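/- **Languages.** Formulas of the modal $\mu$-calculus are in negation normal form, $\varphi ::= \top \mid x \mid p \mid \neg p \mid \varphi\wedge\varphi \mid \varphi\vee\varphi \mid \Diamond\varphi \mid \Box\varphi \mid \nu x.\varphi \mid \mu x.\varphi$, with the usual Kripke semantics ($\nu x.\varphi$ and $\mu x.\varphi$ denote the union and the intersection of the fixed points of $X\mapsto\|\varphi(X)\|$); free variables count as propositional constants, so formulas are taken closed. $\neg\varphi$ is the dual formula, $\dot\Diamond\varphi=\varphi\vee\Diamond\varphi$, $\dot\Box\varphi=\varphi\wedge\Box\varphi$. Tangle logic has $\top, p,\neg,\wedge,\vee,\Diamond,\Box$ and, for finite multisets $\Gamma=\{\varphi_i\}_i$ of its formulas, $\Diamond^\infty\Gamma=\nu x.\bigvee_i\big(\dot\Diamond(\varphi_i\wedge x)\wedge\bigwedge_{j\ne i}\Diamond(\varphi_j\wedge x)\big)$. A model $(M,\sqsubset,\|\cdot\|)$ is wK4 if $a\sqsubset b\sqsubset c$ and $a\neq c$ imply $a\sqsubset c$; $\sqsubseteq$ is the reflexive closure of $\sqsubset$; $(M,w)$ is rooted if $w\sqsubseteq v$ for all $v$;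 $u\prec v$ means $u\sqsubset v\not\sqsubset u$; $C_w=\{u: u\sqsubseteq w\sqsubseteq u\}$ is the cluster of $w$. **Parameters.** Fix $\varphi$. Let $P$ be its set of propositional constants, and $\Sigma$ the closure of $\{\varphi\}$ under $\dot\Diamond$, negation and $sub^*$, where $sub^*$ is the subformula operator which for $\Diamond\psi$, $\Box\psi$ returns $\psi$ and its $sub^*$, and for $\sigma x.\psi$ ($\sigma=\nu,\mu$) returns $\psi(x_{\sigma x.\psi})$ and its $sub^*$; variables $x_{\sigma x.\psi}$ are always read as the closed formula they are named after. $\Sigma$ is taken finite, by keeping for each formula obtained by $sub^*$ and its negation only the seven affirmative S4-modalities of $\dot\Diamond$. Bisimilarity $\rightleftharpoons$ is global $P$-bisimilarity. **Finality and depth.** $w$ is $\Sigma$-final if for some $\psi\in\Sigma$, $w\vDash\psi$ and every $u\sqsupset w$ with $u\vDash\psi$ satisfies $u\sqsubset w$. $M^\Sigma$ is the set of $\Sigma$-final worlds; $M$ is final if $M^\Sigma=M$, and a rooted $(M,w)$ is semifinal if $M\setminus C_w\subseteq M^\Sigma$. $dpt(w)$ is the maximal $k$ with $w\prec v_1\prec\dots\prec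 v_k$, all $v_i\in M^\Sigma$. $w\vDash\overline{\langle n\rangle}\psi$ means that $v\vDash\psi$ for some $v\in M^\Sigma$ with $w\sqsubseteq v$, $dpt(v)=n$. Let $\Theta_{<k}(w)$ be the set of the (formal) $\overline{\langle m\rangle}\psi$ with $m<k$, $\psi\in\Sigma$ that hold at $w$. **Chains.** Clusters are considered up to $\rightleftharpoons$, and represented by nonempty irreflexive clusters with at most two points of each $P$-type (every finite cluster is bisimilar to exactly one such, up to isomorphism). $C'\vartriangleleft$-smaller, written $C'\subset_+C$, means that $C'$ is bisimilar to a subset of $C$ but not to $C$. For pairs, $\langle C',\Theta'\rangle\vartriangleleft\langle C,\Theta\rangle$ iff $C'\subset_+C$ and $\Theta'=\Theta$; $\trianglelefteq$ is the reflexive closure. $\left[{M \atop C}\right]$ is $M$ with the cluster $C$ put below it. A (semi-)witnessing chain of depth $n$ for a (semi)final finite rooted wK4 model $(M,w)$ with $dpt(w)=n$ is a sequence $\mathcal C=\langle C_i,\Theta_i\rangle_{i\le n}$ such that for some worlds $w=v_n\prec\dots\prec v_0$: $C_i$ is the cluster of $v_i$, $\Theta_i=\Theta_{<dpt(v_i)}(v_i)$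 with $dpt(v_i)=i$, and for $i<n$, if $\left[{C_i\atop C_{i+1}}\right]\rightleftharpoons C_i$ then $\Theta_{i+1}\neq\Theta_{<i+1}(v_i)$. $Chain_n$ and $Chain^*_n$ are the sets of all witnessing and semi-witnessing chains of depth $n$; $supp(n,\psi)$ is the set of witnessing chains of depth $n$ for models whose root satisfies $\psi$. $\mathcal C{\upharpoonright}n$ is $\mathcal C$ without its last pair. For $\mathcal C$ of depth $n\ge1$, $Ir(\mathcal C)$ says that $\langle C_n,\Theta_n\rangle\trianglelefteq\langle C_{n-1},\Theta'\rangle$, where $\Theta'=\Theta_{<n}(w)$ for the root $w$ of a semifinal model of depth $n-1$ with $C_w=C_{n-1}$, $\Theta_{<n-1}(w)=\Theta_{n-1}$, and that some point of $C_n$ sees no point of $C_n$ of its own $P$-type. **Formulas.** $\tau_w$ is the conjunction of the literals over $P$ true at $w$. By simultaneous recursion on $n=$ depth of $\mathcal C$: * $A_n(\Theta)$ is the conjunction over $m<n$, $\psi\in\Sigma$ of $\langle m\rangle\psi$ if $\overline{\langle m\rangle}\psi\in\Theta$, and of $\neg\langle m\rangle\psi$ otherwise; * $\tau^{\mathcal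 C}_w$ is $\tau_w\wedge A_n(\Theta_n)\wedge\Diamond(\tau_w\wedge\delta(\mathcal C{\upharpoonright}n))$ if $n\geq1$ and $Ir(\mathcal C)$, $\tau_w\wedge A_n(\Theta_n)\wedge\Diamond\delta(\mathcal C{\upharpoonright}n)$ if $n\ge1$ and not $Ir(\mathcal C)$, and $\tau_w\wedge A_0(\Theta_0)$ if $n=0$; * $\alpha(\mathcal C)=\Diamond^\infty\{\tau^{\mathcal C}_w: w\in C_n\}$ (a multiset indexed by the points of $C_n$); * $\beta(\mathcal C)=\Box\big(\bigvee\alpha(\mathcal C')\to\alpha(\mathcal C)\big)$ over $\mathcal C'\in Chain_n$ with $\langle C'_n,\Theta'_n\rangle\vartriangleleft\langle C_n,\Theta_n\rangle$; * $\gamma(\mathcal C)=\neg\bigvee\alpha(\mathcal C')$ over $\mathcal C'\in Chain_n$ with $\langle C'_n,\Theta'_n\rangle\not\trianglelefteq\langle C_n,\Theta_n\rangle$; * $\delta(\mathcal C)=\alpha(\mathcal C)\wedge\beta(\mathcal C)\wedge\gamma(\mathcal C)$, and $\langle n\rangle\psi=\bigvee_{\mathcal C\in supp(n,\psi)}\dot\Diamond\delta(\mathcal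 C)$. Further, $split(n)=\bigvee\big(\dot\Diamond\delta(\mathcal C)\wedge\dot\Diamond\delta(\mathcal C')\big)\vee\bigvee_{\mathcal C_0\in Chain^*_{n+1}\setminus Chain_{n+1}}\alpha(\mathcal C_0)$, the first disjunction over $\mathcal C,\mathcal C'\in Chain_n$ with $\langle C_n,\Theta_n\rangle\ne\langle C'_n,\Theta'_n\rangle$. Let $eval(\varphi,n)$ be the set of triples $\langle w,\mathcal C,\Theta\rangle$ ($w$ given by its $P$-type) such that for some finite rooted semifinal wK4 model $(M,w)$ with $w\vDash\varphi$ and $\Theta=\Theta_{<dpt(w)}(w)$: either $w\notin M^\Sigma$, $dpt(w)=n+1$, $\mathcal C=\emptyset$; or $w\in M^\Sigma$, $dpt(w)=n$ and $\mathcal C$ is a witnessing chain of depth $n$ for $(M,w)$. Let $\chi_0(w,\mathcal C,\Theta,n)$ be $\langle n\rangle\top\wedge\neg\langle n+1\rangle\top\wedge\neg split(n)\wedge\tau_w\wedge\dot\Diamond\delta(\mathcal C)$ if $\mathcal C\ne\emptyset$, and $\langle n\rangle\top\wedge\neg\langle n+1\rangle\top\wedge split(n)\wedge\tau_w\wedge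 A_{n+1}(\Theta)$ if $\mathcal C=\emptyset$. Finally $$\chi(\varphi)=\bigvee_{n<|\Sigma|}\ \bigvee_{\langle w,\mathcal C,\Theta\rangle\in eval(\varphi,n)}\chi_0(w,\mathcal C,\Theta,n),$$ a formula of tangle logic (final worlds have depth less than $|\Sigma|$). **Theorem.** For every formula $\varphi$ of the modal $\mu$-calculus and every finite rooted wK4 model $(M,w)$: $\ w\vDash_M\varphi$ if and only if $w\vDash_M\chi(\varphi)$. -/

import Mathlib

noncomputable section

namespace TangleLogic

open scoped Classical

/-! ### The modal mu-calculus -/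

/-- Formulas of the modal mu-calculus in negation normal form, with propositional constants in `ℕ`.
`MuForm n` are the formulas with (at most) the free fixed-point variables `0, …, n - 1`, in de Bruijn
style: `nu` and `mu` bind variable `0`. The closed formulas are `MuForm 0`. -/
inductive MuForm : ℕ → Type
  | top {n : ℕ} : MuForm n
  | var {n : ℕ} (i : Fin n) : MuForm n
  | atom {n : ℕ} (p : ℕ) : MuForm n
  | natom {n : ℕ} (p : ℕ) : MuForm n
  | and {n : ℕ} (φ ψ : MuForm n) : MuForm n
  | or {n : ℕ} (φ ψ : MuForm n) : MuForm n
  | dia {n : ℕ} (φ : MuForm n) : MuForm n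
  | box {n : ℕ} (φ : MuForm n) : MuForm n
  | nu {n : ℕ} (φ : MuForm (n + 1)) : MuForm n
  | mu {n : ℕ} (φ : MuForm (n + 1)) : MuForm n

namespace MuForm

def rename : {n m : ℕ} → (Fin n → Fin m) → MuForm n → MuForm m
  | _, _, _, top => top
  | _, _, f, var i => var (f i)
  | _, _, _, atom p => atom p
  | _, _, _, natom p => natom p
  | _, _, f, and φ ψ => and (φ.rename f) (ψ.rename f)
  | _, _, f, or φ ψ => or (φ.rename f) (ψ.rename f)
  | _, _, f, dia φ => dia (φ.rename f)
  | _, _, f, box φ => box (φ.rename f)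
  | _, _, f, nu φ => nu (φ.rename (Fin.cons 0 fun i => (f i).succ))
  | _, _, f, mu φ => mu (φ.rename (Fin.cons 0 fun i => (f i).succ))

/-- Simultaneous (capture-avoiding) substitution for the free variables. -/
def subst : {n m : ℕ} → (Fin n → MuForm m) → MuForm n → MuForm m
  | _, _, _, top => top
  | _, _, s, var i => s i
  | _, _, _, atom p => atom p
  | _, _, _, natom p => natom p
  | _, _, s, and φ ψ => and (φ.subst s) (ψ.subst s)
  | _, _, s, or φ ψ => or (φ.subst s) (ψ.subst s)
  | _, _, s, dia φ => dia (φ.subst s)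
  | _, _, s, box φ => box (φ.subst s)
  | _, _, s, nu φ => nu (φ.subst (Fin.cons (var 0) fun i => (s i).rename Fin.succ))
  | _, _, s, mu φ => mu (φ.subst (Fin.cons (var 0) fun i => (s i).rename Fin.succ))

/-- Negation. Bound variables are left alone, because `¬ νx.φ(x)` is `μx.¬φ(¬x)`; there is no
primitive falsum, so `¬ ⊤` is `μx.x`. -/
def neg : {n : ℕ} → MuForm n → MuForm n
  | _, top => mu (var 0)
  | _, var i => var i
  | _, atom p => natom p
  | _, natom p => atom p
  | _, and φ ψ => or φ.neg ψ.neg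
  | _, or φ ψ => and φ.neg ψ.neg
  | _, dia φ => box φ.neg
  | _, box φ => dia φ.neg
  | _, nu φ => mu φ.neg
  | _, mu φ => nu φ.neg

/-- The reflexive diamond `φ ∨ ◇φ`. -/
def rdia {n : ℕ} (φ : MuForm n) : MuForm n := or φ (dia φ)

/-- The reflexive box `φ ∧ □φ`. -/
def rbox {n : ℕ} (φ : MuForm n) : MuForm n := and φ (box φ)

/-- The propositional constants occurring in a formula. -/
def atoms : {n : ℕ} → MuForm n → Finset ℕ
  | _, top => ∅
  | _, var _ => ∅
  | _, atom p => {p}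
  | _, natom p => {p}
  | _, and φ ψ => φ.atoms ∪ ψ.atoms
  | _, or φ ψ => φ.atoms ∪ ψ.atoms
  | _, dia φ => φ.atoms
  | _, box φ => φ.atoms
  | _, nu φ => φ.atoms
  | _, mu φ => φ.atoms

/-- The closed forms of the elements of `sub*`: the environment `s` gives, for each free variable,
the closed fixed-point formula after which the variable is named. The separate clause of `sub*` for
formulas `ψ ∨ ◇ψ` and `ψ ∧ □ψ` (which only leaves out the formula itself) is not needed, because
`sub*` is used only inside `sigma`, which is closed under the reflexive modalities. -/
def subStar : {n : ℕ} → (Fin n → MuForm 0) → MuForm n → Finset (MuForm 0)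
  | _, _, top => {top}
  | _, s, var i => {s i}
  | _, _, atom p => {atom p}
  | _, _, natom p => {natom p, atom p}
  | _, s, and φ ψ => {(and φ ψ).subst s} ∪ (subStar s φ ∪ subStar s ψ)
  | _, s, or φ ψ => {(or φ ψ).subst s} ∪ (subStar s φ ∪ subStar s ψ)
  | _, s, dia φ => {φ.subst s} ∪ subStar s φ
  | _, s, box φ => {φ.subst s} ∪ subStar s φ
  | _, s, nu φ => {φ.subst (Fin.cons ((nu φ).subst s) s)} ∪ subStar (Fin.cons ((nu φ).subst s) s) φ
  | _, s, mu φ => {φ.subst (Fin.cons ((mu φ).subst s) s)} ∪ subStar (Fin.cons ((mu φ).subst s) s) φ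

/-- The seven affirmative S4-modalities of the reflexive diamond, applied to `ψ`. -/
def modalities (ψ : MuForm 0) : Finset (MuForm 0) :=
  {ψ, ψ.rdia, ψ.rbox, ψ.rbox.rdia, ψ.rdia.rbox, ψ.rdia.rbox.rdia, ψ.rbox.rdia.rbox}

/-- The closure of `{φ}` under `sub*`, negation and the reflexive diamond: a finite set containing
one representative of every element of the closure up to equivalence over weakly transitive frames
(where the reflexive diamond is an S4-modality, so fourteen modalities suffice). -/
def sigma (φ : MuForm 0) : Finset (MuForm 0) :=
  (insert φ (subStar Fin.elim0 φ)).biUnion fun ψ => ψ.modalities ∪ ψ.neg.modalities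

end MuForm

/-! ### Kripke models -/

structure KModel (W : Type*) where
  rel : W → W → Prop
  val : ℕ → Set W

namespace KModel

variable {W V : Type*}

/-- The downset of `A`. -/
def diaSet (M : KModel W) (A : Set W) : Set W := {w | ∃ v, M.rel w v ∧ v ∈ A}

def boxSet (M : KModel W) (A : Set W) : Set W := {w | ∀ v, M.rel w v → v ∈ A}

/-- The truth set of a formula, given values of its free variables. -/
def truth (M : KModel W) : {n : ℕ} → MuForm n → (Fin n → Set W) → Set W
  | _, .top, _ => Set.univ
  | _, .var i, ρ => ρ i
  | _, .atom p, _ => M.val p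
  | _, .natom p, _ => (M.val p)ᶜ
  | _, .and φ ψ, ρ => M.truth φ ρ ∩ M.truth ψ ρ
  | _, .or φ ψ, ρ => M.truth φ ρ ∪ M.truth ψ ρ
  | _, .dia φ, ρ => M.diaSet (M.truth φ ρ)
  | _, .box φ, ρ => M.boxSet (M.truth φ ρ)
  | _, .nu φ, ρ => ⋃₀ {X | X = M.truth φ (Fin.cons X ρ)}
  | _, .mu φ, ρ => ⋂₀ {X | X = M.truth φ (Fin.cons X ρ)}

/-- `w ⊨ φ` for a closed formula `φ`. -/
def Sat (M : KModel W) (w : W) (φ : MuForm 0) : Prop := w ∈ M.truth φ Fin.elim0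

def WeaklyTransitive (M : KModel W) : Prop :=
  ∀ a b c, a ≠ c → M.rel a b → M.rel b c → M.rel a c

/-- The reflexive closure of the accessibility relation. -/
def rrel (M : KModel W) (u v : W) : Prop := u = v ∨ M.rel u v

def IsRoot (M : KModel W) (w : W) : Prop := ∀ v, M.rrel w v

/-- `v` lies strictly above `u`. -/
def Below (M : KModel W) (u v : W) : Prop := M.rel u v ∧ ¬ M.rel v u

/-- The cluster of `w`. -/
def cluster (M : KModel W) (w : W) : Set W := {u | M.rrel w u ∧ M.rrel u w}

def restrict (M : KModel W) (A : Set W) : KModel A where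
  rel u v := M.rel u v
  val p := {u | (u : W) ∈ M.val p}

/-- The model obtained by putting the (cluster) model `C` underneath `M`. -/
def stack (M : KModel W) (C : KModel V) : KModel (W ⊕ V) where
  rel
    | .inl a, .inl b => M.rel a b
    | .inr a, .inr b => C.rel a b
    | .inr _, .inl _ => True
    | .inl _, .inr _ => False
  val p := {x | Sum.elim (fun a => a ∈ M.val p) (fun a => a ∈ C.val p) x}

/-- (Global) `P`-bisimilarity of models. -/
def Bisimilar (P : Finset ℕ) (M : KModel W) (N : KModel V) : Prop :=
  ∃ ι : W → V → Prop,
    (∀ u v, ι u v → ∀ p ∈ P, (u ∈ M.val p ↔ v ∈ N.val p)) ∧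
    (∀ u v u', ι u v → M.rel u u' → ∃ v', N.rel v v' ∧ ι u' v') ∧
    (∀ u v v', ι u v → N.rel v v' → ∃ u', M.rel u u' ∧ ι u' v') ∧
    (∀ u, ∃ v, ι u v) ∧ (∀ v, ∃ u, ι u v)

/-- `w` is `S`-final. -/
def Final (M : KModel W) (S : Finset (MuForm 0)) (w : W) : Prop :=
  ∃ φ ∈ S, M.Sat w φ ∧ ∀ u, M.rel w u → M.Sat u φ → M.rel u w

/-- All worlds are `S`-final. -/
def IsFinal (M : KModel W) (S : Finset (MuForm 0)) : Prop := ∀ u, M.Final S u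

/-- All worlds outside the cluster of `w` are `S`-final. -/
def IsSemifinal (M : KModel W) (S : Finset (MuForm 0)) (w : W) : Prop :=
  ∀ u, u ∉ M.cluster w → M.Final S u

/-- There is a strictly ascending sequence of `k` worlds of the `S`-final part strictly above `w`. -/
def DepthGE (M : KModel W) (S : Finset (MuForm 0)) : ℕ → W → Prop
  | 0, _ => True
  | k + 1, w => ∃ v, M.Final S v ∧ M.Below w v ∧ M.DepthGE S k v

/-- The `S`-depth of `w` is `n`. -/
def HasDepth (M : KModel W) (S : Finset (MuForm 0)) (w : W) (n : ℕ) : Prop :=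
  M.DepthGE S n w ∧ ¬ M.DepthGE S (n + 1) w

/-- `w ⊨ ⟨n⟩‾ φ`: some `S`-final world of `S`-depth `n`, equal to `w` or above it, satisfies `φ`. -/
def DepthDia (M : KModel W) (S : Finset (MuForm 0)) (n : ℕ) (φ : MuForm 0) (w : W) : Prop :=
  ∃ v, M.Final S v ∧ M.rrel w v ∧ M.HasDepth S v n ∧ M.Sat v φ

/-- The set of all `⟨m⟩‾ ψ` with `m < n` and `ψ ∈ S` that hold at `w`; the pair `(m, ψ)` stands for
`⟨m⟩‾ ψ`. -/
def theta (M : KModel W) (S : Finset (MuForm 0)) (n : ℕ) (w : W) : Finset (ℕ × MuForm 0) :=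
  (Finset.range n ×ˢ S).filter fun q => M.DepthDia S q.1 q.2 w

/-- The set of propositional constants from `P` that hold at `w`. -/
def typeAt (M : KModel W) (P : Finset ℕ) (w : W) : Finset ℕ := P.filter fun p => w ∈ M.val p

end KModel

/-! ### Clusters up to bisimilarity

Every finite cluster of a weakly transitive model is `P`-bisimilar to an irreflexive cluster in which
at most two points have the same `P`-type (a reflexive point becomes two irreflexive ones), and to
exactly one up to isomorphism. Such a cluster is given by the multiset of the types of its points. -/

/-- The irreflexive cluster given by a multiset of types. -/
def clusterModel (K : Multiset (Finset ℕ)) : KModel K.ToType where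
  rel a b := a ≠ b
  val p := {a | p ∈ a.1}

/-- The representatives of the bisimilarity classes of (nonempty) clusters. -/
def clusterReps (P : Finset ℕ) : Finset (Multiset (Finset ℕ)) :=
  ((2 • P.powerset.val).powerset.toFinset).erase 0

/-- `K` represents the cluster of `w`. -/
def Represents {W : Type*} (P : Finset ℕ) (M : KModel W) (w : W) (K : Multiset (Finset ℕ)) : Prop :=
  K ∈ clusterReps P ∧ KModel.Bisimilar P (M.restrict (M.cluster w)) (clusterModel K)

/-- `K` is bisimilar to a subset of `K'`, but not to `K'`. -/
def SmallerCluster (P : Finset ℕ) (K K' : Multiset (Finset ℕ)) : Prop :=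
  (∃ K'' ≤ K', KModel.Bisimilar P (clusterModel K) (clusterModel K'')) ∧
    ¬ KModel.Bisimilar P (clusterModel K) (clusterModel K')

/-- A pair `⟨C, Θ⟩` of a cluster (up to bisimilarity) and a set of formulas `⟨m⟩‾ ψ`. -/
abbrev CPair := Multiset (Finset ℕ) × Finset (ℕ × MuForm 0)

/-- `⟨C', Θ'⟩ ⊲ ⟨C, Θ⟩`. -/
def PairLT (P : Finset ℕ) (c' c : CPair) : Prop := SmallerCluster P c'.1 c.1 ∧ c'.2 = c.2

/-- `⟨C', Θ'⟩ ⊴ ⟨C, Θ⟩`. -/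
def PairLE (P : Finset ℕ) (c' c : CPair) : Prop := PairLT P c' c ∨ c' = c

/-! ### Witnessing chains -/

/-- Sequences `⟨C_0, Θ_0⟩, …, ⟨C_n, Θ_n⟩`, where `C_n` is the lowest cluster. -/
abbrev CSeq (n : ℕ) := Fin (n + 1) → CPair

/-- The sequence without its lowest pair. -/
def CSeq.init {n : ℕ} (c : CSeq (n + 1)) : CSeq n := fun i => c i.castSucc

def CSeq.last {n : ℕ} (c : CSeq n) : CPair := c (Fin.last n)

/-- The clusters of certain worlds `v_n = w ≺ … ≺ v_0` of depths `n, …, 0`, together with the sets of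
formulas `⟨m⟩‾ ψ` true there, form the sequence `c`; and, for each `i`, if putting `C_{i+1}` below
`C_i` yields a model bisimilar to `C_i`, then `Θ_{i+1}` differs from `Θ_i^{C_i}`. (If the worlds above
the cluster of `w` are final and `w` has depth `n`, then `v_i` has depth `i` automatically.) -/
def RealizesAt {W : Type*} (P : Finset ℕ) (S : Finset (MuForm 0)) (M : KModel W) {n : ℕ}
    (c : CSeq n) (w : W) : Prop :=
  ∃ v : Fin (n + 1) → W, v (Fin.last n) = w ∧
    (∀ i : Fin (n + 1), M.HasDepth S (v i) i ∧ Represents P M (v i) (c i).1 ∧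
      (c i).2 = M.theta S i (v i)) ∧
    (∀ i : Fin n, M.Below (v i.succ) (v i.castSucc)) ∧
    (∀ i : Fin n,
      KModel.Bisimilar P ((clusterModel (c i.castSucc).1).stack (clusterModel (c i.succ).1))
        (clusterModel (c i.castSucc).1) →
      (c i.succ).2 ≠ M.theta S (i + 1) (v i.castSucc))

/-- `(M, w)` is an `S`-final rooted weakly transitive model, and `c` is a witnessing chain for it. -/
def IsWitnessing {W : Type*} (P : Finset ℕ) (S : Finset (MuForm 0)) (M : KModel W) (w : W) {n : ℕ}
    (c : CSeq n) : Prop :=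
  M.WeaklyTransitive ∧ M.IsRoot w ∧ M.IsFinal S ∧ RealizesAt P S M c w

/-- `(M, w)` is an `S`-semifinal rooted weakly transitive model, and `c` is a semi-witnessing chain
for it. -/
def IsSemiWitnessing {W : Type*} (P : Finset ℕ) (S : Finset (MuForm 0)) (M : KModel W) (w : W)
    {n : ℕ} (c : CSeq n) : Prop :=
  M.WeaklyTransitive ∧ M.IsRoot w ∧ M.IsSemifinal S w ∧ RealizesAt P S M c w

/-- All sequences of depth `n` that can occur. -/
def allSeqs (P : Finset ℕ) (S : Finset (MuForm 0)) (n : ℕ) : Finset (CSeq n) :=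
  Fintype.piFinset fun i : Fin (n + 1) => clusterReps P ×ˢ (Finset.range i ×ˢ S).powerset

/-- The witnessing chains of depth `n` of finite models. -/
def chains (P : Finset ℕ) (S : Finset (MuForm 0)) (n : ℕ) : Finset (CSeq n) :=
  (allSeqs P S n).filter fun c =>
    ∃ (k : ℕ) (M : KModel (Fin k)) (w : Fin k), IsWitnessing P S M w c

/-- The semi-witnessing chains of depth `n` of finite models. -/
def semiChains (P : Finset ℕ) (S : Finset (MuForm 0)) (n : ℕ) : Finset (CSeq n) :=
  (allSeqs P S n).filter fun c =>
    ∃ (k : ℕ) (M : KModel (Fin k)) (w : Fin k), IsSemiWitnessing P S M w c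

/-- The witnessing chains of finite models whose designated root satisfies `φ`. -/
def supp (P : Finset ℕ) (S : Finset (MuForm 0)) (n : ℕ) (φ : MuForm 0) : Finset (CSeq n) :=
  (allSeqs P S n).filter fun c =>
    ∃ (k : ℕ) (M : KModel (Fin k)) (w : Fin k), IsWitnessing P S M w c ∧ M.Sat w φ

/-- `Θ'` is `Θ^C` for the semi-satisfaction pair `⟨C, Θ⟩` of depth `n`. -/
def IsThetaUp (P : Finset ℕ) (S : Finset (MuForm 0)) (n : ℕ) (c : CPair)
    (Θ' : Finset (ℕ × MuForm 0)) : Prop :=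
  ∃ (k : ℕ) (M : KModel (Fin k)) (w : Fin k), M.WeaklyTransitive ∧ M.IsRoot w ∧
    M.IsSemifinal S w ∧ M.HasDepth S w n ∧ Represents P M w c.1 ∧ c.2 = M.theta S n w ∧
    Θ' = M.theta S (n + 1) w

/-- The condition `Ir`: `⟨C_{n+1}, Θ_{n+1}⟩ ⊴ ⟨C_n, Θ_n^{C_n}⟩`, and some point of `C_{n+1}` sees no
point of `C_{n+1}` of its own type. -/
def Ir (P : Finset ℕ) (S : Finset (MuForm 0)) {n : ℕ} (c : CSeq (n + 1)) : Prop :=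
  (∃ Θ', IsThetaUp P S n c.init.last Θ' ∧ PairLE P c.last (c.init.last.1, Θ')) ∧
    ∃ a : c.last.1.ToType, ∀ b, (clusterModel c.last.1).rel a b → a.1 ≠ b.1

/-! ### Tangle logic -/

/-- Formulas of tangle logic; `tangle k Γ` is the tangle modality applied to the finite multiset
`Γ 0, …, Γ (k - 1)`. -/
inductive TForm : Type
  | top : TForm
  | atom (p : ℕ) : TForm
  | neg (φ : TForm) : TForm
  | and (φ ψ : TForm) : TForm
  | or (φ ψ : TForm) : TForm
  | dia (φ : TForm) : TForm
  | box (φ : TForm) : TForm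
  | tangle (k : ℕ) (Γ : Fin k → TForm) : TForm

/-- The truth set of a formula of tangle logic. The tangle modality is
`νx. ⋁_i (((φ_i ∧ x) ∨ ◇(φ_i ∧ x)) ∧ ⋀_{j ≠ i} ◇(φ_j ∧ x))`. -/
def KModel.truthT {W : Type*} (M : KModel W) : TForm → Set W
  | .top => Set.univ
  | .atom p => M.val p
  | .neg φ => (M.truthT φ)ᶜ
  | .and φ ψ => M.truthT φ ∩ M.truthT ψ
  | .or φ ψ => M.truthT φ ∪ M.truthT ψ
  | .dia φ => M.diaSet (M.truthT φ)
  | .box φ => M.boxSet (M.truthT φ)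
  | .tangle k Γ => ⋃₀ {X | X = ⋃ i : Fin k,
      ((M.truthT (Γ i) ∩ X) ∪ M.diaSet (M.truthT (Γ i) ∩ X)) ∩
        ⋂ j : Fin k, ⋂ _ : j ≠ i, M.diaSet (M.truthT (Γ j) ∩ X)}

def KModel.SatT {W : Type*} (M : KModel W) (w : W) (φ : TForm) : Prop := w ∈ M.truthT φ

namespace TForm

def bot : TForm := neg top

def imp (φ ψ : TForm) : TForm := or (neg φ) ψ

/-- The reflexive diamond `φ ∨ ◇φ`. -/
def rdia (φ : TForm) : TForm := or φ (dia φ)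

/-- Finite disjunction. -/
def bigOr {ι : Type*} (s : Finset ι) (f : ι → TForm) : TForm := (s.toList.map f).foldr or bot

/-- Finite conjunction. -/
def bigAnd {ι : Type*} (s : Finset ι) (f : ι → TForm) : TForm := (s.toList.map f).foldr and top

/-- The tangle modality applied to the multiset `{f a : a ∈ s}`. -/
def bigTangle {ι : Type*} (s : Multiset ι) (f : ι → TForm) : TForm :=
  tangle s.toList.length fun i => f (s.toList.get i)

end TForm

/-! ### The structural formulas

The formulas `δ` are defined by recursion on the depth. In the following definitions, `d` is the
assignment of the formulas `δ(C)` to sequences, of which only the values at depths smaller than `n`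
are used for `A(Θ)`, `α`, `β`, `γ` at depth `n`. -/

section Steps

variable (P : Finset ℕ) (S : Finset (MuForm 0)) (d : (m : ℕ) → CSeq m → TForm)

/-- `τ_w` for a world `w` of type `t`. -/
def tauF (t : Finset ℕ) : TForm :=
  TForm.bigAnd P fun p => if p ∈ t then TForm.atom p else TForm.neg (TForm.atom p)

/-- `⟨n⟩ φ`. -/
def angleF (n : ℕ) (φ : MuForm 0) : TForm :=
  TForm.bigOr (supp P S n φ) fun c => (d n c).rdia

/-- `A(Θ)`, where `Θ` is a set of formulas `⟨m⟩‾ ψ` with `m < n`. -/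
def aF (n : ℕ) (Θ : Finset (ℕ × MuForm 0)) : TForm :=
  TForm.bigAnd (Finset.range n ×ˢ S) fun q =>
    if q ∈ Θ then angleF P S d q.1 q.2 else TForm.neg (angleF P S d q.1 q.2)

/-- `τ_w^C` for a point `w` of type `t` of the lowest cluster; at depth `0` there is nothing above
the lowest cluster to be described. -/
def tauChainF : {n : ℕ} → CSeq n → Finset ℕ → TForm
  | 0, c, t => TForm.and (tauF P t) (aF P S d 0 c.last.2)
  | n + 1, c, t =>
    if Ir P S c then
      TForm.and (TForm.and (tauF P t) (aF P S d (n + 1) c.last.2))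
        (TForm.dia (TForm.and (tauF P t) (d n c.init)))
    else
      TForm.and (TForm.and (tauF P t) (aF P S d (n + 1) c.last.2)) (TForm.dia (d n c.init))

def alphaF {n : ℕ} (c : CSeq n) : TForm := TForm.bigTangle c.last.1 (tauChainF P S d c)

def betaF {n : ℕ} (c : CSeq n) : TForm :=
  TForm.box (TForm.imp
    (TForm.bigOr ((chains P S n).filter fun c' => PairLT P c'.last c.last) fun c' =>
      alphaF P S d c')
    (alphaF P S d c))

def gammaF {n : ℕ} (c : CSeq n) : TForm :=
  TForm.neg (TForm.bigOr ((chains P S n).filter fun c' => ¬ PairLE P c'.last c.last) fun c' =>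
    alphaF P S d c')

end Steps

section Formulas

variable (P : Finset ℕ) (S : Finset (MuForm 0))

/-- `δ(C) = α(C) ∧ β(C) ∧ γ(C)`. -/
def delta (n : ℕ) (c : CSeq n) : TForm :=
  let d : (m : ℕ) → CSeq m → TForm := fun m c' => if _h : m < n then delta m c' else TForm.bot
  TForm.and (TForm.and (alphaF P S d c) (betaF P S d c)) (gammaF P S d c)
termination_by n

/-- `α(C)`. -/
def alpha {n : ℕ} (c : CSeq n) : TForm := alphaF P S (delta P S) c

/-- `⟨n⟩ φ`. -/
def angle (n : ℕ) (φ : MuForm 0) : TForm := angleF P S (delta P S) n φ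

/-- The formula `split(n)`. -/
def split (n : ℕ) : TForm :=
  TForm.or
    (TForm.bigOr ((chains P S n ×ˢ chains P S n).filter fun q => q.1.last ≠ q.2.last) fun q =>
      TForm.and (delta P S n q.1).rdia (delta P S n q.2).rdia)
    (TForm.bigOr (semiChains P S (n + 1) \ chains P S (n + 1)) fun c => alpha P S c)

/-- The triples `⟨w, C, Θ⟩` of `eval(φ, n)`, where `w` is given by its type, and `none` stands for
`C = ∅`. As `Θ` consists of the formulas `⟨m⟩‾ ψ` with `m` less than the depth of `w`, that the depth
of `Θ` is `n` means that `w` has depth `n + 1`. -/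
def evalTriples (φ : MuForm 0) (n : ℕ) :
    Finset (Finset ℕ × Option (CSeq n) × Finset (ℕ × MuForm 0)) :=
  (P.powerset ×ˢ Finset.insertNone (allSeqs P S n) ×ˢ (Finset.range (n + 1) ×ˢ S).powerset).filter
    fun q => ∃ (k : ℕ) (M : KModel (Fin k)) (w : Fin k),
      M.WeaklyTransitive ∧ M.IsRoot w ∧ M.IsSemifinal S w ∧ M.Sat w φ ∧ q.1 = M.typeAt P w ∧
      ((¬ M.Final S w ∧ M.HasDepth S w (n + 1) ∧ q.2.2 = M.theta S (n + 1) w ∧ q.2.1 = none) ∨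
        (M.Final S w ∧ M.HasDepth S w n ∧ q.2.2 = M.theta S n w ∧
          ∃ c, q.2.1 = some c ∧ IsWitnessing P S M w c))

/-- The formula `χ₀(w, C, Θ, n)`. -/
def chi0 (n : ℕ) : Finset ℕ × Option (CSeq n) × Finset (ℕ × MuForm 0) → TForm
  | (t, some c, _) =>
    TForm.and (TForm.and (angle P S n .top) (TForm.neg (angle P S (n + 1) .top)))
      (TForm.and (TForm.neg (split P S n)) (TForm.and (tauF P t) (delta P S n c).rdia))
  | (t, none, Θ) =>
    TForm.and (TForm.and (angle P S n .top) (TForm.neg (angle P S (n + 1) .top)))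
      (TForm.and (split P S n) (TForm.and (tauF P t) (aF P S (delta P S) (n + 1) Θ)))

end Formulas

/-- The characteristic formula `χ(φ)`. The disjunction over `n` may stop at the number of elements of
`sigma φ`: a strictly ascending sequence of final worlds needs a new formula for each of its worlds,
so no final world has depth `|sigma φ|` or more. -/
def chi (φ : MuForm 0) : TForm :=
  TForm.bigOr (Finset.range φ.sigma.card) fun n =>
    TForm.bigOr (evalTriples φ.atoms φ.sigma φ n) fun q => chi0 φ.atoms φ.sigma n q

end TangleLogic

end

/-!
The truth of the formulas of `Σ = sigma φ` at a world of a finite weakly transitive model depends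
on very little. Call two worlds related if they have the same type and if every successor of one
either is matched by a related successor of the other or satisfies only formulas of `Σ` that also
hold at successors of the other. Such a bisimulation up to `Σ` preserves all formulas of `Σ`
(`KModel.SBisim.sat_iff`); the proof is an induction on formulas in which the closed fixed-point
formulas named by the bound variables bound the approximations of the fixed points. As a formula
true at a world that is not final is also true at a final world strictly above, three facts follow.

* Worlds that are not final may be removed (`KModel.FinalEmbedding.sat_iff`), and the formulas true
  at a world that is not final depend only on its type and on the formulas true at final worlds
  above it (`KModel.sat_iff_of_not_final`).
* The formulas true in a cluster of depth `n` depend only on the pair `⟨C, Θ⟩` of this cluster up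
  to bisimilarity and the formulas `⟨m⟩‾ ψ`, `m < n`, true there (`KModel.sat_iff_of_pair_eq`). A
  cluster that contains a copy of a final cluster with the same depth and the same `Θ` is itself
  final (`KModel.final_of_clusterRep_le`).
* If all types of a cluster of depth `n + 1` are repeated in a cluster of depth `n` above it, and
  both see the same formulas at depth at most `n`, then the lower cluster is absorbed by the upper
  one: its points satisfy the same formulas as points of the upper one
  (`KModel.WeaklyTransitive.sat_iff_of_absorbed`). In particular the lower cluster is not final,
  whence final worlds have witnessing chains.

The formulas `δ(C)` are then shown, by induction on the depth, to describe final worlds: final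
worlds of depth `n` satisfy `δ(C)` for their witnessing chains (`KModel.DeltaComplete`), and `δ(C)`
only holds below final worlds of depth `n` with the pair `⟨C_n, Θ_n⟩` (`KModel.DeltaSound`). Here
`α(C)` finds a cluster that contains a copy of `C_n` and sees a final world `u` of depth `n - 1`
(`KModel.exists_of_satT_alpha`). If `u` lies strictly above that cluster, then the cluster has
depth at least `n`; otherwise the copy of `C_n` lies in the cluster of `u` itself, which the
condition on consecutive clusters of a chain and the condition `Ir` exclude
(`KModel.not_embedded_of_mem_semiChains`). The conjuncts `β(C)` and `γ(C)` force `C_n` to be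
maximal, so that it is a whole cluster.

For the characteristic formula, let `n` be the largest depth of a final world above the root `w`.
If `w` is final, it has depth `n` and is described by the pair of its own cluster, and `split(n)`
fails. If `w` is not final and `split(n)` holds, then `w` is described by its type and `Θ`. If `w`
is not final and `split(n)` fails, then the cluster of `w` is absorbed by the final clusters of
depth `n` (`KModel.WeaklyTransitive.absorbed_of_not_satT_split`), since otherwise a chain of such a
cluster could be extended by `w` to a semi-witnessing chain that is not a witnessing chain. So `w`
satisfies the same formulas as a final world, whose chain then occurs in the characteristic
formula.
-/

noncomputable section

namespace TangleLogic

open scoped Classical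

/-! ### Semantics of the modal mu-calculus -/

/-- By the Knaster–Tarski theorem, the union of the fixed points of a monotone operator is its
greatest fixed point. -/
theorem sUnion_fixed_eq_gfp {W : Type*} (F : Set W →o Set W) : ⋃₀ {X | X = F X} = F.gfp := by
  apply subset_antisymm
  · rintro x ⟨X, hX, hx⟩
    exact F.le_gfp (le_of_eq hX) hx
  · intro x hx
    exact ⟨F.gfp, F.map_gfp.symm, hx⟩

theorem sInter_fixed_eq_lfp {W : Type*} (F : Set W →o Set W) : ⋂₀ {X | X = F X} = F.lfp := by
  apply subset_antisymm
  · intro x hx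
    exact hx _ F.map_lfp.symm
  · intro x hx X hX
    exact F.lfp_le (le_of_eq hX.symm) hx

theorem cons_le_cons {W : Type*} {n : ℕ} {X Y : Set W} {ρ ρ' : Fin n → Set W} (h : X ⊆ Y)
    (h' : ∀ i, ρ i ⊆ ρ' i) (i : Fin (n + 1)) :
    (Fin.cons X ρ : Fin (n + 1) → Set W) i ⊆ (Fin.cons Y ρ' : Fin (n + 1) → Set W) i := by
  refine Fin.cases ?_ (fun j => ?_) i
  · simpa using h
  · simpa using h' j

namespace KModel

variable {W V : Type*}

theorem truth_mono (M : KModel W) {n : ℕ} (ψ : MuForm n) {ρ ρ' : Fin n → Set W}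
    (h : ∀ i, ρ i ⊆ ρ' i) : M.truth ψ ρ ⊆ M.truth ψ ρ' := by
  induction ψ with
  | top | atom | natom => exact subset_rfl
  | var i => exact h i
  | and φ ψ ihφ ihψ => exact Set.inter_subset_inter (ihφ h) (ihψ h)
  | or φ ψ ihφ ihψ => exact Set.union_subset_union (ihφ h) (ihψ h)
  | dia φ ih => exact fun w ⟨v, hv, hv'⟩ => ⟨v, hv, ih h hv'⟩
  | box φ ih => exact fun w hw v hv => ih h (hw v hv)
  | nu φ ih =>
    let F : Set W →o Set W := ⟨fun X => M.truth φ (Fin.cons X ρ), fun X Y hXY =>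
      ih (cons_le_cons hXY fun _ => subset_rfl)⟩
    let F' : Set W →o Set W := ⟨fun X => M.truth φ (Fin.cons X ρ'), fun X Y hXY =>
      ih (cons_le_cons hXY fun _ => subset_rfl)⟩
    change ⋃₀ {X | X = F X} ⊆ ⋃₀ {X | X = F' X}
    rw [sUnion_fixed_eq_gfp, sUnion_fixed_eq_gfp]
    exact OrderHom.gfp.monotone (fun X => ih (cons_le_cons subset_rfl h))
  | mu φ ih =>
    let F : Set W →o Set W := ⟨fun X => M.truth φ (Fin.cons X ρ), fun X Y hXY =>
      ih (cons_le_cons hXY fun _ => subset_rfl)⟩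
    let F' : Set W →o Set W := ⟨fun X => M.truth φ (Fin.cons X ρ'), fun X Y hXY =>
      ih (cons_le_cons hXY fun _ => subset_rfl)⟩
    change ⋂₀ {X | X = F X} ⊆ ⋂₀ {X | X = F' X}
    rw [sInter_fixed_eq_lfp, sInter_fixed_eq_lfp]
    exact OrderHom.lfp.monotone (fun X => ih (cons_le_cons subset_rfl h))

/-- The operator `X ↦ ‖φ(X)‖` of which fixed-point formulas denote the extremal fixed points. -/
def op (M : KModel W) {n : ℕ} (φ : MuForm (n + 1)) (ρ : Fin n → Set W) : Set W →o Set W :=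
  ⟨fun X => M.truth φ (Fin.cons X ρ), fun _ _ h =>
    M.truth_mono φ (cons_le_cons h fun _ => subset_rfl)⟩

theorem truth_nu (M : KModel W) {n : ℕ} (φ : MuForm (n + 1)) (ρ : Fin n → Set W) :
    M.truth (.nu φ) ρ = (M.op φ ρ).gfp :=
  sUnion_fixed_eq_gfp (M.op φ ρ)

theorem truth_mu (M : KModel W) {n : ℕ} (φ : MuForm (n + 1)) (ρ : Fin n → Set W) :
    M.truth (.mu φ) ρ = (M.op φ ρ).lfp :=
  sInter_fixed_eq_lfp (M.op φ ρ)

theorem truth_rename (M : KModel W) {n m : ℕ} (φ : MuForm n) (f : Fin n → Fin m)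
    (ρ : Fin m → Set W) : M.truth (φ.rename f) ρ = M.truth φ (ρ ∘ f) := by
  induction φ generalizing m with
  | top | atom | natom | var i => rfl
  | and φ ψ ihφ ihψ | or φ ψ ihφ ihψ => simp only [MuForm.rename, truth, ihφ, ihψ]
  | dia φ ih | box φ ih => simp only [MuForm.rename, truth, ih]
  | nu φ ih | mu φ ih =>
    have key : ∀ X : Set W, (Fin.cons X ρ : Fin (m + 1) → Set W) ∘
        (Fin.cons 0 fun i => (f i).succ) = Fin.cons X (ρ ∘ f) := by
      intro X
      funext i
      refine Fin.cases ?_ (fun j => ?_) i <;> simp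
    simp only [MuForm.rename, truth, ih, key]

theorem truth_subst (M : KModel W) {n m : ℕ} (φ : MuForm n) (s : Fin n → MuForm m)
    (ρ : Fin m → Set W) : M.truth (φ.subst s) ρ = M.truth φ (fun i => M.truth (s i) ρ) := by
  induction φ generalizing m with
  | top | atom | natom | var i => rfl
  | and φ ψ ihφ ihψ | or φ ψ ihφ ihψ => simp only [MuForm.subst, truth, ihφ, ihψ]
  | dia φ ih | box φ ih => simp only [MuForm.subst, truth, ih]
  | nu φ ih | mu φ ih =>
    have key : ∀ X : Set W, (fun i => M.truth ((Fin.cons (MuForm.var 0) fun i =>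
        (s i).rename Fin.succ : Fin _ → MuForm (m + 1)) i) (Fin.cons X ρ)) =
        Fin.cons X (fun i => M.truth (s i) ρ) := by
      intro X
      funext i
      refine Fin.cases ?_ (fun j => ?_) i
      · simp [truth]
      · simp only [Fin.cons_succ, truth_rename]
        congr 1
    simp only [MuForm.subst, truth, ih, key]

/-- The value of a formula under the environment that interprets each variable by the closed formula
it is named after. -/
theorem truth_subst_zero (M : KModel W) {n : ℕ} (φ : MuForm n) (s : Fin n → MuForm 0) :
    M.truth (φ.subst s) Fin.elim0 = M.truth φ (fun i => M.truth (s i) Fin.elim0) :=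
  M.truth_subst φ s _

theorem truth_neg (M : KModel W) {n : ℕ} (φ : MuForm n) (ρ : Fin n → Set W) :
    M.truth φ.neg ρ = (M.truth φ fun i => (ρ i)ᶜ)ᶜ := by
  have hcons : ∀ {n : ℕ} (X : Set W) (ρ : Fin n → Set W),
      (fun i => ((Fin.cons X ρ : Fin (n + 1) → Set W) i)ᶜ) = Fin.cons Xᶜ fun i => (ρ i)ᶜ := by
    intro n X ρ
    funext i
    refine Fin.cases ?_ (fun j => ?_) i <;> simp
  induction φ with
  | top =>
    simp only [MuForm.neg, truth, Set.compl_univ]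
    exact Set.eq_empty_of_subset_empty (Set.sInter_subset_of_mem rfl)
  | var i => simp [MuForm.neg, truth]
  | atom | natom => simp [MuForm.neg, truth]
  | and φ ψ ihφ ihψ => simp only [MuForm.neg, truth, ihφ, ihψ, Set.compl_inter]
  | or φ ψ ihφ ihψ => simp only [MuForm.neg, truth, ihφ, ihψ, Set.compl_union]
  | dia φ ih => ext w; simp [MuForm.neg, truth, ih, diaSet, boxSet]
  | box φ ih => ext w; simp [MuForm.neg, truth, ih, diaSet, boxSet]
  | nu φ ih =>
    simp only [MuForm.neg, truth, ih, hcons]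
    ext w
    simp only [Set.mem_sInter, Set.mem_compl_iff, Set.mem_sUnion, not_exists, not_and,
      Set.mem_ofPred_eq]
    constructor
    · intro h X hX hw
      exact h Xᶜ (by rw [compl_compl, ← hX]) hw
    · intro h X hX
      by_contra hw
      exact h Xᶜ (by conv_lhs => rw [hX, compl_compl]) hw
  | mu φ ih =>
    simp only [MuForm.neg, truth, ih, hcons]
    ext w
    simp only [Set.mem_sInter, Set.mem_compl_iff, Set.mem_sUnion,
      Set.mem_ofPred_eq, not_forall]
    constructor
    · rintro ⟨X, hX, hw⟩
      exact ⟨Xᶜ, by conv_lhs => rw [hX, compl_compl], fun h => h hw⟩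
    · rintro ⟨X, hX, hw⟩
      exact ⟨Xᶜ, by rw [compl_compl, ← hX], hw⟩

theorem sat_neg (M : KModel W) (w : W) (φ : MuForm 0) : M.Sat w φ.neg ↔ ¬ M.Sat w φ := by
  have : (fun i => ((Fin.elim0 : Fin 0 → Set W) i)ᶜ) = Fin.elim0 := Subsingleton.elim _ _
  simp [Sat, truth_neg, this]

theorem sat_or (M : KModel W) (w : W) (φ ψ : MuForm 0) :
    M.Sat w (.or φ ψ) ↔ M.Sat w φ ∨ M.Sat w ψ := Iff.rfl

theorem sat_and (M : KModel W) (w : W) (φ ψ : MuForm 0) :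
    M.Sat w (.and φ ψ) ↔ M.Sat w φ ∧ M.Sat w ψ := Iff.rfl

theorem sat_dia (M : KModel W) (w : W) (φ : MuForm 0) :
    M.Sat w (.dia φ) ↔ ∃ v, M.rel w v ∧ M.Sat v φ := Iff.rfl

theorem sat_box (M : KModel W) (w : W) (φ : MuForm 0) :
    M.Sat w (.box φ) ↔ ∀ v, M.rel w v → M.Sat v φ := Iff.rfl

theorem sat_rdia (M : KModel W) (w : W) (φ : MuForm 0) :
    M.Sat w φ.rdia ↔ ∃ v, M.rrel w v ∧ M.Sat v φ := by
  rw [MuForm.rdia, sat_or, sat_dia]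
  constructor
  · rintro (h | ⟨v, hv, h⟩)
    exacts [⟨w, .inl rfl, h⟩, ⟨v, .inr hv, h⟩]
  · rintro ⟨v, rfl | hv, h⟩
    exacts [.inl h, .inr ⟨v, hv, h⟩]

theorem sat_rbox (M : KModel W) (w : W) (φ : MuForm 0) :
    M.Sat w φ.rbox ↔ ∀ v, M.rrel w v → M.Sat v φ := by
  rw [MuForm.rbox, sat_and, sat_box]
  constructor
  · rintro ⟨h, h'⟩ v (rfl | hv)
    exacts [h, h' v hv]
  · intro h
    exact ⟨h w (.inl rfl), fun v hv => h v (.inr hv)⟩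

/-! ### Transfer of truth between models -/

/-- A bisimulation up to a set `S` of formulas: a successor need not be matched by a related
successor, as long as every formula of `S` true at it is also true at some successor on the other
side. -/
structure SBisim (P : Finset ℕ) (S : Finset (MuForm 0)) (M : KModel W) (N : KModel V)
    (Z : W → V → Prop) : Prop where
  atoms : ∀ u v, Z u v → ∀ p ∈ P, (u ∈ M.val p ↔ v ∈ N.val p)
  forth : ∀ u v u', Z u v → M.rel u u' → (∃ v', N.rel v v' ∧ Z u' v') ∨
    ∀ ψ ∈ S, M.Sat u' ψ → ∃ v', N.rel v v' ∧ N.Sat v' ψ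
  back : ∀ u v v', Z u v → N.rel v v' → (∃ u', M.rel u u' ∧ Z u' v') ∨
    ∀ ψ ∈ S, N.Sat v' ψ → ∃ u', M.rel u u' ∧ M.Sat u' ψ

theorem SBisim.symm {P : Finset ℕ} {S : Finset (MuForm 0)} {M : KModel W} {N : KModel V}
    {Z : W → V → Prop} (h : SBisim P S M N Z) : SBisim P S N M (fun v u => Z u v) where
  atoms u v hZ p hp := (h.atoms v u hZ p hp).symm
  forth u v u' hZ hr := h.back v u u' hZ hr
  back u v v' hZ hr := h.forth v u v' hZ hr

/-- One direction of the transfer of truth along an `S`-bisimulation, for open formulas. The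
environments `ρ`, `ρ'` may differ from the intended one, given by `s`, in the directions in which an
induction over least fixed points (on the left) and over greatest fixed points (on the right)
approaches it; on successors that are not matched, the intended environment is used. -/
theorem SBisim.truth_of_truth {P : Finset ℕ} {S : Finset (MuForm 0)} {M : KModel W} {N : KModel V}
    {Z : W → V → Prop} (h : SBisim P S M N Z) (hneg : ∀ ψ ∈ S, ∃ χ ∈ S, (∀ w, M.Sat w χ ↔
      ¬ M.Sat w ψ) ∧ ∀ w, N.Sat w χ ↔ ¬ N.Sat w ψ)
    {n : ℕ} (ψ : MuForm n) (s : Fin n → MuForm 0) (ρ : Fin n → Set W) (ρ' : Fin n → Set V)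
    (hP : ψ.atoms ⊆ P) (hS : MuForm.subStar s ψ ⊆ S)
    (hρ : ∀ i, ρ i ⊆ M.truth (s i) Fin.elim0) (hρ' : ∀ i, N.truth (s i) Fin.elim0 ⊆ ρ' i)
    (hZ : ∀ i u v, u ∈ ρ i → Z u v → v ∈ ρ' i) :
    ∀ u v, u ∈ M.truth ψ ρ → Z u v → v ∈ N.truth ψ ρ' := by
  induction ψ with
  | top => exact fun _ _ _ _ => trivial
  | var i => exact fun u v hu huv => hZ i u v hu huv
  | atom p =>
    intro u v hu huv
    exact (h.atoms u v huv p (hP (by simp [MuForm.atoms]))).1 hu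
  | natom p =>
    intro u v hu huv hv
    exact hu ((h.atoms u v huv p (hP (by simp [MuForm.atoms]))).2 hv)
  | and φ ψ ihφ ihψ =>
    simp only [MuForm.atoms, MuForm.subStar, Finset.union_subset_iff] at hP hS
    intro u v hu huv
    exact ⟨ihφ s ρ ρ' hP.1 hS.2.1 hρ hρ' hZ u v hu.1 huv,
      ihψ s ρ ρ' hP.2 hS.2.2 hρ hρ' hZ u v hu.2 huv⟩
  | or φ ψ ihφ ihψ =>
    simp only [MuForm.atoms, MuForm.subStar, Finset.union_subset_iff] at hP hS
    intro u v hu huv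
    exact hu.imp (fun hu => ihφ s ρ ρ' hP.1 hS.2.1 hρ hρ' hZ u v hu huv)
      (fun hu => ihψ s ρ ρ' hP.2 hS.2.2 hρ hρ' hZ u v hu huv)
  | dia φ ih =>
    simp only [MuForm.atoms, MuForm.subStar, Finset.union_subset_iff,
      Finset.singleton_subset_iff] at hP hS
    rintro u v ⟨u', hr, hu'⟩ huv
    rcases h.forth u v u' huv hr with ⟨v', hr', hv'⟩ | hfar
    · exact ⟨v', hr', ih s ρ ρ' hP hS.2 hρ hρ' hZ u' v' hu' hv'⟩
    · obtain ⟨v', hr', hv'⟩ := hfar _ hS.1 (by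
        rw [Sat, truth_subst_zero]
        exact M.truth_mono φ hρ hu')
      rw [Sat, truth_subst_zero] at hv'
      exact ⟨v', hr', N.truth_mono φ hρ' hv'⟩
  | box φ ih =>
    simp only [MuForm.atoms, MuForm.subStar, Finset.union_subset_iff,
      Finset.singleton_subset_iff] at hP hS
    intro u v hu huv v' hr
    rcases h.back u v v' huv hr with ⟨u', hr', hu'⟩ | hfar
    · exact ih s ρ ρ' hP hS.2 hρ hρ' hZ u' v' (hu u' hr') hu'
    · suffices N.Sat v' (φ.subst s) by
        rw [Sat, truth_subst_zero] at this
        exact N.truth_mono φ hρ' this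
      by_contra hv'
      obtain ⟨χ, hχ, hχM, hχN⟩ := hneg _ hS.1
      obtain ⟨u', hr', hu'⟩ := hfar χ hχ ((hχN v').2 hv')
      refine (hχM u').1 hu' ?_
      rw [Sat, truth_subst_zero]
      exact M.truth_mono φ hρ (hu u' hr')
  | nu φ ih =>
    simp only [MuForm.atoms, MuForm.subStar, Finset.union_subset_iff,
      Finset.singleton_subset_iff] at hP hS
    set σ := (MuForm.nu φ).subst s with hσ
    have hσM : M.truth σ Fin.elim0 = (M.op φ fun i => M.truth (s i) Fin.elim0).gfp := by
      rw [hσ, truth_subst_zero, truth_nu]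
    have hσN : N.truth σ Fin.elim0 = (N.op φ fun i => N.truth (s i) Fin.elim0).gfp := by
      rw [hσ, truth_subst_zero, truth_nu]
    rw [truth_nu, truth_nu]
    set X := (M.op φ ρ).gfp with hX
    -- the related points of `X`, added to the intended value, form a post-fixed point
    let Y : Set V := N.truth σ Fin.elim0 ∪ {v | ∃ u ∈ X, Z u v}
    have hY : Y ⊆ N.op φ ρ' Y := by
      rintro v (hv | ⟨u, hu, huv⟩)
      · rw [hσN, ← OrderHom.map_gfp, ← hσN] at hv
        exact N.truth_mono φ (cons_le_cons Set.subset_union_left hρ') hv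
      · rw [hX, ← OrderHom.map_gfp, ← hX] at hu
        refine ih (Fin.cons σ s) (Fin.cons X ρ) (Fin.cons Y ρ') hP hS.2 ?_ ?_ ?_ u v hu huv
        · refine Fin.cases ?_ fun i => ?_
          · simp only [Fin.cons_zero, hσM]
            exact OrderHom.gfp.monotone fun T => M.truth_mono φ (cons_le_cons subset_rfl hρ)
          · simpa using hρ i
        · refine Fin.cases ?_ fun i => ?_
          · exact Set.subset_union_left
          · simpa using hρ' i
        · refine Fin.cases ?_ fun i => ?_
          · intro u v hu huv
            exact Or.inr ⟨u, hu, huv⟩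
          · simpa using hZ i
    intro u v hu huv
    exact OrderHom.le_gfp _ hY (Or.inr ⟨u, hu, huv⟩)
  | mu φ ih =>
    simp only [MuForm.atoms, MuForm.subStar, Finset.union_subset_iff,
      Finset.singleton_subset_iff] at hP hS
    set σ := (MuForm.mu φ).subst s with hσ
    have hσM : M.truth σ Fin.elim0 = (M.op φ fun i => M.truth (s i) Fin.elim0).lfp := by
      rw [hσ, truth_subst_zero, truth_mu]
    have hσN : N.truth σ Fin.elim0 = (N.op φ fun i => N.truth (s i) Fin.elim0).lfp := by
      rw [hσ, truth_subst_zero, truth_mu]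
    rw [truth_mu, truth_mu]
    set Y := (N.op φ ρ').lfp with hY
    -- the points whose related points lie in `Y`, cut down to the intended value, form a pre-fixed
    -- point
    let T : Set W := M.truth σ Fin.elim0 ∩ {u | ∀ v, Z u v → v ∈ Y}
    have hT : M.op φ ρ T ⊆ T := by
      intro u hu
      refine ⟨?_, fun v huv => ?_⟩
      · rw [hσM, ← OrderHom.map_lfp, ← hσM]
        exact M.truth_mono φ (cons_le_cons Set.inter_subset_left hρ) hu
      · rw [hY, ← OrderHom.map_lfp, ← hY]
        refine ih (Fin.cons σ s) (Fin.cons T ρ) (Fin.cons Y ρ') hP hS.2 ?_ ?_ ?_ u v hu huv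
        · refine Fin.cases ?_ fun i => ?_
          · exact Set.inter_subset_left
          · simpa using hρ i
        · refine Fin.cases ?_ fun i => ?_
          · simp only [Fin.cons_zero, hσN]
            exact OrderHom.lfp.monotone fun T => N.truth_mono φ (cons_le_cons subset_rfl hρ')
          · simpa using hρ' i
        · refine Fin.cases ?_ fun i => ?_
          · intro u v hu huv
            exact hu.2 v huv
          · simpa using hZ i
    intro u v hu huv
    exact (OrderHom.lfp_le _ hT hu).2 v huv

/-- Formulas are invariant under `S`-bisimulations, together with all their `sub*`-formulas. -/
theorem SBisim.sat_iff_of_mem_subStar {P : Finset ℕ} {S : Finset (MuForm 0)} {M : KModel W}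
    {N : KModel V} {Z : W → V → Prop} (h : SBisim P S M N Z) (hneg : ∀ ψ ∈ S, ∃ χ ∈ S,
      (∀ w, M.Sat w χ ↔ ¬ M.Sat w ψ) ∧ ∀ w, N.Sat w χ ↔ ¬ N.Sat w ψ)
    {n : ℕ} (ψ : MuForm n) (s : Fin n → MuForm 0) (hP : ψ.atoms ⊆ P)
    (hS : MuForm.subStar s ψ ⊆ S) (hs : ∀ i u v, Z u v → (M.Sat u (s i) ↔ N.Sat v (s i))) :
    ∀ χ ∈ insert (ψ.subst s) (MuForm.subStar s ψ), ∀ u v, Z u v → (M.Sat u χ ↔ N.Sat v χ) := by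
  have hneg' : ∀ ψ ∈ S, ∃ χ ∈ S,
      (∀ w, N.Sat w χ ↔ ¬ N.Sat w ψ) ∧ ∀ w, M.Sat w χ ↔ ¬ M.Sat w ψ := fun ψ hψ => by
    obtain ⟨χ, h1, h2, h3⟩ := hneg ψ hψ
    exact ⟨χ, h1, h3, h2⟩
  have base : ∀ {n : ℕ} (ψ : MuForm n) (s : Fin n → MuForm 0), ψ.atoms ⊆ P →
      MuForm.subStar s ψ ⊆ S → (∀ i u v, Z u v → (M.Sat u (s i) ↔ N.Sat v (s i))) →
      ∀ u v, Z u v → (M.Sat u (ψ.subst s) ↔ N.Sat v (ψ.subst s)) := by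
    intro n ψ s hP hS hs u v huv
    simp only [Sat, truth_subst_zero]
    exact ⟨fun hu => h.truth_of_truth hneg ψ s _ _ hP hS (fun _ => subset_rfl)
        (fun _ => subset_rfl) (fun i u v hu huv => (hs i u v huv).1 hu) u v hu huv,
      fun hv => h.symm.truth_of_truth hneg' ψ s _ _ hP hS (fun _ => subset_rfl)
        (fun _ => subset_rfl) (fun i u v hu huv => (hs i v u huv).2 hu) v u hv huv⟩
  have fixed : ∀ {n : ℕ} (φ : MuForm (n + 1)) (σ : MuForm 0) (s : Fin n → MuForm 0),
      (∀ i u v, Z u v → (M.Sat u (s i) ↔ N.Sat v (s i))) →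
      (∀ u v, Z u v → (M.Sat u σ ↔ N.Sat v σ)) →
      ∀ i u v, Z u v → (M.Sat u ((Fin.cons σ s : Fin (n + 1) → MuForm 0) i) ↔
        N.Sat v ((Fin.cons σ s : Fin (n + 1) → MuForm 0) i)) := by
    intro n φ σ s hs hσ
    refine Fin.cases ?_ fun i => ?_
    · simpa using hσ
    · simpa using hs i
  intro χ hχ
  rcases Finset.mem_insert.1 hχ with rfl | hχ
  · exact base ψ s hP hS hs
  clear * - base fixed hP hS hs hχ h
  induction ψ with
  | top => 
    simp only [MuForm.subStar, Finset.mem_singleton] at hχ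
    subst hχ
    exact fun _ _ _ => Iff.rfl
  | var i =>
    simp only [MuForm.subStar, Finset.mem_singleton] at hχ
    subst hχ
    exact hs i
  | atom p =>
    simp only [MuForm.subStar, Finset.mem_singleton] at hχ
    subst hχ
    exact base (.atom p) s hP hS hs
  | natom p =>
    simp only [MuForm.subStar, Finset.mem_insert, Finset.mem_singleton] at hχ
    have hp : p ∈ P := hP (by simp [MuForm.atoms])
    intro u v huv
    have := h.atoms u v huv p hp
    rcases hχ with rfl | rfl
    · exact not_congr this
    · exact this
  | and φ ψ ihφ ihψ | or φ ψ ihφ ihψ =>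
    have hb := base _ s hP hS hs
    simp only [MuForm.atoms, MuForm.subStar, Finset.union_subset_iff] at hP hS
    simp only [MuForm.subStar, Finset.mem_union, Finset.mem_singleton] at hχ
    rcases hχ with rfl | hχ | hχ
    · exact hb
    · exact ihφ s hP.1 hS.2.1 hs hχ
    · exact ihψ s hP.2 hS.2.2 hs hχ
  | dia φ ih | box φ ih =>
    simp only [MuForm.atoms, MuForm.subStar, Finset.union_subset_iff] at hP hS
    simp only [MuForm.subStar, Finset.mem_union, Finset.mem_singleton] at hχ
    rcases hχ with rfl | hχ
    · exact base φ s hP hS.2 hs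
    · exact ih s hP hS.2 hs hχ
  | nu φ ih | mu φ ih =>
    have hb := fixed φ _ s hs (base _ s hP hS hs)
    simp only [MuForm.atoms, MuForm.subStar, Finset.union_subset_iff] at hP hS
    simp only [MuForm.subStar, Finset.mem_union, Finset.mem_singleton] at hχ
    rcases hχ with rfl | hχ
    · exact base φ _ hP hS.2 hb
    · exact ih _ hP hS.2 hb hχ

end KModel

/-! ### Closure properties of `sigma` -/

namespace MuForm

theorem mem_sigma {φ χ : MuForm 0} : χ ∈ φ.sigma ↔
    ∃ ψ ∈ insert φ (subStar Fin.elim0 φ), χ ∈ ψ.modalities ∨ χ ∈ ψ.neg.modalities := by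
  simp only [sigma, Finset.mem_biUnion, Finset.mem_union]

theorem mem_modalities_self (ψ : MuForm 0) : ψ ∈ ψ.modalities := by simp [modalities]

theorem self_mem_sigma (φ : MuForm 0) : φ ∈ φ.sigma :=
  mem_sigma.2 ⟨φ, Finset.mem_insert_self _ _, .inl (mem_modalities_self φ)⟩

theorem subStar_subset_sigma (φ : MuForm 0) : subStar Fin.elim0 φ ⊆ φ.sigma := fun ψ hψ =>
  mem_sigma.2 ⟨ψ, Finset.mem_insert_of_mem hψ, .inl (mem_modalities_self ψ)⟩

theorem neg_self_mem_sigma (φ : MuForm 0) : φ.neg ∈ φ.sigma :=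
  mem_sigma.2 ⟨φ, Finset.mem_insert_self _ _, .inr (mem_modalities_self _)⟩

end MuForm

namespace KModel

variable {W V : Type*}

theorem sat_rbox_iff_not_rdia (M : KModel W) {a b : MuForm 0}
    (h : ∀ w, M.Sat w a ↔ ¬ M.Sat w b) : ∀ w, M.Sat w a.rbox ↔ ¬ M.Sat w b.rdia := by
  intro w
  simp [sat_rbox, sat_rdia, h]

theorem sat_rdia_iff_not_rbox (M : KModel W) {a b : MuForm 0}
    (h : ∀ w, M.Sat w a ↔ ¬ M.Sat w b) : ∀ w, M.Sat w a.rdia ↔ ¬ M.Sat w b.rbox := by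
  intro w
  simp [sat_rbox, sat_rdia, h]

/-- Negation maps the modalities applied to `b` to their duals applied to the negation of `b`. -/
theorem exists_dual_modality (M : KModel W) (N : KModel V) {a b : MuForm 0}
    (hM : ∀ w, M.Sat w a ↔ ¬ M.Sat w b) (hN : ∀ w, N.Sat w a ↔ ¬ N.Sat w b) :
    ∀ χ ∈ b.modalities, ∃ χ' ∈ a.modalities,
      (∀ w, M.Sat w χ' ↔ ¬ M.Sat w χ) ∧ ∀ w, N.Sat w χ' ↔ ¬ N.Sat w χ := by
  have dM := @sat_rdia_iff_not_rbox W M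
  have bM := @sat_rbox_iff_not_rdia W M
  have dN := @sat_rdia_iff_not_rbox V N
  have bN := @sat_rbox_iff_not_rdia V N
  intro χ hχ
  simp only [MuForm.modalities, Finset.mem_insert, Finset.mem_singleton] at hχ
  rcases hχ with rfl | rfl | rfl | rfl | rfl | rfl | rfl
  · exact ⟨a, by simp [MuForm.modalities], hM, hN⟩
  · exact ⟨a.rbox, by simp [MuForm.modalities], bM hM, bN hN⟩
  · exact ⟨a.rdia, by simp [MuForm.modalities], dM hM, dN hN⟩
  · exact ⟨a.rdia.rbox, by simp [MuForm.modalities], bM (dM hM), bN (dN hN)⟩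
  · exact ⟨a.rbox.rdia, by simp [MuForm.modalities], dM (bM hM), dN (bN hN)⟩
  · exact ⟨a.rbox.rdia.rbox, by simp [MuForm.modalities], bM (dM (bM hM)), bN (dN (bN hN))⟩
  · exact ⟨a.rdia.rbox.rdia, by simp [MuForm.modalities], dM (bM (dM hM)), dN (bN (dN hN))⟩

/-- `sigma φ` is closed under negation up to equivalence. -/
theorem exists_neg_mem_sigma (M : KModel W) (N : KModel V) (φ : MuForm 0) :
    ∀ ψ ∈ φ.sigma, ∃ χ ∈ φ.sigma,
      (∀ w, M.Sat w χ ↔ ¬ M.Sat w ψ) ∧ ∀ w, N.Sat w χ ↔ ¬ N.Sat w ψ := by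
  intro ψ hψ
  obtain ⟨θ, hθ, h | h⟩ := MuForm.mem_sigma.1 hψ
  · obtain ⟨χ, hχ, h'⟩ := exists_dual_modality M N (fun w => M.sat_neg w θ)
      (fun w => N.sat_neg w θ) ψ h
    exact ⟨χ, MuForm.mem_sigma.2 ⟨θ, hθ, .inr hχ⟩, h'⟩
  · obtain ⟨χ, hχ, h'⟩ := exists_dual_modality M N (a := θ) (b := θ.neg)
      (fun w => by rw [M.sat_neg w θ, not_not]) (fun w => by rw [N.sat_neg w θ, not_not]) ψ h
    exact ⟨χ, MuForm.mem_sigma.2 ⟨θ, hθ, .inl hχ⟩, h'⟩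

theorem rrel_refl (M : KModel W) (w : W) : M.rrel w w := .inl rfl

theorem WeaklyTransitive.rrel_trans {M : KModel W} (hM : M.WeaklyTransitive) {a b c : W}
    (h : M.rrel a b) (h' : M.rrel b c) : M.rrel a c := by
  rcases h with rfl | h
  · exact h'
  rcases h' with rfl | h'
  · exact .inr h
  by_cases hac : a = c
  exacts [.inl hac, .inr (hM a b c hac h h')]

/-- Over weakly transitive models, `sigma φ` is closed under the reflexive diamond up to
equivalence, by the S4 laws for that diamond. -/
theorem WeaklyTransitive.exists_rdia_mem_sigma {M : KModel W} (hM : M.WeaklyTransitive)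
    (φ : MuForm 0) : ∀ ψ ∈ φ.sigma, ∃ χ ∈ φ.sigma, ∀ w, M.Sat w χ ↔
      ∃ v, M.rrel w v ∧ M.Sat v ψ := by
  have key : ∀ θ : MuForm 0, ∀ ψ ∈ θ.modalities, ∃ χ ∈ θ.modalities,
      ∀ w, M.Sat w χ ↔ M.Sat w ψ.rdia := by
    intro θ ψ hψ
    have idem : ∀ (χ : MuForm 0) w, M.Sat w χ.rdia ↔ M.Sat w χ.rdia.rdia := by
      intro χ w
      simp only [sat_rdia]
      constructor
      · rintro ⟨v, hv, h⟩
        exact ⟨v, hv, v, M.rrel_refl v, h⟩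
      · rintro ⟨v, hv, u, hu, h⟩
        exact ⟨u, hM.rrel_trans hv hu, h⟩
    have collapse : ∀ (χ : MuForm 0) w,
        M.Sat w χ.rbox.rdia ↔ M.Sat w χ.rbox.rdia.rbox.rdia := by
      intro χ w
      simp only [sat_rdia, sat_rbox]
      constructor
      · rintro ⟨v, hv, h⟩
        exact ⟨v, hv, fun x hx => ⟨x, M.rrel_refl x, fun y hy => h y (hM.rrel_trans hx hy)⟩⟩
      · rintro ⟨v, hv, h⟩
        obtain ⟨y, hy, h⟩ := h v (M.rrel_refl v)
        exact ⟨y, hM.rrel_trans hv hy, h⟩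
    simp only [MuForm.modalities, Finset.mem_insert, Finset.mem_singleton] at hψ
    rcases hψ with rfl | rfl | rfl | rfl | rfl | rfl | rfl
    · exact ⟨ψ.rdia, by simp [MuForm.modalities], fun w => Iff.rfl⟩
    · exact ⟨θ.rdia, by simp [MuForm.modalities], idem _⟩
    · exact ⟨θ.rbox.rdia, by simp [MuForm.modalities], fun w => Iff.rfl⟩
    · exact ⟨θ.rbox.rdia, by simp [MuForm.modalities], idem _⟩
    · exact ⟨θ.rdia.rbox.rdia, by simp [MuForm.modalities], fun w => Iff.rfl⟩
    · exact ⟨θ.rdia.rbox.rdia, by simp [MuForm.modalities], idem _⟩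
    · exact ⟨θ.rbox.rdia, by simp [MuForm.modalities], collapse _⟩
  intro ψ hψ
  obtain ⟨θ, hθ, h | h⟩ := MuForm.mem_sigma.1 hψ
  · obtain ⟨χ, hχ, h'⟩ := key θ ψ h
    exact ⟨χ, MuForm.mem_sigma.2 ⟨θ, hθ, .inl hχ⟩, fun w => (h' w).trans (M.sat_rdia w ψ)⟩
  · obtain ⟨χ, hχ, h'⟩ := key θ.neg ψ h
    exact ⟨χ, MuForm.mem_sigma.2 ⟨θ, hθ, .inr hχ⟩, fun w => (h' w).trans (M.sat_rdia w ψ)⟩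

/-- The formulas in `sigma φ` are invariant under `sigma φ`-bisimulations. -/
theorem SBisim.sat_iff {φ : MuForm 0} {M : KModel W} {N : KModel V} {Z : W → V → Prop}
    (h : SBisim φ.atoms φ.sigma M N Z) {u : W} {v : V} (huv : Z u v) :
    ∀ ψ ∈ φ.sigma, (M.Sat u ψ ↔ N.Sat v ψ) := by
  let Agree (χ : MuForm 0) : Prop := ∀ u v, Z u v → (M.Sat u χ ↔ N.Sat v χ)
  have hneg := exists_neg_mem_sigma M N φ
  have base : ∀ χ ∈ insert φ (MuForm.subStar Fin.elim0 φ), Agree χ := by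
    have := h.sat_iff_of_mem_subStar hneg φ Fin.elim0 subset_rfl (MuForm.subStar_subset_sigma φ)
      (fun i => i.elim0)
    intro χ hχ
    rcases Finset.mem_insert.1 hχ with rfl | hχ
    · intro u v huv
      have h' := this _ (Finset.mem_insert_self _ _) u v huv
      simp only [Sat, truth_subst_zero] at h' ⊢
      convert h' using 3
    · exact this χ (Finset.mem_insert_of_mem hχ)
  have rdia : ∀ χ ∈ φ.sigma, Agree χ → Agree χ.rdia := by
    intro χ hχ hA u v huv
    change _ ∨ (∃ _, _) ↔ _ ∨ (∃ _, _)
    have h0 : M.Sat u χ ↔ N.Sat v χ := hA u v huv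
    constructor
    · rintro (hu | ⟨u', hr, hu'⟩)
      · exact .inl (h0.1 hu)
      · rcases h.forth u v u' huv hr with ⟨v', hr', hv'⟩ | hfar
        · exact .inr ⟨v', hr', (hA u' v' hv').1 hu'⟩
        · exact .inr (hfar χ hχ hu')
    · rintro (hu | ⟨u', hr, hu'⟩)
      · exact .inl (h0.2 hu)
      · rcases h.back u v u' huv hr with ⟨v', hr', hv'⟩ | hfar
        · exact .inr ⟨v', hr', (hA v' u' hv').2 hu'⟩
        · exact .inr (hfar χ hχ hu')
  have rbox : ∀ χ ∈ φ.sigma, Agree χ → Agree χ.rbox := by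
    intro χ hχ hA u v huv
    obtain ⟨χ', hχ', hM, hN⟩ := hneg χ hχ
    have hA' : Agree χ' := fun u v huv => by rw [hM, hN, hA u v huv]
    have := rdia χ' hχ' hA' u v huv
    rw [M.sat_rdia_iff_not_rbox hM, N.sat_rdia_iff_not_rbox hN] at this
    exact not_iff_not.1 this
  have mods : ∀ χ, χ.modalities ⊆ φ.sigma → Agree χ → ∀ ψ ∈ χ.modalities, Agree ψ := by
    intro χ hχ hA ψ hψ
    have mem : ∀ {ψ}, ψ ∈ χ.modalities → ψ ∈ φ.sigma := fun h => hχ h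
    have hd := rdia χ (mem (by simp [MuForm.modalities])) hA
    have hb := rbox χ (mem (by simp [MuForm.modalities])) hA
    have hbd := rdia _ (mem (by simp [MuForm.modalities])) hb
    have hdb := rbox _ (mem (by simp [MuForm.modalities])) hd
    have hdbd := rdia _ (mem (by simp [MuForm.modalities])) hdb
    have hbdb := rbox _ (mem (by simp [MuForm.modalities])) hbd
    simp only [MuForm.modalities, Finset.mem_insert, Finset.mem_singleton] at hψ
    rcases hψ with rfl | rfl | rfl | rfl | rfl | rfl | rfl <;> assumption
  intro ψ hψ
  obtain ⟨θ, hθ, h' | h'⟩ := MuForm.mem_sigma.1 hψ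
  · exact mods θ (fun χ hχ => MuForm.mem_sigma.2 ⟨θ, hθ, .inl hχ⟩) (base θ hθ) ψ h' u v huv
  · refine mods θ.neg (fun χ hχ => MuForm.mem_sigma.2 ⟨θ, hθ, .inr hχ⟩) ?_ ψ h' u v huv
    intro u v huv
    rw [sat_neg, sat_neg, base θ hθ u v huv]

end KModel

/-! ### Weakly transitive models: clusters, final worlds and depth -/

namespace KModel

variable {W V : Type*} {M : KModel W}

theorem mem_cluster_self (M : KModel W) (w : W) : w ∈ M.cluster w := ⟨.inl rfl, .inl rfl⟩

theorem mem_cluster_symm {u w : W} (h : u ∈ M.cluster w) : w ∈ M.cluster u := ⟨h.2, h.1⟩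

/-- Distinct points of a cluster see each other. -/
theorem WeaklyTransitive.rel_of_mem_cluster (hM : M.WeaklyTransitive) {w x y : W}
    (hx : x ∈ M.cluster w) (hy : y ∈ M.cluster w) (hxy : x ≠ y) : M.rel x y :=
  (hM.rrel_trans hx.2 hy.1).resolve_left hxy

theorem WeaklyTransitive.mem_cluster_trans (hM : M.WeaklyTransitive) {u v w : W}
    (h : u ∈ M.cluster v) (h' : v ∈ M.cluster w) : u ∈ M.cluster w :=
  ⟨hM.rrel_trans h'.1 h.1, hM.rrel_trans h.2 h'.2⟩

theorem WeaklyTransitive.cluster_eq (hM : M.WeaklyTransitive) {u w : W} (h : u ∈ M.cluster w) :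
    M.cluster u = M.cluster w :=
  Set.Subset.antisymm (fun _ hx => hM.mem_cluster_trans hx h)
    (fun _ hx => hM.mem_cluster_trans hx (mem_cluster_symm h))

theorem Below.rrel {u v : W} (h : M.Below u v) : M.rrel u v := .inr h.1

theorem Below.ne {u v : W} (h : M.Below u v) : u ≠ v := by
  rintro rfl
  exact h.2 h.1

theorem Below.not_rrel {u v : W} (h : M.Below u v) : ¬ M.rrel v u := by
  rintro (h' | h')
  exacts [h.ne h'.symm, h.2 h']

theorem below_iff {u v : W} : M.Below u v ↔ M.rrel u v ∧ ¬ M.rrel v u := by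
  constructor
  · exact fun h => ⟨h.rrel, h.not_rrel⟩
  · rintro ⟨rfl | h, h'⟩
    exacts [(h' (.inl rfl)).elim, ⟨h, fun h'' => h' (.inr h'')⟩]

theorem mem_cluster_or_below {u v : W} (h : M.rrel u v) : v ∈ M.cluster u ∨ M.Below u v := by
  by_cases h' : M.rrel v u
  exacts [.inl ⟨h, h'⟩, .inr (below_iff.2 ⟨h, h'⟩)]

theorem WeaklyTransitive.below_of_rrel_of_below (hM : M.WeaklyTransitive) {u v w : W}
    (h : M.rrel u v) (h' : M.Below v w) : M.Below u w :=
  below_iff.2 ⟨hM.rrel_trans h h'.rrel, fun h'' => h'.not_rrel (hM.rrel_trans h'' h)⟩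

theorem WeaklyTransitive.below_of_below_of_rrel (hM : M.WeaklyTransitive) {u v w : W}
    (h : M.Below u v) (h' : M.rrel v w) : M.Below u w :=
  below_iff.2 ⟨hM.rrel_trans h.rrel h', fun h'' => h.not_rrel (hM.rrel_trans h' h'')⟩

theorem WeaklyTransitive.below_wf [Finite W] (hM : M.WeaklyTransitive) :
    WellFounded (fun u v => M.Below v u) := by
  have h1 : Std.Irrefl (fun u v => M.Below v u) := ⟨fun _ h => h.ne rfl⟩
  have h2 : IsTrans W (fun u v => M.Below v u) :=
    ⟨fun _ _ _ h h' => hM.below_of_below_of_rrel h' h.rrel⟩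
  exact Finite.wellFounded_of_trans_of_irrefl _

section Sigma

variable {φ : MuForm 0}

/-- Finality is a property of clusters: replace the witnessing formula `ψ` by its reflexive
diamond. -/
theorem WeaklyTransitive.final_of_mem_cluster (hM : M.WeaklyTransitive) {u w : W}
    (hw : M.Final φ.sigma w) (hu : u ∈ M.cluster w) : M.Final φ.sigma u := by
  obtain ⟨ψ, hψ, hwψ, hmax⟩ := hw
  obtain ⟨χ, hχ, h⟩ := hM.exists_rdia_mem_sigma φ ψ hψ
  refine ⟨χ, hχ, (h u).2 ⟨w, hu.2, hwψ⟩, fun v huv hv => ?_⟩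
  obtain ⟨x, hvx, hx⟩ := (h v).1 hv
  have hxw : M.rrel x w := by
    rcases hM.rrel_trans hu.1 (hM.rrel_trans (.inr huv) hvx) with rfl | hwx
    · exact .inl rfl
    · exact .inr (hmax x hwx hx)
  rcases hM.rrel_trans (hM.rrel_trans hvx hxw) hu.1 with rfl | h'
  · exact huv
  · exact h'

theorem WeaklyTransitive.final_iff_of_mem_cluster (hM : M.WeaklyTransitive) {u w : W}
    (hu : u ∈ M.cluster w) : M.Final φ.sigma u ↔ M.Final φ.sigma w :=
  ⟨fun h => hM.final_of_mem_cluster h (mem_cluster_symm hu), fun h => hM.final_of_mem_cluster h hu⟩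

theorem exists_below_of_not_final {S : Finset (MuForm 0)} {v : W} (hv : ¬ M.Final S v)
    {ψ : MuForm 0} (hψ : ψ ∈ S) (hvψ : M.Sat v ψ) : ∃ u, M.Below v u ∧ M.Sat u ψ := by
  by_contra h
  push Not at h
  exact hv ⟨ψ, hψ, hvψ, fun u hvu hu => by_contra fun h' => h u ⟨hvu, h'⟩ hu⟩

theorem WeaklyTransitive.exists_final_of_sat [Finite W] (hM : M.WeaklyTransitive)
    {S : Finset (MuForm 0)} {ψ : MuForm 0} (hψ : ψ ∈ S) {v : W} (hv : M.Sat v ψ) :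
    ∃ u, M.rrel v u ∧ M.Final S u ∧ M.Sat u ψ := by
  induction v using hM.below_wf.induction with
  | _ v ih =>
    by_cases hf : M.Final S v
    · exact ⟨v, .inl rfl, hf, hv⟩
    · obtain ⟨u, hvu, hu⟩ := exists_below_of_not_final hf hψ hv
      obtain ⟨x, hux, hx⟩ := ih u hvu hu
      exact ⟨x, hM.rrel_trans hvu.rrel hux, hx⟩

theorem WeaklyTransitive.exists_final_above_of_not_final [Finite W] (hM : M.WeaklyTransitive)
    {S : Finset (MuForm 0)} {ψ : MuForm 0} (hψ : ψ ∈ S) {v : W} (hf : ¬ M.Final S v)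
    (hv : M.Sat v ψ) : ∃ u, M.Below v u ∧ M.Final S u ∧ M.Sat u ψ := by
  obtain ⟨u, hvu, hu⟩ := exists_below_of_not_final hf hψ hv
  obtain ⟨x, hux, hx⟩ := hM.exists_final_of_sat hψ hu
  exact ⟨x, hM.below_of_below_of_rrel hvu hux, hx⟩

theorem WeaklyTransitive.exists_final [Finite W] (hM : M.WeaklyTransitive) (φ : MuForm 0) (v : W) :
    ∃ u, M.rrel v u ∧ M.Final φ.sigma u := by
  by_cases h : M.Sat v φ
  · obtain ⟨u, hu, hf, -⟩ := hM.exists_final_of_sat φ.self_mem_sigma h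
    exact ⟨u, hu, hf⟩
  · obtain ⟨u, hu, hf, -⟩ := hM.exists_final_of_sat φ.neg_self_mem_sigma ((M.sat_neg v φ).2 h)
    exact ⟨u, hu, hf⟩

variable {S : Finset (MuForm 0)}

theorem WeaklyTransitive.depthGE_of_rrel (hM : M.WeaklyTransitive) {u v : W} (h : M.rrel u v)
    {k : ℕ} (hv : M.DepthGE S k v) : M.DepthGE S k u := by
  cases k with
  | zero => trivial
  | succ k =>
    obtain ⟨x, hx, hvx, hk⟩ := hv
    exact ⟨x, hx, hM.below_of_rrel_of_below h hvx, hk⟩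

theorem WeaklyTransitive.depthGE_of_succ (hM : M.WeaklyTransitive) {w : W} {k : ℕ}
    (h : M.DepthGE S (k + 1) w) : M.DepthGE S k w := by
  obtain ⟨x, -, hwx, hk⟩ := h
  exact hM.depthGE_of_rrel hwx.rrel hk

theorem WeaklyTransitive.depthGE_of_le (hM : M.WeaklyTransitive) {w : W} {k l : ℕ} (hkl : k ≤ l)
    (h : M.DepthGE S l w) : M.DepthGE S k w := by
  induction hkl with
  | refl => exact h
  | step _ ih => exact ih (hM.depthGE_of_succ h)

theorem WeaklyTransitive.depthGE_iff_of_mem_cluster (hM : M.WeaklyTransitive) {u w : W}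
    (hu : u ∈ M.cluster w) {k : ℕ} : M.DepthGE S k u ↔ M.DepthGE S k w :=
  ⟨hM.depthGE_of_rrel hu.1, hM.depthGE_of_rrel hu.2⟩

theorem WeaklyTransitive.hasDepth_iff_of_mem_cluster (hM : M.WeaklyTransitive) {u w : W}
    (hu : u ∈ M.cluster w) {k : ℕ} : M.HasDepth S u k ↔ M.HasDepth S w k := by
  rw [HasDepth, HasDepth, hM.depthGE_iff_of_mem_cluster hu, hM.depthGE_iff_of_mem_cluster hu]

theorem WeaklyTransitive.le_of_depthGE (hM : M.WeaklyTransitive) {w : W} {k n : ℕ}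
    (h : M.DepthGE S k w) (hn : M.HasDepth S w n) : k ≤ n := by
  by_contra hlt
  exact hn.2 (hM.depthGE_of_le (by omega) h)

theorem WeaklyTransitive.hasDepth_unique (hM : M.WeaklyTransitive) {w : W} {m n : ℕ}
    (hm : M.HasDepth S w m) (hn : M.HasDepth S w n) : m = n :=
  le_antisymm (hM.le_of_depthGE hm.1 hn) (hM.le_of_depthGE hn.1 hm)

/-- A strictly ascending sequence of final worlds needs a new formula of `S` for each world. -/
theorem WeaklyTransitive.le_card_of_depthGE (hM : M.WeaklyTransitive) {w : W} {k : ℕ}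
    (h : M.DepthGE S k w) : k ≤ (S.filter fun ψ => ∃ v, M.Below w v ∧ M.Sat v ψ).card := by
  induction k generalizing w with
  | zero => exact Nat.zero_le _
  | succ k ih =>
    obtain ⟨v, ⟨ψ, hψ, hvψ, hmax⟩, hwv, hk⟩ := h
    refine (ih hk).trans_lt (Finset.card_lt_card ?_)
    refine Finset.ssubset_iff_subset_ne.2 ⟨?_, ?_⟩
    · intro χ hχ
      simp only [Finset.mem_filter] at hχ ⊢
      obtain ⟨hχS, u, hvu, hu⟩ := hχ
      exact ⟨hχS, u, hM.below_of_below_of_rrel hwv hvu.rrel, hu⟩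
    · intro heq
      have : ψ ∈ S.filter fun ψ => ∃ u, M.Below v u ∧ M.Sat u ψ := by
        rw [heq]
        exact Finset.mem_filter.2 ⟨hψ, v, hwv, hvψ⟩
      obtain ⟨-, u, hvu, hu⟩ := Finset.mem_filter.1 this
      exact hvu.2 (hmax u hvu.1 hu)

theorem WeaklyTransitive.lt_card_of_final (hM : M.WeaklyTransitive) {w : W} {k : ℕ}
    (hw : M.Final S w) (h : M.DepthGE S k w) : k < S.card := by
  refine (hM.le_card_of_depthGE h).trans_lt (Finset.card_lt_card ?_)
  obtain ⟨ψ, hψ, hwψ, hmax⟩ := hw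
  refine Finset.ssubset_iff_subset_ne.2 ⟨Finset.filter_subset _ _, fun heq => ?_⟩
  rw [← heq] at hψ
  obtain ⟨-, u, hwu, hu⟩ := Finset.mem_filter.1 hψ
  exact hwu.2 (hmax u hwu.1 hu)

theorem WeaklyTransitive.exists_hasDepth (hM : M.WeaklyTransitive) (S : Finset (MuForm 0)) (w : W) :
    ∃ n, M.HasDepth S w n := by
  have hb : ∃ n, ¬ M.DepthGE S (n + 1) w := ⟨S.card, fun h => by
    have := (hM.le_card_of_depthGE h).trans (Finset.card_filter_le _ _)
    omega⟩
  refine ⟨Nat.find hb, ?_, Nat.find_spec hb⟩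
  cases hn : Nat.find hb with
  | zero => trivial
  | succ m => exact not_not.1 (Nat.find_min hb (m := m) (by omega))

theorem WeaklyTransitive.depth_lt_of_below (hM : M.WeaklyTransitive) {w v : W} {m n : ℕ}
    (hw : M.HasDepth S w n) (hwv : M.Below w v) (hf : M.Final S v) (hv : M.HasDepth S v m) :
    m < n :=
  hM.le_of_depthGE (k := m + 1) ⟨v, hf, hwv, hv.1⟩ hw

theorem WeaklyTransitive.depth_le_of_rrel (hM : M.WeaklyTransitive) {w v : W} {m n : ℕ}
    (hw : M.HasDepth S w n) (hwv : M.rrel w v) (hv : M.HasDepth S v m) : m ≤ n :=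
  hM.le_of_depthGE (hM.depthGE_of_rrel hwv hv.1) hw

/-- A final world weakly above `w` and of the same depth lies in the cluster of `w`. -/
theorem WeaklyTransitive.mem_cluster_of_hasDepth (hM : M.WeaklyTransitive) {w v : W} {n : ℕ}
    (hw : M.HasDepth S w n) (hwv : M.rrel w v) (hf : M.Final S v) (hv : M.HasDepth S v n) :
    v ∈ M.cluster w :=
  (mem_cluster_or_below hwv).resolve_right fun h => (hM.depth_lt_of_below hw h hf hv).false

theorem WeaklyTransitive.exists_final_of_lt_depth (hM : M.WeaklyTransitive) {w : W} {m : ℕ}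
    {n : ℕ} (hw : M.DepthGE S n w) (hmn : m < n) :
    ∃ v, M.Below w v ∧ M.Final S v ∧ M.HasDepth S v m := by
  induction n generalizing w with
  | zero => omega
  | succ n ih =>
    obtain ⟨v, hf, hwv, hv⟩ := hw
    rcases Nat.lt_succ_iff_lt_or_eq.1 hmn with hmn | rfl
    · obtain ⟨x, hvx, hx⟩ := ih hv hmn
      exact ⟨x, hM.below_of_below_of_rrel hwv hvx.rrel, hx⟩
    · by_cases hv' : M.DepthGE S (m + 1) v
      · clear ih
        -- among the final worlds of depth at least `m` above `w`, a highest one has depth `m`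
        obtain ⟨k, hk⟩ := hM.exists_hasDepth S v
        induction k using Nat.strong_induction_on generalizing v with
        | _ k ih =>
          obtain ⟨x, hfx, hvx, hx⟩ := hv'
          obtain ⟨l, hl⟩ := hM.exists_hasDepth S x
          have hwx := hM.below_of_below_of_rrel hwv hvx.rrel
          by_cases hx' : M.DepthGE S (m + 1) x
          · exact ih l (hM.depth_lt_of_below hk hvx hfx hl) x hfx hwx hx hx' hl
          · exact ⟨x, hwx, hfx, hx, hx'⟩
      · exact ⟨v, hwv, hf, hv, hv'⟩

theorem WeaklyTransitive.depthDia_of_rrel (hM : M.WeaklyTransitive) {u v : W} (h : M.rrel u v)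
    {n : ℕ} {ψ : MuForm 0} (hv : M.DepthDia S n ψ v) : M.DepthDia S n ψ u := by
  obtain ⟨x, hf, hvx, hx⟩ := hv
  exact ⟨x, hf, hM.rrel_trans h hvx, hx⟩

theorem mem_theta {n m : ℕ} {ψ : MuForm 0} {w : W} :
    (m, ψ) ∈ M.theta S n w ↔ m < n ∧ ψ ∈ S ∧ M.DepthDia S m ψ w := by
  simp [theta, and_assoc]

theorem theta_mem_powerset {n : ℕ} {w : W} :
    M.theta S n w ∈ (Finset.range n ×ˢ S).powerset :=
  Finset.mem_powerset.2 (Finset.filter_subset _ _)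

theorem theta_eq_iff {n : ℕ} {w : W} {v : V} {N : KModel V} :
    M.theta S n w = N.theta S n v ↔
      ∀ m < n, ∀ ψ ∈ S, (M.DepthDia S m ψ w ↔ N.DepthDia S m ψ v) := by
  constructor
  · intro h m hm ψ hψ
    have := Finset.ext_iff.1 h (m, ψ)
    simpa [mem_theta, hm, hψ] using this
  · intro h
    ext ⟨m, ψ⟩
    rw [mem_theta, mem_theta]
    exact and_congr_right fun hm => and_congr_right fun hψ => h m hm ψ hψ

theorem WeaklyTransitive.theta_eq_of_mem_cluster (hM : M.WeaklyTransitive) {n : ℕ} {u w : W}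
    (hu : u ∈ M.cluster w) : M.theta S n u = M.theta S n w :=
  theta_eq_iff.2 fun _ _ _ _ => ⟨hM.depthDia_of_rrel hu.1, hM.depthDia_of_rrel hu.2⟩

/-- For a world of depth `n`, the set `theta` at level `n` records which formulas hold at final
worlds strictly above its cluster. -/
theorem WeaklyTransitive.exists_mem_theta_iff (hM : M.WeaklyTransitive) {n : ℕ} {w : W}
    (hw : M.HasDepth S w n) {ψ : MuForm 0} (hψ : ψ ∈ S) :
    (∃ m, (m, ψ) ∈ M.theta S n w) ↔ ∃ v, M.Below w v ∧ M.Final S v ∧ M.Sat v ψ := by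
  constructor
  · rintro ⟨m, hm⟩
    obtain ⟨hmn, -, v, hf, hwv, hv, hvψ⟩ := mem_theta.1 hm
    rcases mem_cluster_or_below hwv with hc | hb
    · have := hM.hasDepth_unique ((hM.hasDepth_iff_of_mem_cluster hc).1 hv) hw
      omega
    · exact ⟨v, hb, hf, hvψ⟩
  · rintro ⟨v, hb, hf, hvψ⟩
    obtain ⟨m, hm⟩ := hM.exists_hasDepth S v
    exact ⟨m, mem_theta.2 ⟨hM.depth_lt_of_below hw hb hf hm, hψ, v, hf, hb.rrel, hm, hvψ⟩⟩

end Sigma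
end KModel

/-! ### Clusters up to bisimilarity -/

namespace KModel

variable {W V : Type*}

theorem typeAt_subset (M : KModel W) (P : Finset ℕ) (w : W) : M.typeAt P w ⊆ P :=
  Finset.filter_subset _ _

theorem mem_typeAt {M : KModel W} {P : Finset ℕ} {w : W} {p : ℕ} :
    p ∈ M.typeAt P w ↔ p ∈ P ∧ w ∈ M.val p :=
  Finset.mem_filter

theorem typeAt_eq_iff {P : Finset ℕ} {M : KModel W} {N : KModel V} {u : W} {v : V} :
    M.typeAt P u = N.typeAt P v ↔ ∀ p ∈ P, (u ∈ M.val p ↔ v ∈ N.val p) := by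
  constructor
  · intro h p hp
    have := Finset.ext_iff.1 h p
    simpa [mem_typeAt, hp] using this
  · intro h
    ext p
    rw [mem_typeAt, mem_typeAt]
    exact and_congr_right fun hp => h p hp

/-- `t` is the type of some world. -/
def HasType (M : KModel W) (P : Finset ℕ) (t : Finset ℕ) : Prop := ∃ x, M.typeAt P x = t

/-- Some world of type `t` sees a world of type `t`. -/
def HasDouble (M : KModel W) (P : Finset ℕ) (t : Finset ℕ) : Prop :=
  ∃ x y, M.rel x y ∧ M.typeAt P x = t ∧ M.typeAt P y = t

/-- In a cluster, any point of a doubled type sees a point of that type. -/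
theorem HasDouble.exists_rel {M : KModel W} (hM : ∀ a b, a ≠ b → M.rel a b) {P t : Finset ℕ}
    (h : M.HasDouble P t) (x : W) : ∃ y, M.rel x y ∧ M.typeAt P y = t := by
  obtain ⟨a, b, hab, ha, hb⟩ := h
  by_cases hx : x = a
  · exact ⟨b, hx ▸ hab, hb⟩
  · exact ⟨a, hM x a hx, ha⟩

/-- Two models with the same types and the same doubled types match the successors of points of
equal types. -/
theorem exists_rel_of_types {M : KModel W} {N : KModel V} (hN : ∀ a b, a ≠ b → N.rel a b)
    {P : Finset ℕ} (h1 : ∀ t, M.HasType P t → N.HasType P t)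
    (h2 : ∀ t, M.HasDouble P t → N.HasDouble P t) {x x' : W} {y : V}
    (hxy : M.typeAt P x = N.typeAt P y) (hx : M.rel x x') :
    ∃ y', N.rel y y' ∧ M.typeAt P x' = N.typeAt P y' := by
  by_cases h : M.typeAt P x = M.typeAt P x'
  · obtain ⟨y', hy', ht⟩ := (h2 _ ⟨x, x', hx, rfl, h.symm⟩).exists_rel hN y
    exact ⟨y', hy', by rw [ht, h]⟩
  · obtain ⟨y', ht⟩ := h1 _ ⟨x', rfl⟩
    refine ⟨y', hN y y' ?_, ht.symm⟩
    rintro rfl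
    exact h (hxy.trans ht)

theorem bisimilar_iff {M : KModel W} {N : KModel V} (hM : ∀ a b, a ≠ b → M.rel a b)
    (hN : ∀ a b, a ≠ b → N.rel a b) {P : Finset ℕ} :
    Bisimilar P M N ↔ (∀ t, M.HasType P t ↔ N.HasType P t) ∧
      ∀ t, M.HasDouble P t ↔ N.HasDouble P t := by
  constructor
  · rintro ⟨ι, hat, hf, hb, ht, hs⟩
    have hat' : ∀ u v, ι u v → M.typeAt P u = N.typeAt P v := fun u v h =>
      typeAt_eq_iff.2 (hat u v h)
    refine ⟨fun t => ⟨?_, ?_⟩, fun t => ⟨?_, ?_⟩⟩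
    · rintro ⟨x, rfl⟩
      obtain ⟨y, hy⟩ := ht x
      exact ⟨y, (hat' x y hy).symm⟩
    · rintro ⟨y, rfl⟩
      obtain ⟨x, hx⟩ := hs y
      exact ⟨x, hat' x y hx⟩
    · rintro ⟨x, x', hr, h, h'⟩
      obtain ⟨y, hy⟩ := ht x
      obtain ⟨y', hr', hy'⟩ := hf x y x' hy hr
      exact ⟨y, y', hr', (hat' _ _ hy).symm.trans h, (hat' _ _ hy').symm.trans h'⟩
    · rintro ⟨y, y', hr, h, h'⟩
      obtain ⟨x, hx⟩ := hs y
      obtain ⟨x', hr', hx'⟩ := hb x y y' hx hr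
      exact ⟨x, x', hr', (hat' _ _ hx).trans h, (hat' _ _ hx').trans h'⟩
  · rintro ⟨h1, h2⟩
    refine ⟨fun u v => M.typeAt P u = N.typeAt P v, fun u v => typeAt_eq_iff.1, ?_, ?_, ?_, ?_⟩
    · intro u v u' huv hr
      exact exists_rel_of_types hN (fun t => (h1 t).1) (fun t => (h2 t).1) huv hr
    · intro u v v' huv hr
      obtain ⟨u', hu', h⟩ :=
        exists_rel_of_types hM (fun t => (h1 t).2) (fun t => (h2 t).2) huv.symm hr
      exact ⟨u', hu', h.symm⟩
    · intro u
      obtain ⟨v, hv⟩ := (h1 _).1 ⟨u, rfl⟩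
      exact ⟨v, hv.symm⟩
    · intro v
      exact (h1 _).2 ⟨v, rfl⟩

end KModel

open KModel

theorem typeAt_clusterModel {P : Finset ℕ} {K : Multiset (Finset ℕ)} {a : K.ToType} (ha : a.1 ⊆ P) :
    (clusterModel K).typeAt P a = a.1 := by
  ext p
  rw [mem_typeAt]
  exact ⟨fun h => h.2, fun h => ⟨ha h, h⟩⟩

theorem fst_mem {K : Multiset (Finset ℕ)} (a : K.ToType) : a.1 ∈ K :=
  Multiset.count_pos.1 (Fin.pos a.2)

theorem exists_fst_eq {K : Multiset (Finset ℕ)} {t : Finset ℕ} (ht : t ∈ K) :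
    ∃ a : K.ToType, a.1 = t := ⟨⟨t, ⟨0, Multiset.count_pos.2 ht⟩⟩, rfl⟩

theorem exists_ne_fst_eq_iff {K : Multiset (Finset ℕ)} {t : Finset ℕ} :
    (∃ a b : K.ToType, a ≠ b ∧ a.1 = t ∧ b.1 = t) ↔ 2 ≤ K.count t := by
  constructor
  · rintro ⟨⟨a, i⟩, ⟨b, j⟩, hne, rfl, hb⟩
    dsimp only at hb
    subst hb
    have : i ≠ j := fun h => hne (by rw [h])
    have h1 := i.2
    have h2 := j.2
    have h3 : i.val ≠ j.val := fun h => this (Fin.ext h)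
    dsimp only at *
    omega
  · intro h
    refine ⟨⟨t, ⟨0, by omega⟩⟩, ⟨t, ⟨1, by omega⟩⟩, ?_, rfl, rfl⟩
    intro h'
    have := eq_of_heq (Sigma.mk.inj h').2
    simp at this

theorem hasType_clusterModel {P : Finset ℕ} {K : Multiset (Finset ℕ)} (hK : ∀ t ∈ K, t ⊆ P)
    {t : Finset ℕ} : (clusterModel K).HasType P t ↔ t ∈ K := by
  constructor
  · rintro ⟨a, rfl⟩
    rw [typeAt_clusterModel (hK _ (fst_mem a))]
    exact fst_mem a
  · intro h
    obtain ⟨a, rfl⟩ := exists_fst_eq h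
    exact ⟨a, typeAt_clusterModel (hK _ h)⟩

theorem hasDouble_clusterModel {P : Finset ℕ} {K : Multiset (Finset ℕ)} (hK : ∀ t ∈ K, t ⊆ P)
    {t : Finset ℕ} : (clusterModel K).HasDouble P t ↔ 2 ≤ K.count t := by
  rw [← exists_ne_fst_eq_iff]
  refine exists_congr fun a => exists_congr fun b => ?_
  rw [typeAt_clusterModel (hK _ (fst_mem a)), typeAt_clusterModel (hK _ (fst_mem b))]
  exact Iff.rfl

theorem mem_clusterReps {P : Finset ℕ} {K : Multiset (Finset ℕ)} :
    K ∈ clusterReps P ↔ K ≠ 0 ∧ (∀ t ∈ K, t ⊆ P) ∧ ∀ t, K.count t ≤ 2 := by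
  rw [clusterReps, Finset.mem_erase, Multiset.mem_toFinset, Multiset.mem_powerset,
    Multiset.le_iff_count]
  refine and_congr_right fun _ => ?_
  have hc : ∀ t, Multiset.count t (2 • P.powerset.val) = if t ⊆ P then 2 else 0 := by
    intro t
    rw [Multiset.count_nsmul]
    split_ifs with h
    · rw [Multiset.count_eq_one_of_mem P.powerset.nodup (Finset.mem_powerset.2 h)]
    · rw [Multiset.count_eq_zero_of_notMem (fun h' => h (Finset.mem_powerset.1 h'))]
  constructor
  · intro h
    refine ⟨fun t ht => ?_, fun t => ?_⟩
    · by_contra h'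
      have := h t
      rw [hc, if_neg h', Nat.le_zero, Multiset.count_eq_zero] at this
      exact this ht
    · have := h t
      rw [hc] at this
      split_ifs at this <;> omega
  · rintro ⟨h1, h2⟩ t
    rw [hc]
    split_ifs with h
    · exact h2 t
    · rw [Multiset.count_eq_zero_of_notMem (fun h' => h (h1 t h'))]

/-- Representatives are compared by their elements and their repeated elements. -/
theorem le_iff_of_count_le_two {K K' : Multiset (Finset ℕ)} (hK : ∀ t, K.count t ≤ 2) :
    K ≤ K' ↔ (∀ t ∈ K, t ∈ K') ∧ ∀ t, 2 ≤ K.count t → 2 ≤ K'.count t := by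
  rw [Multiset.le_iff_count]
  constructor
  · intro h
    exact ⟨fun t ht => Multiset.count_pos.1 ((Multiset.count_pos.2 ht).trans_le (h t)),
      fun t ht => ht.trans (h t)⟩
  · rintro ⟨h1, h2⟩ t
    have h3 := hK t
    by_cases h : 2 ≤ K.count t
    · have := h2 t h
      omega
    · by_cases h' : t ∈ K
      · have := Multiset.count_pos.2 (h1 t h')
        omega
      · rw [Multiset.count_eq_zero_of_notMem h']
        exact Nat.zero_le _

theorem bisimilar_clusterModel_iff {P : Finset ℕ} {K K' : Multiset (Finset ℕ)}
    (hK : ∀ t ∈ K, t ⊆ P) (hK2 : ∀ t, K.count t ≤ 2) (hK' : ∀ t ∈ K', t ⊆ P)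
    (hK2' : ∀ t, K'.count t ≤ 2) :
    Bisimilar P (clusterModel K) (clusterModel K') ↔ K = K' := by
  rw [bisimilar_iff (fun _ _ h => h) (fun _ _ h => h)]
  simp only [hasType_clusterModel hK, hasType_clusterModel hK', hasDouble_clusterModel hK,
    hasDouble_clusterModel hK']
  constructor
  · rintro ⟨h1, h2⟩
    exact le_antisymm ((le_iff_of_count_le_two hK2).2 ⟨fun t => (h1 t).1, fun t => (h2 t).1⟩)
      ((le_iff_of_count_le_two hK2').2 ⟨fun t => (h1 t).2, fun t => (h2 t).2⟩)
  · rintro rfl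
    exact ⟨fun _ => Iff.rfl, fun _ => Iff.rfl⟩

theorem smallerCluster_iff {P : Finset ℕ} {K K' : Multiset (Finset ℕ)} (hK : K ∈ clusterReps P)
    (hK' : K' ∈ clusterReps P) : SmallerCluster P K K' ↔ K < K' := by
  obtain ⟨-, h1, h2⟩ := mem_clusterReps.1 hK
  obtain ⟨-, h1', h2'⟩ := mem_clusterReps.1 hK'
  rw [SmallerCluster, bisimilar_clusterModel_iff h1 h2 h1' h2', lt_iff_le_and_ne]
  refine and_congr_left fun _ => ⟨?_, fun h => ⟨K, h, ?_⟩⟩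
  · rintro ⟨K'', hle, hb⟩
    rw [bisimilar_clusterModel_iff h1 h2 (fun t ht => h1' t (Multiset.mem_of_le hle ht))
      (fun t => (Multiset.count_le_of_le t hle).trans (h2' t))] at hb
    exact hb ▸ hle
  · exact (bisimilar_clusterModel_iff h1 h2 h1 h2).2 rfl

theorem pairLT_iff {P : Finset ℕ} {c' c : CPair} (hc' : c'.1 ∈ clusterReps P)
    (hc : c.1 ∈ clusterReps P) : PairLT P c' c ↔ c'.1 < c.1 ∧ c'.2 = c.2 := by
  rw [PairLT, smallerCluster_iff hc' hc]

theorem pairLE_iff {P : Finset ℕ} {c' c : CPair} (hc' : c'.1 ∈ clusterReps P)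
    (hc : c.1 ∈ clusterReps P) : PairLE P c' c ↔ c'.1 ≤ c.1 ∧ c'.2 = c.2 := by
  rw [PairLE, pairLT_iff hc' hc, le_iff_lt_or_eq, Prod.ext_iff]
  tauto

/-- Putting `K'` below `K` gives nothing new up to bisimilarity if and only if all types in `K'` are
repeated in `K`. -/
theorem bisimilar_stack_iff {P : Finset ℕ} {K K' : Multiset (Finset ℕ)}
    (hK : ∀ t ∈ K, t ⊆ P) (hK' : ∀ t ∈ K', t ⊆ P) :
    Bisimilar P ((clusterModel K).stack (clusterModel K')) (clusterModel K) ↔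
      ∀ t ∈ K', 2 ≤ K.count t := by
  have hinl : ∀ a : K.ToType, ((clusterModel K).stack (clusterModel K')).typeAt P (.inl a) = a.1 :=
    fun a => typeAt_clusterModel (hK _ (fst_mem a))
  have hinr : ∀ a : K'.ToType, ((clusterModel K).stack (clusterModel K')).typeAt P (.inr a) = a.1 :=
    fun a => typeAt_clusterModel (hK' _ (fst_mem a))
  have hcl : ∀ a : K.ToType, (clusterModel K).typeAt P a = a.1 :=
    fun a => typeAt_clusterModel (hK _ (fst_mem a))
  constructor
  · rintro ⟨ι, hat, hf, -, ht, -⟩ t htK'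
    obtain ⟨a, rfl⟩ := exists_fst_eq htK'
    obtain ⟨x, hx⟩ := ht (.inr a)
    have hx' : a.1 = x.1 := (hinr a).symm.trans ((typeAt_eq_iff.2 (hat _ _ hx)).trans (hcl x))
    obtain ⟨y, hxy, hy⟩ := hf _ _ (.inl x) hx trivial
    have hy' : x.1 = y.1 := (hinl x).symm.trans ((typeAt_eq_iff.2 (hat _ _ hy)).trans (hcl y))
    exact exists_ne_fst_eq_iff.1 ⟨x, y, hxy, hx'.symm, by rw [← hy', hx']⟩
  · intro h
    have key : ∀ (x : K.ToType) (t : Finset ℕ), 2 ≤ K.count t →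
        ∃ y : K.ToType, x ≠ y ∧ y.1 = t := by
      intro x t ht
      obtain ⟨y, hy, hy'⟩ := ((hasDouble_clusterModel hK).2 ht).exists_rel (fun _ _ h => h) x
      exact ⟨y, hy, by rw [← hcl, hy']⟩
    have key' : ∀ (x y : K.ToType) (t : Finset ℕ), t = x.1 → (2 ≤ K.count t) →
        ∃ x', x ≠ x' ∧ y.1 = x'.1 := by
      intro x y t htx ht
      by_cases hxy : y.1 = t
      · obtain ⟨z, hz, hz'⟩ := key x t ht
        exact ⟨z, hz, by rw [hz', hxy]⟩
      · refine ⟨y, ?_, rfl⟩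
        rintro rfl
        exact hxy htx.symm
    refine ⟨fun u v => ((clusterModel K).stack (clusterModel K')).typeAt P u =
      (clusterModel K).typeAt P v, fun u v => typeAt_eq_iff.1, ?_, ?_, ?_, ?_⟩
    · rintro (a | a) x (b | b) hax hr
      · exact exists_rel_of_types (M := clusterModel K) (N := clusterModel K) (fun _ _ h => h)
          (fun _ h => h) (fun _ h => h) hax hr
      · exact hr.elim
      · rw [hinr, hcl] at hax
        obtain ⟨x', hx', hb⟩ := key' x b a.1 hax (h _ (fst_mem a))
        exact ⟨x', hx', (hinl b).trans (hb.trans (hcl x').symm)⟩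
      · obtain ⟨x', hx', hb⟩ := key x b.1 (h _ (fst_mem b))
        exact ⟨x', hx', (hinr b).trans (hb.symm.trans (hcl x').symm)⟩
    · rintro (a | a) x y hax hr
      · obtain ⟨b, hb, hby⟩ := exists_rel_of_types (M := clusterModel K) (N := clusterModel K)
          (P := P) (fun _ _ h => h) (fun _ h => h) (fun _ h => h) (x := x) (y := a) hax.symm hr
        exact ⟨.inl b, hb, hby.symm⟩
      · exact ⟨.inl y, trivial, (hinl y).trans (hcl y).symm⟩
    · rintro (a | a)
      · exact ⟨a, (hinl a).trans (hcl a).symm⟩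
      · obtain ⟨x, hx⟩ := exists_fst_eq (Multiset.count_pos.1 ((Nat.zero_lt_two).trans_le
          (h _ (fst_mem a))))
        exact ⟨x, (hinr a).trans (hx.symm.trans (hcl x).symm)⟩
    · exact fun x => ⟨.inl x, (hinl x).trans (hcl x).symm⟩

namespace KModel

variable {W V : Type*}

/-- The types of the points of the cluster of `w`. -/
def clusterTypes (M : KModel W) (P : Finset ℕ) (w : W) : Finset (Finset ℕ) :=
  P.powerset.filter fun t => ∃ x ∈ M.cluster w, M.typeAt P x = t

/-- The types `t` such that a point of type `t` of the cluster of `w` sees such a point. -/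
def doubleTypes (M : KModel W) (P : Finset ℕ) (w : W) : Finset (Finset ℕ) :=
  P.powerset.filter fun t => ∃ x ∈ M.cluster w, ∃ y ∈ M.cluster w, M.rel x y ∧
    M.typeAt P x = t ∧ M.typeAt P y = t

/-- The canonical representative of the cluster of `w`. -/
def clusterRep (M : KModel W) (P : Finset ℕ) (w : W) : Multiset (Finset ℕ) :=
  (M.clusterTypes P w).val + (M.doubleTypes P w).val

variable {M : KModel W} {P : Finset ℕ}

theorem mem_clusterTypes {w : W} {t : Finset ℕ} :
    t ∈ M.clusterTypes P w ↔ ∃ x ∈ M.cluster w, M.typeAt P x = t := by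
  rw [clusterTypes, Finset.mem_filter, and_iff_right_iff_imp]
  rintro ⟨x, -, rfl⟩
  exact Finset.mem_powerset.2 (M.typeAt_subset P x)

theorem mem_doubleTypes {w : W} {t : Finset ℕ} :
    t ∈ M.doubleTypes P w ↔ ∃ x ∈ M.cluster w, ∃ y ∈ M.cluster w, M.rel x y ∧
      M.typeAt P x = t ∧ M.typeAt P y = t := by
  rw [doubleTypes, Finset.mem_filter, and_iff_right_iff_imp]
  rintro ⟨x, -, -, -, -, rfl, -⟩
  exact Finset.mem_powerset.2 (M.typeAt_subset P x)

theorem doubleTypes_subset {w : W} : M.doubleTypes P w ⊆ M.clusterTypes P w := fun t ht => by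
  obtain ⟨x, hx, -, -, -, h, -⟩ := mem_doubleTypes.1 ht
  exact mem_clusterTypes.2 ⟨x, hx, h⟩

theorem mem_clusterRep {w : W} {t : Finset ℕ} :
    t ∈ M.clusterRep P w ↔ ∃ x ∈ M.cluster w, M.typeAt P x = t := by
  rw [clusterRep, Multiset.mem_add, Finset.mem_val, Finset.mem_val, ← mem_clusterTypes]
  exact or_iff_left_of_imp fun h => doubleTypes_subset h

theorem count_clusterRep {w : W} {t : Finset ℕ} : (M.clusterRep P w).count t =
    (if t ∈ M.clusterTypes P w then 1 else 0) + if t ∈ M.doubleTypes P w then 1 else 0 := by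
  rw [clusterRep, Multiset.count_add, Multiset.count_eq_of_nodup (Finset.nodup _),
    Multiset.count_eq_of_nodup (Finset.nodup _)]
  rfl

theorem two_le_count_clusterRep {w : W} {t : Finset ℕ} : 2 ≤ (M.clusterRep P w).count t ↔
    ∃ x ∈ M.cluster w, ∃ y ∈ M.cluster w, M.rel x y ∧ M.typeAt P x = t ∧ M.typeAt P y = t := by
  rw [← mem_doubleTypes, count_clusterRep]
  by_cases h : t ∈ M.doubleTypes P w
  · simp [h, doubleTypes_subset h]
  · simp only [h, if_false, add_zero, iff_false]
    split_ifs <;> omega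

theorem clusterRep_mem_clusterReps (M : KModel W) (P : Finset ℕ) (w : W) :
    M.clusterRep P w ∈ clusterReps P := by
  refine mem_clusterReps.2 ⟨?_, fun t ht => ?_, fun t => ?_⟩
  · intro h
    have : M.typeAt P w ∈ M.clusterRep P w := mem_clusterRep.2 ⟨w, M.mem_cluster_self w, rfl⟩
    rw [h] at this
    exact Multiset.notMem_zero _ this
  · obtain ⟨x, -, rfl⟩ := mem_clusterRep.1 ht
    exact M.typeAt_subset P x
  · rw [count_clusterRep]
    split_ifs <;> omega

theorem subset_of_mem_clusterRep {w : W} {t : Finset ℕ} (ht : t ∈ M.clusterRep P w) : t ⊆ P :=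
  (mem_clusterReps.1 (M.clusterRep_mem_clusterReps P w)).2.1 t ht

theorem count_clusterRep_le_two {w : W} {t : Finset ℕ} : (M.clusterRep P w).count t ≤ 2 :=
  (mem_clusterReps.1 (M.clusterRep_mem_clusterReps P w)).2.2 t

theorem WeaklyTransitive.clusterRep_eq_of_mem_cluster (hM : M.WeaklyTransitive) {u w : W}
    (h : u ∈ M.cluster w) : M.clusterRep P u = M.clusterRep P w := by
  simp only [clusterRep, clusterTypes, doubleTypes, hM.cluster_eq h]

/-- If `t` is a repeated type of the cluster of `w`, then every point of the cluster sees a point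
of type `t` in the cluster. -/
theorem WeaklyTransitive.exists_rel_of_two_le_count (hM : M.WeaklyTransitive) {w : W}
    {t : Finset ℕ} (h : 2 ≤ (M.clusterRep P w).count t) {x : W} (hx : x ∈ M.cluster w) :
    ∃ y ∈ M.cluster w, M.rel x y ∧ M.typeAt P y = t := by
  obtain ⟨a, ha, b, hb, hab, hta, htb⟩ := two_le_count_clusterRep.1 h
  by_cases hxa : x = a
  · exact ⟨b, hb, hxa ▸ hab, htb⟩
  · exact ⟨a, ha, hM.rel_of_mem_cluster hx ha hxa, hta⟩

/-- Inside clusters, successors of a point of a smaller cluster are matched at points of equal type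
of a larger one. -/
theorem WeaklyTransitive.exists_rel_of_clusterRep_le (hM : M.WeaklyTransitive) {N : KModel V}
    {w x : W} {v y y' : V} (hle : N.clusterRep P v ≤ M.clusterRep P w) (hx : x ∈ M.cluster w)
    (hy : y ∈ N.cluster v) (hy' : y' ∈ N.cluster v) (hxy : M.typeAt P x = N.typeAt P y)
    (hr : N.rel y y') : ∃ x' ∈ M.cluster w, M.rel x x' ∧ M.typeAt P x' = N.typeAt P y' := by
  by_cases h : N.typeAt P y = N.typeAt P y'
  · exact hM.exists_rel_of_two_le_count ((two_le_count_clusterRep.2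
      ⟨y, hy, y', hy', hr, h, rfl⟩).trans (Multiset.count_le_of_le _ hle)) hx
  · obtain ⟨x', hx', ht⟩ := mem_clusterRep.1 (Multiset.mem_of_le hle
      (mem_clusterRep.2 ⟨y', hy', rfl⟩))
    refine ⟨x', hx', hM.rel_of_mem_cluster hx hx' ?_, ht⟩
    rintro rfl
    exact h (hxy.symm.trans ht)

theorem WeaklyTransitive.represents_iff (hM : M.WeaklyTransitive) {w : W}
    {K : Multiset (Finset ℕ)} : Represents P M w K ↔ K = M.clusterRep P w := by
  have hcl : ∀ a b : M.cluster w, a ≠ b → (M.restrict (M.cluster w)).rel a b := fun a b hab =>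
    hM.rel_of_mem_cluster a.2 b.2 fun h => hab (Subtype.ext h)
  have hT : ∀ t, (M.restrict (M.cluster w)).HasType P t ↔ t ∈ M.clusterRep P w := by
    intro t
    rw [mem_clusterRep]
    exact ⟨fun ⟨x, hx⟩ => ⟨x, x.2, hx⟩, fun ⟨x, hx, h⟩ => ⟨⟨x, hx⟩, h⟩⟩
  have hD : ∀ t, (M.restrict (M.cluster w)).HasDouble P t ↔ 2 ≤ (M.clusterRep P w).count t := by
    intro t
    rw [two_le_count_clusterRep]
    exact ⟨fun ⟨x, y, h⟩ => ⟨x, x.2, y, y.2, h⟩,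
      fun ⟨x, hx, y, hy, h⟩ => ⟨⟨x, hx⟩, ⟨y, hy⟩, h⟩⟩
  have key : ∀ K ∈ clusterReps P, (Bisimilar P (M.restrict (M.cluster w)) (clusterModel K) ↔
      K = M.clusterRep P w) := by
    intro K hK
    obtain ⟨-, h1, h2⟩ := mem_clusterReps.1 hK
    rw [bisimilar_iff hcl (fun _ _ h => h)]
    simp only [hasType_clusterModel h1, hasDouble_clusterModel h1, hT, hD]
    constructor
    · rintro ⟨h3, h4⟩
      exact le_antisymm
        ((le_iff_of_count_le_two h2).2 ⟨fun t => (h3 t).2, fun t => (h4 t).2⟩)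
        ((le_iff_of_count_le_two fun t => count_clusterRep_le_two).2
          ⟨fun t => (h3 t).1, fun t => (h4 t).1⟩)
    · rintro rfl
      exact ⟨fun _ => Iff.rfl, fun _ => Iff.rfl⟩
  constructor
  · rintro ⟨hK, hb⟩
    exact (key K hK).1 hb
  · rintro rfl
    exact ⟨M.clusterRep_mem_clusterReps P w, (key _ (M.clusterRep_mem_clusterReps P w)).2 rfl⟩

end KModel

/-! ### Which data determine the formulas true in a cluster -/

namespace KModel

variable {W V : Type*} {M : KModel W} {N : KModel V} {φ : MuForm 0}

/-- The pair `⟨C, Θ⟩` of the cluster of `w` and the formulas `⟨m⟩‾ ψ` with `m < n` true at `w`. -/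
def pair (M : KModel W) (φ : MuForm 0) (n : ℕ) (w : W) : CPair :=
  (M.clusterRep φ.atoms w, M.theta φ.sigma n w)

theorem WeaklyTransitive.pair_eq_of_mem_cluster (hM : M.WeaklyTransitive) {n : ℕ} {u w : W}
    (hu : u ∈ M.cluster w) : M.pair φ n u = M.pair φ n w := by
  rw [pair, pair, hM.clusterRep_eq_of_mem_cluster hu, hM.theta_eq_of_mem_cluster hu]

/-- A formula true at `u'`, weakly above `u`, also holds at a final world strictly above `u`, unless
`u'` is a final world of the cluster of `u`. -/
theorem WeaklyTransitive.exists_final_above [Finite W] (hM : M.WeaklyTransitive) {u u' : W}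
    (hr : M.rrel u u') (hnot : ¬ (u' ∈ M.cluster u ∧ M.Final φ.sigma u')) {ψ : MuForm 0}
    (hψ : ψ ∈ φ.sigma) (hu' : M.Sat u' ψ) :
    ∃ x, M.Below u x ∧ M.Final φ.sigma x ∧ M.Sat x ψ := by
  rcases mem_cluster_or_below hr with hc | hb
  · obtain ⟨x, hx, h⟩ := hM.exists_final_above_of_not_final hψ (fun hf => hnot ⟨hc, hf⟩) hu'
    exact ⟨x, hM.below_of_rrel_of_below hr hx, h⟩
  · obtain ⟨x, hx, h⟩ := hM.exists_final_of_sat hψ hu'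
    exact ⟨x, hM.below_of_below_of_rrel hb hx, h⟩

/-- A relation between worlds of two models preserves the formulas of `sigma φ` if related worlds
have the same type, the same formulas hold at final worlds strictly above them, and those of their
successors that lie in the same cluster and are final are matched. -/
theorem sat_iff_of_match [Finite W] [Finite V] (hM : M.WeaklyTransitive)
    (hN : N.WeaklyTransitive) {Z : W → V → Prop}
    (hat : ∀ u v, Z u v → M.typeAt φ.atoms u = N.typeAt φ.atoms v)
    (hup : ∀ u v, Z u v → ∀ ψ ∈ φ.sigma, ((∃ x, M.Below u x ∧ M.Final φ.sigma x ∧ M.Sat x ψ) ↔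
      ∃ y, N.Below v y ∧ N.Final φ.sigma y ∧ N.Sat y ψ))
    (hforth : ∀ u v u', Z u v → M.rel u u' → u' ∈ M.cluster u → M.Final φ.sigma u' →
      ∃ v', N.rel v v' ∧ Z u' v')
    (hback : ∀ u v v', Z u v → N.rel v v' → v' ∈ N.cluster v → N.Final φ.sigma v' →
      ∃ u', M.rel u u' ∧ Z u' v')
    {u : W} {v : V} (huv : Z u v) : ∀ ψ ∈ φ.sigma, (M.Sat u ψ ↔ N.Sat v ψ) := by
  have hbis : SBisim φ.atoms φ.sigma M N Z := by
    refine ⟨fun u v huv => typeAt_eq_iff.1 (hat u v huv), ?_, ?_⟩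
    · intro u v u' huv hr
      by_cases hc : u' ∈ M.cluster u ∧ M.Final φ.sigma u'
      · exact .inl (hforth u v u' huv hr hc.1 hc.2)
      · refine .inr fun ψ hψ hu' => ?_
        obtain ⟨y, hy, -, hyψ⟩ := (hup u v huv ψ hψ).1 (hM.exists_final_above (.inr hr) hc hψ hu')
        exact ⟨y, hy.1, hyψ⟩
    · intro u v v' huv hr
      by_cases hc : v' ∈ N.cluster v ∧ N.Final φ.sigma v'
      · exact .inl (hback u v v' huv hr hc.1 hc.2)
      · refine .inr fun ψ hψ hv' => ?_
        obtain ⟨x, hx, -, hxψ⟩ := (hup u v huv ψ hψ).2 (hN.exists_final_above (.inr hr) hc hψ hv')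
        exact ⟨x, hx.1, hxψ⟩
  exact hbis.sat_iff huv

theorem exists_above_iff_of_theta_eq (hM : M.WeaklyTransitive) (hN : N.WeaklyTransitive) {n : ℕ}
    {w x : W} {v y : V} (hw : M.HasDepth φ.sigma w n) (hv : N.HasDepth φ.sigma v n)
    (hθ : M.theta φ.sigma n w = N.theta φ.sigma n v) (hx : x ∈ M.cluster w) (hy : y ∈ N.cluster v) :
    ∀ ψ ∈ φ.sigma, ((∃ z, M.Below x z ∧ M.Final φ.sigma z ∧ M.Sat z ψ) ↔
      ∃ z, N.Below y z ∧ N.Final φ.sigma z ∧ N.Sat z ψ) := by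
  intro ψ hψ
  rw [← hM.exists_mem_theta_iff ((hM.hasDepth_iff_of_mem_cluster hx).2 hw) hψ,
    ← hN.exists_mem_theta_iff ((hN.hasDepth_iff_of_mem_cluster hy).2 hv) hψ,
    hM.theta_eq_of_mem_cluster hx, hN.theta_eq_of_mem_cluster hy, hθ]

/-- The pair `⟨C, Θ⟩` at a world of depth `n` determines the formulas true in its cluster. -/
theorem sat_iff_of_pair_eq [Finite W] [Finite V] (hM : M.WeaklyTransitive)
    (hN : N.WeaklyTransitive) {n : ℕ} {w x : W} {v y : V} (hw : M.HasDepth φ.sigma w n)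
    (hv : N.HasDepth φ.sigma v n) (hp : M.pair φ n w = N.pair φ n v) (hx : x ∈ M.cluster w)
    (hy : y ∈ N.cluster v) (hxy : M.typeAt φ.atoms x = N.typeAt φ.atoms y) :
    ∀ ψ ∈ φ.sigma, (M.Sat x ψ ↔ N.Sat y ψ) := by
  obtain ⟨hrep, hθ⟩ := Prod.ext_iff.1 hp
  dsimp only [pair] at hrep hθ
  refine sat_iff_of_match hM hN (Z := fun x y => x ∈ M.cluster w ∧ y ∈ N.cluster v ∧
    M.typeAt φ.atoms x = N.typeAt φ.atoms y) (fun _ _ h => h.2.2) ?_ ?_ ?_ ⟨hx, hy, hxy⟩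
  · rintro x y ⟨hx, hy, -⟩
    exact exists_above_iff_of_theta_eq hM hN hw hv hθ hx hy
  · rintro x y x' ⟨hx, hy, hxy⟩ hr hx' -
    have hx' := hM.mem_cluster_trans hx' hx
    obtain ⟨y', hy', hr', ht⟩ := hN.exists_rel_of_clusterRep_le hrep.le hy hx hx' hxy.symm hr
    exact ⟨y', hr', hx', hy', ht.symm⟩
  · rintro x y y' ⟨hx, hy, hxy⟩ hr hy' -
    have hy' := hN.mem_cluster_trans hy' hy
    obtain ⟨x', hx', hr', ht⟩ := hM.exists_rel_of_clusterRep_le hrep.ge hx hy hy' hxy hr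
    exact ⟨x', hr', hx', hy', ht⟩

/-- If a cluster contains a copy of the cluster of a final world of the same depth and with the same
formulas above it, then it is final. Otherwise all of its points would be irrelevant for the
formulas true at its points, so that the points of the copy would satisfy the same formulas as the
corresponding points of the final cluster. -/
theorem final_of_clusterRep_le [Finite W] [Finite V] (hM : M.WeaklyTransitive)
    (hN : N.WeaklyTransitive) {n : ℕ} {w : W} {v : V} (hw : M.HasDepth φ.sigma w n)
    (hv : N.HasDepth φ.sigma v n) (hf : N.Final φ.sigma v)
    (hle : N.clusterRep φ.atoms v ≤ M.clusterRep φ.atoms w)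
    (hθ : M.theta φ.sigma n w = N.theta φ.sigma n v) : M.Final φ.sigma w := by
  by_contra hnf
  have hnf' : ∀ x ∈ M.cluster w, ¬ M.Final φ.sigma x := fun x hx h =>
    hnf ((hM.final_iff_of_mem_cluster hx).1 h)
  obtain ⟨x, hx, hxv⟩ := mem_clusterRep.1 (Multiset.mem_of_le hle
    (mem_clusterRep.2 ⟨v, N.mem_cluster_self v, rfl⟩))
  have key : ∀ ψ ∈ φ.sigma, (M.Sat x ψ ↔ N.Sat v ψ) := by
    refine sat_iff_of_match hM hN (Z := fun x y => x ∈ M.cluster w ∧ y ∈ N.cluster v ∧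
      M.typeAt φ.atoms x = N.typeAt φ.atoms y) (fun _ _ h => h.2.2) ?_ ?_ ?_
      ⟨hx, N.mem_cluster_self v, hxv⟩
    · rintro x y ⟨hx, hy, -⟩
      exact exists_above_iff_of_theta_eq hM hN hw hv hθ hx hy
    · rintro x y x' ⟨hx, hy, hxy⟩ hr hx' hf'
      exact (hnf' x' (hM.mem_cluster_trans hx' hx) hf').elim
    · rintro x y y' ⟨hx, hy, hxy⟩ hr hy' -
      have hy' := hN.mem_cluster_trans hy' hy
      obtain ⟨x', hx', hr', ht⟩ := hM.exists_rel_of_clusterRep_le hle hx hy hy' hxy hr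
      exact ⟨x', hr', hx', hy', ht⟩
  obtain ⟨ψ, hψ, hvψ, hmax⟩ := hf
  obtain ⟨z, hz, hzf, hzψ⟩ := (exists_above_iff_of_theta_eq hM hN hw hv hθ hx
    (N.mem_cluster_self v) ψ hψ).1
    (hM.exists_final_above_of_not_final hψ (hnf' x hx) ((key ψ hψ).2 hvψ))
  exact hz.2 (hmax z hz.1 hzψ)

/-- The formulas true at a non-final world are determined by its type and the formulas true at final
worlds above it. -/
theorem sat_iff_of_not_final [Finite W] [Finite V] (hM : M.WeaklyTransitive)
    (hN : N.WeaklyTransitive) {n : ℕ} {w : W} {v : V} (hw : M.HasDepth φ.sigma w n)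
    (hv : N.HasDepth φ.sigma v n) (hwf : ¬ M.Final φ.sigma w) (hvf : ¬ N.Final φ.sigma v)
    (hwv : M.typeAt φ.atoms w = N.typeAt φ.atoms v)
    (hθ : M.theta φ.sigma n w = N.theta φ.sigma n v) :
    ∀ ψ ∈ φ.sigma, (M.Sat w ψ ↔ N.Sat v ψ) := by
  refine sat_iff_of_match hM hN (Z := fun x y => x = w ∧ y = v) ?_ ?_ ?_ ?_ ⟨rfl, rfl⟩
  · rintro x y ⟨rfl, rfl⟩
    exact hwv
  · rintro x y ⟨rfl, rfl⟩
    exact exists_above_iff_of_theta_eq hM hN hw hv hθ (M.mem_cluster_self _)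
      (N.mem_cluster_self _)
  · rintro x y x' ⟨rfl, rfl⟩ hr hx' hf'
    exact (hwf ((hM.final_iff_of_mem_cluster hx').1 hf')).elim
  · rintro x y y' ⟨rfl, rfl⟩ hr hy' hf'
    exact (hvf ((hN.final_iff_of_mem_cluster hy').1 hf')).elim

/-- If all types of the cluster of `w` are repeated in the cluster of a world `v` strictly above,
and nothing else than what is seen from `v` is seen from `w`, then the points of the first cluster
satisfy the same formulas as those of equal type of the second. -/
theorem WeaklyTransitive.sat_iff_of_absorbed [Finite W] (hM : M.WeaklyTransitive) {n : ℕ}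
    {w v x y : W} (hw : M.HasDepth φ.sigma w (n + 1)) (hv : M.HasDepth φ.sigma v n)
    (hwv : M.Below w v) (hθ : M.theta φ.sigma (n + 1) w = M.theta φ.sigma (n + 1) v)
    (hrep : ∀ t ∈ M.clusterRep φ.atoms w, 2 ≤ (M.clusterRep φ.atoms v).count t)
    (hx : x ∈ M.cluster w) (hy : y ∈ M.cluster v)
    (hxy : M.typeAt φ.atoms x = M.typeAt φ.atoms y) :
    ∀ ψ ∈ φ.sigma, (M.Sat x ψ ↔ M.Sat y ψ) := by
  have hbis : SBisim φ.atoms φ.sigma M M (fun x y => x ∈ M.cluster w ∧ y ∈ M.cluster v ∧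
      M.typeAt φ.atoms x = M.typeAt φ.atoms y) := by
    refine ⟨fun u v huv => typeAt_eq_iff.1 huv.2.2, ?_, ?_⟩
    · rintro x y x' ⟨hx, hy, hxy⟩ hr
      rcases mem_cluster_or_below (hM.rrel_trans hx.1 (.inr hr)) with hx' | hx'
      · obtain ⟨y', hy', hr', ht⟩ := hM.exists_rel_of_two_le_count
          (hrep _ (mem_clusterRep.2 ⟨x', hx', rfl⟩)) hy
        exact .inl ⟨y', hr', hx', hy', ht.symm⟩
      · refine .inr fun ψ hψ hx'ψ => ?_
        obtain ⟨z, hz, hzf, hzψ⟩ := hM.exists_final_of_sat hψ hx'ψ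
        have hwz := hM.below_of_below_of_rrel hx' hz
        obtain ⟨m, hm⟩ := (hM.exists_mem_theta_iff hw hψ).2 ⟨z, hwz, hzf, hzψ⟩
        rw [hθ] at hm
        obtain ⟨-, -, u, huf, hvu, -, huψ⟩ := mem_theta.1 hm
        rcases hM.rrel_trans hy.2 hvu with rfl | hyu
        · -- if `ψ` is only known to hold at `y` itself, use a successor of the same type
          obtain ⟨y', hy', hr', ht⟩ := hM.exists_rel_of_two_le_count
            (hrep _ (mem_clusterRep.2 ⟨x, hx, rfl⟩)) hy
          exact ⟨y', hr', (sat_iff_of_pair_eq hM hM hv hv rfl hy' hy (ht.trans hxy) ψ hψ).2 huψ⟩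
        · exact ⟨u, hyu, huψ⟩
    · rintro x y y' ⟨hx, hy, hxy⟩ hr
      refine .inr fun ψ hψ hy'ψ => ⟨y', ?_, hy'ψ⟩
      exact (hM.below_of_rrel_of_below hx.2 (hM.below_of_below_of_rrel hwv
        (hM.rrel_trans hy.1 (.inr hr)))).1
  exact hbis.sat_iff ⟨hx, hy, hxy⟩

/-- The pair `⟨C, Θ⟩` at a final world of depth `n` also determines the formulas `⟨n⟩‾ ψ` true
there. -/
theorem theta_succ_eq_of_pair_eq [Finite W] [Finite V] (hM : M.WeaklyTransitive)
    (hN : N.WeaklyTransitive) {n : ℕ} {w : W} {v : V} (hw : M.HasDepth φ.sigma w n)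
    (hv : N.HasDepth φ.sigma v n) (hwf : M.Final φ.sigma w) (hvf : N.Final φ.sigma v)
    (hp : M.pair φ n w = N.pair φ n v) :
    M.theta φ.sigma (n + 1) w = N.theta φ.sigma (n + 1) v := by
  obtain ⟨hrep, hθ⟩ := Prod.ext_iff.1 hp
  dsimp only [pair] at hrep hθ
  refine theta_eq_iff.2 fun m hm ψ hψ => ?_
  rcases Nat.lt_succ_iff_lt_or_eq.1 hm with hm | rfl
  · exact theta_eq_iff.1 hθ m hm ψ hψ
  constructor
  · rintro ⟨x, hxf, hwx, hx, hxψ⟩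
    have hxc := hM.mem_cluster_of_hasDepth hw hwx hxf hx
    obtain ⟨y, hy, hxy⟩ := mem_clusterRep.1 (hrep ▸ mem_clusterRep.2 ⟨x, hxc, rfl⟩)
    exact ⟨y, hN.final_of_mem_cluster hvf hy, hy.1, (hN.hasDepth_iff_of_mem_cluster hy).2 hv,
      (sat_iff_of_pair_eq hM hN hw hv hp hxc hy hxy.symm ψ hψ).1 hxψ⟩
  · rintro ⟨y, hyf, hvy, hy, hyψ⟩
    have hyc := hN.mem_cluster_of_hasDepth hv hvy hyf hy
    obtain ⟨x, hx, hxy⟩ := mem_clusterRep.1 (hrep.symm ▸ mem_clusterRep.2 ⟨y, hyc, rfl⟩)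
    exact ⟨x, hM.final_of_mem_cluster hwf hx, hx.1, (hM.hasDepth_iff_of_mem_cluster hx).2 hw,
      (sat_iff_of_pair_eq hM hN hw hv hp hx hyc hxy ψ hψ).2 hyψ⟩

/-! ### Removing worlds that are not final -/

/-- The pullback of a model along a map. -/
def comap (M : KModel W) (f : V → W) : KModel V where
  rel a b := M.rel (f a) (f b)
  val p := f ⁻¹' M.val p

/-- The submodel on the image of `f` contains, with each of its worlds, the cluster of that world
and all final worlds above it. -/
structure FinalEmbedding (S : Finset (MuForm 0)) (M : KModel W) (f : V → W) : Prop where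
  injective : Function.Injective f
  mem_range : ∀ a v, M.rel (f a) v → M.Final S v ∨ M.rel v (f a) → ∃ b, f b = v

namespace FinalEmbedding

variable {f : V → W}

theorem weaklyTransitive (hM : M.WeaklyTransitive) (hf : FinalEmbedding φ.sigma M f) :
    (M.comap f).WeaklyTransitive := fun a b c hac h h' =>
  hM (f a) (f b) (f c) (fun h => hac (hf.injective h)) h h'

theorem rrel_iff (hf : FinalEmbedding φ.sigma M f) {a b : V} :
    (M.comap f).rrel a b ↔ M.rrel (f a) (f b) :=
  or_congr hf.injective.eq_iff.symm Iff.rfl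

theorem mem_cluster_iff (hf : FinalEmbedding φ.sigma M f) {a b : V} :
    b ∈ (M.comap f).cluster a ↔ f b ∈ M.cluster (f a) :=
  and_congr hf.rrel_iff hf.rrel_iff

theorem exists_of_mem_cluster (hf : FinalEmbedding φ.sigma M f) {a : V} {v : W}
    (hv : v ∈ M.cluster (f a)) : ∃ b, f b = v := by
  rcases hv.1 with h | h
  · exact ⟨a, h⟩
  · rcases hv.2 with h' | h'
    · exact ⟨a, h'.symm⟩
    · exact hf.mem_range a v h (.inr h')

theorem exists_of_final (hf : FinalEmbedding φ.sigma M f) {a : V} {v : W}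
    (hv : M.rrel (f a) v) (hvf : M.Final φ.sigma v) : ∃ b, f b = v := by
  rcases hv with h | h
  · exact ⟨a, h⟩
  · exact hf.mem_range a v h (.inl hvf)

/-- Removing worlds that are not final does not affect the truth of formulas of `sigma φ`. -/
theorem sat_iff [Finite W] (hM : M.WeaklyTransitive) (hf : FinalEmbedding φ.sigma M f) (a : V) :
    ∀ ψ ∈ φ.sigma, (M.Sat (f a) ψ ↔ (M.comap f).Sat a ψ) := by
  have main : ∀ w a, f a = w → ∀ ψ ∈ φ.sigma, (M.Sat (f a) ψ ↔ (M.comap f).Sat a ψ) := by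
    intro w
    induction w using hM.below_wf.induction with
    | _ w ih =>
    rintro a rfl
    have hbis : SBisim φ.atoms φ.sigma M (M.comap f)
        (fun w b => w = f b ∧ f b ∈ M.cluster (f a)) := by
      refine ⟨?_, ?_, ?_⟩
      · rintro _ b ⟨rfl, -⟩ p -
        exact Iff.rfl
      · rintro _ b v ⟨rfl, hb⟩ hr
        rcases mem_cluster_or_below (hM.rrel_trans hb.1 (.inr hr)) with hv | hv
        · obtain ⟨b', rfl⟩ := hf.exists_of_mem_cluster hv
          exact .inl ⟨b', hr, rfl, hv⟩
        · refine .inr fun ψ hψ hvψ => ?_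
          obtain ⟨u, hvu, huf, huψ⟩ := hM.exists_final_of_sat hψ hvψ
          have hu := hM.below_of_below_of_rrel hv hvu
          obtain ⟨b', rfl⟩ := hf.exists_of_final hu.rrel huf
          exact ⟨b', (hM.below_of_rrel_of_below hb.2 hu).1, (ih _ hu b' rfl ψ hψ).1 huψ⟩
      · rintro _ b b' ⟨rfl, hb⟩ hr
        rcases mem_cluster_or_below (hM.rrel_trans hb.1 (.inr hr)) with hv | hv
        · exact .inl ⟨f b', hr, rfl, hv⟩
        · exact .inr fun ψ hψ hb'ψ => ⟨f b', hr, (ih _ hv b' rfl ψ hψ).2 hb'ψ⟩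
    exact hbis.sat_iff ⟨rfl, M.mem_cluster_self _⟩
  exact main _ a rfl

theorem final_iff [Finite W] (hM : M.WeaklyTransitive) (hf : FinalEmbedding φ.sigma M f) (a : V) :
    M.Final φ.sigma (f a) ↔ (M.comap f).Final φ.sigma a := by
  constructor
  · rintro ⟨ψ, hψ, haψ, hmax⟩
    exact ⟨ψ, hψ, (hf.sat_iff hM a ψ hψ).1 haψ, fun b hr hb =>
      hmax (f b) hr ((hf.sat_iff hM b ψ hψ).2 hb)⟩
  · rintro ⟨ψ, hψ, haψ, hmax⟩
    refine ⟨ψ, hψ, (hf.sat_iff hM a ψ hψ).2 haψ, fun u hr hu => ?_⟩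
    obtain ⟨v, huv, hvf, hvψ⟩ := hM.exists_final_of_sat hψ hu
    by_contra hua
    have hau : M.Below (f a) u := ⟨hr, hua⟩
    have hav := hM.below_of_below_of_rrel hau huv
    obtain ⟨b, rfl⟩ := hf.exists_of_final hav.rrel hvf
    exact hav.2 (hmax b hav.1 ((hf.sat_iff hM b ψ hψ).1 hvψ))

theorem depthGE_iff [Finite W] (hM : M.WeaklyTransitive) (hf : FinalEmbedding φ.sigma M f) {k : ℕ}
    (a : V) : M.DepthGE φ.sigma k (f a) ↔ (M.comap f).DepthGE φ.sigma k a := by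
  induction k generalizing a with
  | zero => exact Iff.rfl
  | succ k ih =>
    constructor
    · rintro ⟨v, hvf, hav, hv⟩
      obtain ⟨b, rfl⟩ := hf.exists_of_final hav.rrel hvf
      exact ⟨b, (hf.final_iff hM b).1 hvf, hav, (ih b).1 hv⟩
    · rintro ⟨b, hbf, hab, hb⟩
      exact ⟨f b, (hf.final_iff hM b).2 hbf, hab, (ih b).2 hb⟩

theorem hasDepth_iff [Finite W] (hM : M.WeaklyTransitive) (hf : FinalEmbedding φ.sigma M f) {k : ℕ}
    (a : V) : M.HasDepth φ.sigma (f a) k ↔ (M.comap f).HasDepth φ.sigma a k :=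
  and_congr (hf.depthGE_iff hM a) (not_congr (hf.depthGE_iff hM a))

theorem theta_eq [Finite W] (hM : M.WeaklyTransitive) (hf : FinalEmbedding φ.sigma M f) {n : ℕ}
    (a : V) : M.theta φ.sigma n (f a) = (M.comap f).theta φ.sigma n a := by
  refine theta_eq_iff.2 fun m _ ψ hψ => ⟨?_, ?_⟩
  · rintro ⟨v, hvf, hav, hv, hvψ⟩
    obtain ⟨b, rfl⟩ := hf.exists_of_final hav hvf
    exact ⟨b, (hf.final_iff hM b).1 hvf, hf.rrel_iff.2 hav, (hf.hasDepth_iff hM b).1 hv,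
      (hf.sat_iff hM b ψ hψ).1 hvψ⟩
  · rintro ⟨b, hbf, hab, hb, hbψ⟩
    exact ⟨f b, (hf.final_iff hM b).2 hbf, hf.rrel_iff.1 hab, (hf.hasDepth_iff hM b).2 hb,
      (hf.sat_iff hM b ψ hψ).2 hbψ⟩

theorem clusterRep_eq (hf : FinalEmbedding φ.sigma M f) {P : Finset ℕ} (a : V) :
    M.clusterRep P (f a) = (M.comap f).clusterRep P a := by
  have h1 : M.clusterTypes P (f a) = (M.comap f).clusterTypes P a := by
    ext t
    rw [mem_clusterTypes, mem_clusterTypes]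
    constructor
    · rintro ⟨x, hx, ht⟩
      obtain ⟨b, rfl⟩ := hf.exists_of_mem_cluster hx
      exact ⟨b, hf.mem_cluster_iff.2 hx, ht⟩
    · rintro ⟨b, hb, ht⟩
      exact ⟨f b, hf.mem_cluster_iff.1 hb, ht⟩
  have h2 : M.doubleTypes P (f a) = (M.comap f).doubleTypes P a := by
    ext t
    rw [mem_doubleTypes, mem_doubleTypes]
    constructor
    · rintro ⟨x, hx, y, hy, ht⟩
      obtain ⟨b, rfl⟩ := hf.exists_of_mem_cluster hx
      obtain ⟨c, rfl⟩ := hf.exists_of_mem_cluster hy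
      exact ⟨b, hf.mem_cluster_iff.2 hx, c, hf.mem_cluster_iff.2 hy, ht⟩
    · rintro ⟨b, hb, c, hc, ht⟩
      exact ⟨f b, hf.mem_cluster_iff.1 hb, f c, hf.mem_cluster_iff.1 hc, ht⟩
  rw [clusterRep, clusterRep, h1, h2]

theorem pair_eq [Finite W] (hM : M.WeaklyTransitive) (hf : FinalEmbedding φ.sigma M f) {n : ℕ}
    (a : V) : M.pair φ n (f a) = (M.comap f).pair φ n a := by
  rw [pair, pair, hf.clusterRep_eq, hf.theta_eq hM]

end FinalEmbedding

/-- The worlds above `u` that are final or in the cluster of `u`, enumerated. -/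
theorem WeaklyTransitive.exists_finalEmbedding [Finite W] (hM : M.WeaklyTransitive) (φ : MuForm 0)
    (u : W) : ∃ (k : ℕ) (f : Fin k → W) (a : Fin k), FinalEmbedding φ.sigma M f ∧ f a = u ∧
      ∀ b, M.rrel u (f b) ∧ (M.Final φ.sigma (f b) ∨ f b ∈ M.cluster u) := by
  let A := {v : W // M.rrel u v ∧ (M.Final φ.sigma v ∨ v ∈ M.cluster u)}
  have e : A ≃ Fin (Nat.card A) := Finite.equivFin A
  refine ⟨Nat.card A, fun i => (e.symm i).1, e ⟨u, .inl rfl, .inr (M.mem_cluster_self u)⟩,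
    ⟨fun i j h => e.symm.injective (Subtype.ext h), ?_⟩, by simp, fun b => (e.symm b).2⟩
  intro i v hr h
  have hiv := (e.symm i).2
  suffices hv : M.Final φ.sigma v ∨ v ∈ M.cluster u from
    ⟨e ⟨v, hM.rrel_trans hiv.1 (.inr hr), hv⟩, by simp⟩
  rcases h with h | h
  · exact .inl h
  · have hc : v ∈ M.cluster (e.symm i).1 := ⟨.inr hr, .inr h⟩
    exact hiv.2.imp (fun h' => hM.final_of_mem_cluster h' hc) fun h' => hM.mem_cluster_trans hc h'

end KModel

/-! ### Witnessing chains -/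

/-- The sequence `c` with the pair `p` put below it. -/
def CSeq.extend {n : ℕ} (c : CSeq n) (p : CPair) : CSeq (n + 1) :=
  Fin.snoc (α := fun _ => CPair) c p

@[simp] theorem CSeq.init_extend {n : ℕ} (c : CSeq n) (p : CPair) : (c.extend p).init = c :=
  funext fun i => Fin.snoc_castSucc (α := fun _ => CPair) p c i

@[simp] theorem CSeq.last_extend {n : ℕ} (c : CSeq n) (p : CPair) : (c.extend p).last = p :=
  Fin.snoc_last (α := fun _ => CPair) p c

namespace KModel

variable {W V : Type*} {M : KModel W} {φ : MuForm 0}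

/-- A recursive description of semi-witnessing chains: the worlds other than the lowest one are
required to be final, clusters are compared with their canonical representatives, and the condition
on consecutive clusters is expressed by repeated types. -/
def Realizes (φ : MuForm 0) (M : KModel W) : {n : ℕ} → CSeq n → W → Prop
  | 0, c, w => M.HasDepth φ.sigma w 0 ∧ c.last = M.pair φ 0 w
  | n + 1, c, w => M.HasDepth φ.sigma w (n + 1) ∧ c.last = M.pair φ (n + 1) w ∧
      ∃ v, M.Final φ.sigma v ∧ M.Below w v ∧ Realizes φ M c.init v ∧
        ((∀ t ∈ c.last.1, 2 ≤ c.init.last.1.count t) → c.last.2 ≠ M.theta φ.sigma (n + 1) v)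

theorem Realizes.hasDepth {n : ℕ} {c : CSeq n} {w : W} (h : Realizes φ M c w) :
    M.HasDepth φ.sigma w n := by
  cases n with
  | zero => exact h.1
  | succ n => exact h.1

theorem Realizes.last_eq {n : ℕ} {c : CSeq n} {w : W} (h : Realizes φ M c w) :
    c.last = M.pair φ n w := by
  cases n with
  | zero => exact h.2
  | succ n => exact h.2.1

theorem Realizes.fst_last_mem {n : ℕ} {c : CSeq n} {w : W} (h : Realizes φ M c w) :
    c.last.1 ∈ clusterReps φ.atoms := by
  rw [h.last_eq]
  exact M.clusterRep_mem_clusterReps _ _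

theorem Realizes.of_mem_cluster (hM : M.WeaklyTransitive) {n : ℕ} {c : CSeq n} {u w : W}
    (h : Realizes φ M c w) (hu : u ∈ M.cluster w) : Realizes φ M c u := by
  cases n with
  | zero =>
    exact ⟨(hM.hasDepth_iff_of_mem_cluster hu).2 h.1, h.2.trans (hM.pair_eq_of_mem_cluster hu).symm⟩
  | succ n =>
    obtain ⟨h1, h2, v, hv, hwv, h3⟩ := h
    exact ⟨(hM.hasDepth_iff_of_mem_cluster hu).2 h1, h2.trans (hM.pair_eq_of_mem_cluster hu).symm,
      v, hv, hM.below_of_rrel_of_below hu.2 hwv, h3⟩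

theorem Realizes.realizesAt (hM : M.WeaklyTransitive) {n : ℕ} {c : CSeq n} {w : W}
    (h : Realizes φ M c w) : RealizesAt φ.atoms φ.sigma M c w := by
  induction n generalizing w with
  | zero =>
    refine ⟨fun _ => w, rfl, fun i => ?_, fun i => i.elim0, fun i => i.elim0⟩
    obtain ⟨h1, h2⟩ := h
    obtain rfl : i = Fin.last 0 := Subsingleton.elim (α := Fin 1) _ _
    obtain ⟨h3, h4⟩ := Prod.ext_iff.1 h2
    exact ⟨h1, hM.represents_iff.2 h3, h4⟩
  | succ n ih =>
    obtain ⟨h1, h2, v, hv, hwv, h3, h4⟩ := h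
    obtain ⟨x, hx, hx1, hx2, hx3⟩ := ih h3
    obtain ⟨h5, h6⟩ := Prod.ext_iff.1 h2
    have hl : (Fin.snoc x w : Fin (n + 2) → W) (Fin.last (n + 1)) = w :=
      Fin.snoc_last (α := fun _ => W) w x
    have hs : ∀ i : Fin (n + 1), (Fin.snoc x w : Fin (n + 2) → W) i.castSucc = x i := fun i =>
      Fin.snoc_castSucc (α := fun _ => W) w x i
    refine ⟨Fin.snoc x w, hl, fun i => ?_, fun i => ?_, fun i => ?_⟩
    · refine Fin.lastCases ?_ (fun i => ?_) i
      · rw [hl]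
        exact ⟨h1, hM.represents_iff.2 h5, h6⟩
      · rw [hs]
        exact hx1 i
    · refine Fin.lastCases ?_ (fun i => ?_) i
      · rw [hs, Fin.succ_last, hl, hx]
        exact hwv
      · rw [hs, Fin.succ_castSucc, hs]
        exact hx2 i
    · refine Fin.lastCases ?_ (fun i => ?_) i
      · rw [hs, Fin.succ_last, hx]
        intro hb
        refine h4 ((bisimilar_stack_iff (P := φ.atoms) ?_ ?_).1 hb)
        · exact (mem_clusterReps.1 h3.fst_last_mem).2.1
        · rw [h2]
          exact fun t ht => subset_of_mem_clusterRep ht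
      · rw [hs, Fin.succ_castSucc]
        exact hx3 i

theorem realizes_of_realizesAt (hM : M.WeaklyTransitive) {n : ℕ} {c : CSeq n} {w : W}
    (h : RealizesAt φ.atoms φ.sigma M c w) (hf : ∀ x, M.Below w x → M.Final φ.sigma x) :
    Realizes φ M c w := by
  obtain ⟨v, rfl, h1, h2, h3⟩ := h
  have hpair : ∀ i, c i = M.pair φ i (v i) := fun i =>
    Prod.ext (hM.represents_iff.1 (h1 i).2.1) (h1 i).2.2
  induction n with
  | zero => exact ⟨(h1 0).1, hpair 0⟩
  | succ n ih =>
    have hb : M.Below (v (Fin.last (n + 1))) (v (Fin.last n).castSucc) := h2 (Fin.last n)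
    refine ⟨(h1 (Fin.last (n + 1))).1, hpair (Fin.last (n + 1)), v (Fin.last n).castSucc, hf _ hb,
      hb, ?_, ?_⟩
    · exact ih (c := c.init) (v := fun i => v i.castSucc)
        (fun x hx => hf x (hM.below_of_below_of_rrel hb hx.rrel)) (fun i => h1 i.castSucc)
        (fun i => h2 i.castSucc) (fun i => h3 i.castSucc) (fun i => hpair i.castSucc)
    · intro ht
      refine h3 (Fin.last n) ((bisimilar_stack_iff (P := φ.atoms) ?_ ?_).2 ht)
      · rw [hpair]
        exact fun t ht => subset_of_mem_clusterRep ht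
      · rw [hpair]
        exact fun t ht => subset_of_mem_clusterRep ht

theorem Realizes.comap [Finite W] {f : V → W} (hM : M.WeaklyTransitive)
    (hf : FinalEmbedding φ.sigma M f) {n : ℕ} {c : CSeq n} {a : V} (h : Realizes φ M c (f a)) :
    Realizes φ (M.comap f) c a := by
  induction n generalizing a with
  | zero => exact ⟨(hf.hasDepth_iff hM a).1 h.1, h.2.trans (hf.pair_eq hM a)⟩
  | succ n ih =>
    obtain ⟨h1, h2, v, hv, hwv, h3, h4⟩ := h
    obtain ⟨b, rfl⟩ := hf.exists_of_final hwv.rrel hv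
    exact ⟨(hf.hasDepth_iff hM a).1 h1, h2.trans (hf.pair_eq hM a), b, (hf.final_iff hM b).1 hv,
      hwv, ih h3, by rwa [← hf.theta_eq hM]⟩

/-- Every final world has a witnessing chain: the condition on consecutive clusters holds because a
final cluster is never absorbed by a cluster above it. -/
theorem WeaklyTransitive.exists_realizes [Finite W] (hM : M.WeaklyTransitive) {n : ℕ} {w : W}
    (hw : M.HasDepth φ.sigma w n) (hf : M.Final φ.sigma w) : ∃ c : CSeq n, Realizes φ M c w := by
  induction n generalizing w with
  | zero => exact ⟨fun _ => M.pair φ 0 w, hw, rfl⟩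
  | succ n ih =>
    obtain ⟨v, hwv, hvf, hv⟩ := hM.exists_final_of_lt_depth hw.1 (Nat.lt_succ_self n)
    obtain ⟨c, hc⟩ := ih hv hvf
    refine ⟨c.extend (M.pair φ (n + 1) w), hw, CSeq.last_extend _ _, v, hvf, hwv, ?_, ?_⟩
    · rwa [CSeq.init_extend]
    rw [CSeq.last_extend, CSeq.init_extend, hc.last_eq]
    intro hrep hθ
    have hrep' := hrep _ (mem_clusterRep.2 ⟨w, M.mem_cluster_self w, rfl⟩)
    obtain ⟨y, hy, hyt⟩ := mem_clusterRep.1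
      (Multiset.count_pos.1 (Nat.zero_lt_two.trans_le hrep'))
    obtain ⟨ψ, hψ, hwψ, hmax⟩ := hf
    have hyψ := (hM.sat_iff_of_absorbed hw hv hwv hθ hrep (M.mem_cluster_self w) hy hyt.symm
      ψ hψ).1 hwψ
    have hwy := hM.below_of_below_of_rrel hwv hy.1
    exact hwy.2 (hmax y hwy.1 hyψ)

theorem mem_allSeqs_of_realizesAt {P : Finset ℕ} {S : Finset (MuForm 0)} {n : ℕ} {c : CSeq n}
    {w : W} (h : RealizesAt P S M c w) : c ∈ allSeqs P S n := by
  obtain ⟨v, -, h, -⟩ := h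
  refine Fintype.mem_piFinset.2 fun i => Finset.mem_product.2 ⟨(h i).2.1.1, ?_⟩
  rw [(h i).2.2]
  exact theta_mem_powerset

/-- All that matters about a world of a finite model is reflected at the root of a semifinal model
on some `Fin k`, consisting of the worlds above it that are final or in its cluster. -/
theorem WeaklyTransitive.exists_fin_model [Finite W] (hM : M.WeaklyTransitive) (φ : MuForm 0)
    (u : W) : ∃ (k : ℕ) (N : KModel (Fin k)) (a : Fin k), N.WeaklyTransitive ∧ N.IsRoot a ∧
      N.IsSemifinal φ.sigma a ∧ (M.Final φ.sigma u → N.IsFinal φ.sigma) ∧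
      (N.Final φ.sigma a ↔ M.Final φ.sigma u) ∧
      (∀ ψ ∈ φ.sigma, (N.Sat a ψ ↔ M.Sat u ψ)) ∧
      (∀ n, N.HasDepth φ.sigma a n ↔ M.HasDepth φ.sigma u n) ∧
      N.typeAt φ.atoms a = M.typeAt φ.atoms u ∧ (∀ n, N.pair φ n a = M.pair φ n u) ∧
      ∀ (n : ℕ) (c : CSeq n), Realizes φ M c u → Realizes φ N c a := by
  obtain ⟨k, f, a, hf, rfl, hfa⟩ := hM.exists_finalEmbedding φ u
  refine ⟨k, M.comap f, a, hf.weaklyTransitive hM, fun b => hf.rrel_iff.2 (hfa b).1, ?_, ?_,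
    (hf.final_iff hM a).symm, fun ψ hψ => (hf.sat_iff hM a ψ hψ).symm,
    fun n => (hf.hasDepth_iff hM a).symm, rfl, fun n => (hf.pair_eq hM a).symm,
    fun n c h => h.comap hM hf⟩
  · intro b hb
    exact (hf.final_iff hM b).1 ((hfa b).2.resolve_right fun h => hb (hf.mem_cluster_iff.2 h))
  · intro h b
    exact (hf.final_iff hM b).1 ((hfa b).2.elim id fun h' => hM.final_of_mem_cluster h h')

theorem Realizes.mem_supp [Finite W] (hM : M.WeaklyTransitive) {n : ℕ} {c : CSeq n} {w : W}
    (h : Realizes φ M c w) (hf : M.Final φ.sigma w) {ψ : MuForm 0} (hψ : ψ ∈ φ.sigma ∨ ψ = .top)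
    (hw : M.Sat w ψ) : c ∈ supp φ.atoms φ.sigma n ψ := by
  obtain ⟨k, N, a, hN, hroot, -, hfin, -, hsat, -, -, -, hreal⟩ := hM.exists_fin_model φ w
  refine Finset.mem_filter.2 ⟨mem_allSeqs_of_realizesAt (h.realizesAt hM), k, N, a,
    ⟨hN, hroot, hfin hf, (hreal n c h).realizesAt hN⟩, ?_⟩
  rcases hψ with hψ | rfl
  · exact (hsat ψ hψ).2 hw
  · trivial

theorem mem_supp_iff_exists {n : ℕ} {c : CSeq n} {ψ : MuForm 0} :
    c ∈ supp φ.atoms φ.sigma n ψ ↔ ∃ (k : ℕ) (N : KModel (Fin k)) (a : Fin k),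
      N.WeaklyTransitive ∧ N.IsRoot a ∧ N.IsFinal φ.sigma ∧ Realizes φ N c a ∧ N.Sat a ψ := by
  constructor
  · intro hc
    obtain ⟨-, k, N, a, ⟨hN, hr, hf, h⟩, hs⟩ := Finset.mem_filter.1 hc
    exact ⟨k, N, a, hN, hr, hf, realizes_of_realizesAt hN h fun x _ => hf x, hs⟩
  · rintro ⟨k, N, a, hN, hr, hf, h, hs⟩
    have h' := h.realizesAt hN
    exact Finset.mem_filter.2 ⟨mem_allSeqs_of_realizesAt h', k, N, a, ⟨hN, hr, hf, h'⟩, hs⟩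

theorem supp_top {P : Finset ℕ} {S : Finset (MuForm 0)} {n : ℕ} : supp P S n .top = chains P S n :=
  Finset.filter_congr fun _ _ => exists_congr fun _ => exists_congr fun _ => exists_congr fun _ =>
    and_iff_left trivial

theorem mem_chains_of_mem_supp {P : Finset ℕ} {S : Finset (MuForm 0)} {n : ℕ} {c : CSeq n}
    {ψ : MuForm 0} (h : c ∈ supp P S n ψ) : c ∈ chains P S n := by
  obtain ⟨hc, k, N, a, h, -⟩ := Finset.mem_filter.1 h
  exact Finset.mem_filter.2 ⟨hc, k, N, a, h⟩

theorem Realizes.mem_chains [Finite W] (hM : M.WeaklyTransitive) {n : ℕ} {c : CSeq n} {w : W}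
    (h : Realizes φ M c w) (hf : M.Final φ.sigma w) : c ∈ chains φ.atoms φ.sigma n :=
  mem_chains_of_mem_supp (h.mem_supp hM hf (.inr rfl) trivial)

theorem Realizes.mem_semiChains [Finite W] (hM : M.WeaklyTransitive) {n : ℕ} {c : CSeq n} {w : W}
    (h : Realizes φ M c w) : c ∈ semiChains φ.atoms φ.sigma n := by
  obtain ⟨k, N, a, hN, hroot, hsemi, -, -, -, -, -, -, hreal⟩ := hM.exists_fin_model φ w
  exact Finset.mem_filter.2 ⟨mem_allSeqs_of_realizesAt (h.realizesAt hM), k, N, a,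
    ⟨hN, hroot, hsemi, (hreal n c h).realizesAt hN⟩⟩

theorem exists_of_mem_chains {n : ℕ} {c : CSeq n} (h : c ∈ chains φ.atoms φ.sigma n) :
    ∃ (k : ℕ) (N : KModel (Fin k)) (a : Fin k),
      N.WeaklyTransitive ∧ N.Final φ.sigma a ∧ Realizes φ N c a := by
  rw [← supp_top, mem_supp_iff_exists] at h
  obtain ⟨k, N, a, hN, -, hf, h, -⟩ := h
  exact ⟨k, N, a, hN, hf a, h⟩

theorem exists_of_mem_semiChains {n : ℕ} {c : CSeq n} (h : c ∈ semiChains φ.atoms φ.sigma n) :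
    ∃ (k : ℕ) (N : KModel (Fin k)) (a : Fin k), N.WeaklyTransitive ∧ Realizes φ N c a := by
  obtain ⟨-, k, N, a, hN, hr, hf, h⟩ := Finset.mem_filter.1 h
  exact ⟨k, N, a, hN, realizes_of_realizesAt hN h fun x hx =>
    hf x fun hc => hx.not_rrel hc.2⟩

theorem mem_semiChains_of_mem_chains {n : ℕ} {c : CSeq n} (h : c ∈ chains φ.atoms φ.sigma n) :
    c ∈ semiChains φ.atoms φ.sigma n := by
  obtain ⟨k, N, a, hN, -, h⟩ := exists_of_mem_chains h
  exact h.mem_semiChains hN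

theorem init_mem_chains {n : ℕ} {c : CSeq (n + 1)} (h : c ∈ semiChains φ.atoms φ.sigma (n + 1)) :
    c.init ∈ chains φ.atoms φ.sigma n := by
  obtain ⟨k, N, a, hN, -, -, v, hv, -, h, -⟩ := exists_of_mem_semiChains h
  exact h.mem_chains hN hv

/-- Whether a world realizing a chain is final depends only on the chain. -/
theorem Realizes.final_of_mem_chains [Finite W] (hM : M.WeaklyTransitive) {n : ℕ} {c : CSeq n}
    {w : W} (h : Realizes φ M c w) (hc : c ∈ chains φ.atoms φ.sigma n) : M.Final φ.sigma w := by
  obtain ⟨k, N, a, hN, hf, h'⟩ := exists_of_mem_chains hc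
  obtain ⟨h1, h2⟩ := Prod.ext_iff.1 (h'.last_eq.symm.trans h.last_eq)
  exact final_of_clusterRep_le hM hN h.hasDepth h'.hasDepth hf h1.le h2.symm

end KModel

/-! ### Semantics of tangle logic -/

namespace KModel

variable {W : Type*} {M : KModel W}

theorem satT_neg {w : W} {ψ : TForm} : M.SatT w (.neg ψ) ↔ ¬ M.SatT w ψ := Iff.rfl

theorem satT_and {w : W} {ψ χ : TForm} : M.SatT w (.and ψ χ) ↔ M.SatT w ψ ∧ M.SatT w χ := Iff.rfl

theorem satT_or {w : W} {ψ χ : TForm} : M.SatT w (.or ψ χ) ↔ M.SatT w ψ ∨ M.SatT w χ := Iff.rfl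

theorem satT_dia {w : W} {ψ : TForm} : M.SatT w (.dia ψ) ↔ ∃ v, M.rel w v ∧ M.SatT v ψ := Iff.rfl

theorem satT_box {w : W} {ψ : TForm} : M.SatT w (.box ψ) ↔ ∀ v, M.rel w v → M.SatT v ψ := Iff.rfl

theorem satT_imp {w : W} {ψ χ : TForm} :
    M.SatT w (ψ.imp χ) ↔ (M.SatT w ψ → M.SatT w χ) := by
  rw [TForm.imp, satT_or, satT_neg, imp_iff_not_or]

theorem satT_rdia {w : W} {ψ : TForm} :
    M.SatT w ψ.rdia ↔ ∃ v, M.rrel w v ∧ M.SatT v ψ := by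
  rw [TForm.rdia, satT_or, satT_dia]
  constructor
  · rintro (h | ⟨v, hv, h⟩)
    exacts [⟨w, .inl rfl, h⟩, ⟨v, .inr hv, h⟩]
  · rintro ⟨v, rfl | hv, h⟩
    exacts [.inl h, .inr ⟨v, hv, h⟩]

theorem satT_bigOr {ι : Type*} {s : Finset ι} {f : ι → TForm} {w : W} :
    M.SatT w (TForm.bigOr s f) ↔ ∃ a ∈ s, M.SatT w (f a) := by
  have key : ∀ l : List ι, M.SatT w ((l.map f).foldr .or .bot) ↔ ∃ a ∈ l, M.SatT w (f a) := by
    intro l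
    induction l with
    | nil =>
      simp only [List.map_nil, List.foldr_nil, List.not_mem_nil, false_and, exists_false, iff_false]
      exact fun h => h trivial
    | cons a l ih =>
      rw [List.map_cons, List.foldr_cons, satT_or, ih]
      simp
  rw [TForm.bigOr, key]
  simp

theorem satT_bigAnd {ι : Type*} {s : Finset ι} {f : ι → TForm} {w : W} :
    M.SatT w (TForm.bigAnd s f) ↔ ∀ a ∈ s, M.SatT w (f a) := by
  have key : ∀ l : List ι, M.SatT w ((l.map f).foldr .and .top) ↔ ∀ a ∈ l, M.SatT w (f a) := by
    intro l
    induction l with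
    | nil =>
      simp only [List.map_nil, List.foldr_nil, List.not_mem_nil, false_imp_iff, implies_true,
        iff_true]
      trivial
    | cons a l ih =>
      rw [List.map_cons, List.foldr_cons, satT_and, ih]
      simp
  rw [TForm.bigAnd, key]
  simp

/-- The points of `X` see in `X` all formulas `Γ j`, except that for one index the formula may hold
at the point itself instead. -/
def TangleClosed (M : KModel W) {k : ℕ} (Γ : Fin k → TForm) (X : Set W) : Prop :=
  ∀ x ∈ X, ∃ i, (∃ y ∈ X, M.rrel x y ∧ M.SatT y (Γ i)) ∧
    ∀ j, j ≠ i → ∃ y ∈ X, M.rel x y ∧ M.SatT y (Γ j)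

/-- The operator whose greatest fixed point is the tangle modality. -/
def tangleOp (M : KModel W) {k : ℕ} (Γ : Fin k → TForm) : Set W →o Set W where
  toFun X := ⋃ i : Fin k, ((M.truthT (Γ i) ∩ X) ∪ M.diaSet (M.truthT (Γ i) ∩ X)) ∩
    ⋂ j : Fin k, ⋂ _ : j ≠ i, M.diaSet (M.truthT (Γ j) ∩ X)
  monotone' X Y h := by
    have hd : ∀ A : Set W, M.diaSet (A ∩ X) ⊆ M.diaSet (A ∩ Y) := fun A w ⟨v, hv, h1, h2⟩ =>
      ⟨v, hv, h1, h h2⟩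
    exact Set.iUnion_mono fun i => Set.inter_subset_inter
      (Set.union_subset_union (Set.inter_subset_inter_right _ h) (hd _))
      (Set.iInter_mono fun j => Set.iInter_mono fun _ => hd _)

theorem mem_tangleOp {k : ℕ} {Γ : Fin k → TForm} {X : Set W} {x : W} :
    x ∈ M.tangleOp Γ X ↔ ∃ i, (∃ y ∈ X, M.rrel x y ∧ M.SatT y (Γ i)) ∧
      ∀ j, j ≠ i → ∃ y ∈ X, M.rel x y ∧ M.SatT y (Γ j) := by
  change x ∈ ⋃ i : Fin k, _ ↔ _
  simp only [Set.mem_iUnion, Set.mem_inter_iff, Set.mem_iInter, Set.mem_union]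
  refine exists_congr fun i => and_congr ⟨?_, ?_⟩ (forall_congr' fun j => forall_congr' fun _ => ?_)
  · rintro (⟨h, hx⟩ | ⟨y, hr, h, hy⟩)
    exacts [⟨x, hx, .inl rfl, h⟩, ⟨y, hy, .inr hr, h⟩]
  · rintro ⟨y, hy, rfl | hr, h⟩
    exacts [.inl ⟨h, hy⟩, .inr ⟨y, hr, h, hy⟩]
  · exact ⟨fun ⟨y, hr, h, hy⟩ => ⟨y, hy, hr, h⟩, fun ⟨y, hy, hr, h⟩ => ⟨y, hr, h, hy⟩⟩

theorem satT_tangle_iff_mem_gfp {k : ℕ} {Γ : Fin k → TForm} {w : W} :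
    M.SatT w (.tangle k Γ) ↔ w ∈ (M.tangleOp Γ).gfp := by
  rw [← sUnion_fixed_eq_gfp]
  exact Iff.rfl

/-- In finite weakly transitive models, the tangle modality says that some cluster weakly above
contains a set closed in the sense of the tangle modality. -/
theorem WeaklyTransitive.satT_tangle_iff [Finite W] (hM : M.WeaklyTransitive) {k : ℕ}
    {Γ : Fin k → TForm} {w : W} : M.SatT w (.tangle k Γ) ↔
      ∃ v, M.rrel w v ∧ ∃ X ⊆ M.cluster v, v ∈ X ∧ M.TangleClosed Γ X := by
  rw [satT_tangle_iff_mem_gfp]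
  constructor
  · intro hw
    -- take a point of the greatest fixed point as high as possible above `w`
    have hmax : ∃ v, M.rrel w v ∧ v ∈ (M.tangleOp Γ).gfp ∧
        ∀ x ∈ (M.tangleOp Γ).gfp, ¬ M.Below v x := by
      induction w using hM.below_wf.induction with
      | _ w ih =>
        by_cases h : ∃ x ∈ (M.tangleOp Γ).gfp, M.Below w x
        · obtain ⟨x, hx, hwx⟩ := h
          obtain ⟨v, hxv, hv⟩ := ih x hwx hx
          exact ⟨v, hM.rrel_trans hwx.rrel hxv, hv⟩
        · push Not at h
          exact ⟨w, .inl rfl, hw, h⟩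
    obtain ⟨v, hwv, hv, hmax⟩ := hmax
    refine ⟨v, hwv, (M.tangleOp Γ).gfp ∩ M.cluster v, Set.inter_subset_right,
      ⟨hv, M.mem_cluster_self v⟩, ?_⟩
    rintro x ⟨hx, hxv⟩
    have hin : ∀ y ∈ (M.tangleOp Γ).gfp, M.rrel x y → y ∈ (M.tangleOp Γ).gfp ∩ M.cluster v :=
      fun y hy hr => ⟨hy, (mem_cluster_or_below (hM.rrel_trans hxv.1 hr)).resolve_right (hmax y hy)⟩
    rw [← OrderHom.map_gfp] at hx
    obtain ⟨i, ⟨y, hy, hr, h⟩, hj⟩ := mem_tangleOp.1 hx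
    refine ⟨i, ⟨y, hin y hy hr, hr, h⟩, fun j hji => ?_⟩
    obtain ⟨y, hy, hr, h⟩ := hj j hji
    exact ⟨y, hin y hy (.inr hr), hr, h⟩
  · rintro ⟨v, hwv, X, hX, hv, hcl⟩
    have hsub : insert w X ⊆ M.tangleOp Γ (insert w X) := by
      have hmem : ∀ x ∈ X, x ∈ M.tangleOp Γ (insert w X) := by
        intro x hx
        obtain ⟨i, ⟨y, hy, h⟩, hj⟩ := hcl x hx
        refine mem_tangleOp.2 ⟨i, ⟨y, .inr hy, h⟩, fun j hji => ?_⟩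
        obtain ⟨y, hy, h⟩ := hj j hji
        exact ⟨y, .inr hy, h⟩
      rintro x (rfl | hx)
      · by_cases hx : x ∈ X
        · exact hmem x hx
        · obtain ⟨i, ⟨y, hy, hr, h⟩, hj⟩ := hcl v hv
          refine mem_tangleOp.2 ⟨i, ⟨y, .inr hy, hM.rrel_trans hwv hr, h⟩, fun j hji => ?_⟩
          obtain ⟨y, hy, hr, h⟩ := hj j hji
          refine ⟨y, .inr hy, (hM.rrel_trans hwv (.inr hr)).resolve_left ?_, h⟩
          rintro rfl
          exact hx hy
      · exact hmem x hx
    exact OrderHom.le_gfp _ hsub (.inl rfl)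

theorem WeaklyTransitive.satT_bigTangle_of_rrel [Finite W] (hM : M.WeaklyTransitive) {ι : Type*}
    {s : Multiset ι} {f : ι → TForm} {v w : W} (hr : M.rrel w v)
    (h : M.SatT v (TForm.bigTangle s f)) : M.SatT w (TForm.bigTangle s f) := by
  obtain ⟨z, hz, h⟩ := hM.satT_tangle_iff.1 h
  exact hM.satT_tangle_iff.2 ⟨z, hM.rrel_trans hr hz, h⟩

/-- The tangle modality over a multiset of types finds a cluster in which all formulas hold
somewhere, and formulas occurring twice hold at two consecutive points. -/
theorem WeaklyTransitive.exists_of_satT_bigTangle [Finite W] (hM : M.WeaklyTransitive)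
    {K : Multiset (Finset ℕ)} {f : Finset ℕ → TForm} {w : W} (h : M.SatT w (TForm.bigTangle K f)) :
    ∃ z, M.rrel w z ∧ (∀ t ∈ K, ∃ x ∈ M.cluster z, M.SatT x (f t)) ∧
      ∀ t, 2 ≤ K.count t → ∃ x ∈ M.cluster z, ∃ y ∈ M.cluster z,
        M.rel x y ∧ M.SatT x (f t) ∧ M.SatT y (f t) := by
  obtain ⟨z, hwz, X, hX, hzX, hcl⟩ := hM.satT_tangle_iff.1 h
  have hall : ∀ i : Fin K.toList.length, ∃ x ∈ X, M.SatT x (f (K.toList.get i)) := by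
    intro i
    obtain ⟨j, ⟨y, hy, -, hyj⟩, hj⟩ := hcl z hzX
    by_cases hij : i = j
    · exact ⟨y, hy, hij ▸ hyj⟩
    · obtain ⟨y, hy, -, h⟩ := hj i hij
      exact ⟨y, hy, h⟩
  refine ⟨z, hwz, fun t ht => ?_, fun t ht => ?_⟩
  · obtain ⟨i, rfl⟩ := List.get_of_mem (Multiset.mem_toList.2 ht)
    obtain ⟨x, hx, h⟩ := hall i
    exact ⟨x, hX hx, h⟩
  · rw [← Multiset.coe_toList K, Multiset.coe_count, ← List.duplicate_iff_two_le_count,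
      List.duplicate_iff_exists_distinct_get] at ht
    obtain ⟨i, j, hij, hi, hj⟩ := ht
    obtain ⟨x, hx, hxi⟩ := hall i
    rw [← hi] at hxi
    obtain ⟨l, -, hl⟩ := hcl x hx
    -- one of the indices `i`, `j` is not the exceptional one at `x`
    have : ∃ y ∈ X, M.rel x y ∧ M.SatT y (f t) := by
      by_cases hil : i = l
      · obtain ⟨y, hy, hr, h⟩ := hl j (fun h => hij.ne (hil.trans h.symm))
        exact ⟨y, hy, hr, hj ▸ h⟩
      · obtain ⟨y, hy, hr, h⟩ := hl i hil
        exact ⟨y, hy, hr, hi ▸ h⟩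
    obtain ⟨y, hy, hr, h⟩ := this
    exact ⟨x, hX hx, y, hX hy, hr, hxi, h⟩

theorem WeaklyTransitive.satT_bigTangle_clusterRep [Finite W] (hM : M.WeaklyTransitive)
    {P : Finset ℕ} {f : Finset ℕ → TForm} {w : W}
    (h : ∀ x ∈ M.cluster w, M.SatT x (f (M.typeAt P x))) :
    M.SatT w (TForm.bigTangle (M.clusterRep P w) f) := by
  refine hM.satT_tangle_iff.2 ⟨w, .inl rfl, M.cluster w, subset_rfl, M.mem_cluster_self w, ?_⟩
  intro x hx
  set l := (M.clusterRep P w).toList with hl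
  obtain ⟨i, hi⟩ := List.get_of_mem (l := l) (Multiset.mem_toList.2
    (mem_clusterRep.2 ⟨x, hx, rfl⟩))
  refine ⟨i, ⟨x, hx, .inl rfl, ?_⟩, fun j hji => ?_⟩
  · change M.SatT x (f (l.get i))
    rw [hi]
    exact h x hx
  suffices ∃ y ∈ M.cluster w, M.rel x y ∧ M.typeAt P y = l.get j by
    obtain ⟨y, hy, hr, ht⟩ := this
    refine ⟨y, hy, hr, ?_⟩
    change M.SatT y (f (l.get j))
    rw [← ht]
    exact h y hy
  by_cases hij : l.get i = l.get j
  · refine hM.exists_rel_of_two_le_count ?_ hx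
    have hd : ∀ i j : Fin l.length, i < j → l.get i = l.get j → 2 ≤ l.count (l.get j) :=
      fun i j hlt hij => List.duplicate_iff_two_le_count.1
        (List.duplicate_iff_exists_distinct_get.2 ⟨i, j, hlt, hij.symm, rfl⟩)
    rw [← Multiset.coe_toList (M.clusterRep P w), Multiset.coe_count, ← hl]
    rcases lt_or_gt_of_ne hji with hlt | hlt
    · rw [← hij]
      exact hd j i hlt hij.symm
    · exact hd i j hlt hij
  · obtain ⟨y, hy, ht⟩ := mem_clusterRep.1 (Multiset.mem_toList.1 (l.get_mem j))
    refine ⟨y, hy, hM.rel_of_mem_cluster hx hy ?_, ht⟩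
    rintro rfl
    exact hij (hi.trans ht)

end KModel

/-! ### Unfolding the structural formulas -/

section Congr

variable {P : Finset ℕ} {S : Finset (MuForm 0)} {d d' : (m : ℕ) → CSeq m → TForm}

theorem aF_congr {n : ℕ} (h : ∀ m < n, d m = d' m) (Θ : Finset (ℕ × MuForm 0)) :
    aF P S d n Θ = aF P S d' n Θ := by
  have : ∀ q ∈ (Finset.range n ×ˢ S).toList,
      (if q ∈ Θ then angleF P S d q.1 q.2 else TForm.neg (angleF P S d q.1 q.2)) =
      if q ∈ Θ then angleF P S d' q.1 q.2 else TForm.neg (angleF P S d' q.1 q.2) := by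
    intro q hq
    rw [Finset.mem_toList, Finset.mem_product, Finset.mem_range] at hq
    have : angleF P S d q.1 q.2 = angleF P S d' q.1 q.2 := by
      rw [angleF, angleF, h q.1 hq.1]
    rw [this]
  rw [aF, aF, TForm.bigAnd, TForm.bigAnd, List.map_congr_left this]

theorem tauChainF_congr {n : ℕ} (h : ∀ m < n, d m = d' m) (c : CSeq n) :
    tauChainF P S d c = tauChainF P S d' c := by
  funext t
  cases n with
  | zero => rw [tauChainF, tauChainF, aF_congr h]
  | succ n => rw [tauChainF, tauChainF, aF_congr h, h n (Nat.lt_succ_self n)]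

theorem alphaF_congr {n : ℕ} (h : ∀ m < n, d m = d' m) (c : CSeq n) :
    alphaF P S d c = alphaF P S d' c := by
  rw [alphaF, alphaF, tauChainF_congr h]

theorem betaF_congr {n : ℕ} (h : ∀ m < n, d m = d' m) (c : CSeq n) :
    betaF P S d c = betaF P S d' c := by
  have : (fun c' : CSeq n => alphaF P S d c') = fun c' => alphaF P S d' c' :=
    funext (alphaF_congr h)
  rw [betaF, betaF, this, alphaF_congr h]

theorem gammaF_congr {n : ℕ} (h : ∀ m < n, d m = d' m) (c : CSeq n) :
    gammaF P S d c = gammaF P S d' c := by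
  have : (fun c' : CSeq n => alphaF P S d c') = fun c' => alphaF P S d' c' :=
    funext (alphaF_congr h)
  rw [gammaF, gammaF, this]

theorem delta_eq (P : Finset ℕ) (S : Finset (MuForm 0)) {n : ℕ} (c : CSeq n) :
    delta P S n c = .and (.and (alphaF P S (delta P S) c) (betaF P S (delta P S) c))
      (gammaF P S (delta P S) c) := by
  have h : ∀ m < n, (fun m c' => if _h : m < n then delta P S m c' else TForm.bot :
      (m : ℕ) → CSeq m → TForm) m = delta P S m := by
    intro m hm
    funext c'
    simp [hm]
  rw [delta]
  rw [alphaF_congr h, betaF_congr h, gammaF_congr h]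

end Congr

namespace KModel

variable {W : Type*} {M : KModel W} {φ : MuForm 0}

theorem satT_tauF {P t : Finset ℕ} (ht : t ⊆ P) {w : W} :
    M.SatT w (tauF P t) ↔ M.typeAt P w = t := by
  rw [tauF, satT_bigAnd, Finset.ext_iff]
  constructor
  · intro h p
    rw [mem_typeAt]
    constructor
    · rintro ⟨hp, hw⟩
      by_contra hpt
      have := h p hp
      rw [if_neg hpt] at this
      exact this hw
    · intro hpt
      have := h p (ht hpt)
      rw [if_pos hpt] at this
      exact ⟨ht hpt, this⟩
  · intro h p hp
    have := h p
    rw [mem_typeAt, and_iff_right hp] at this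
    split_ifs with hpt
    · exact this.2 hpt
    · exact fun hw => hpt (this.1 hw)

theorem satT_alpha_iff {P : Finset ℕ} {S : Finset (MuForm 0)} {n : ℕ} {c : CSeq n} {w : W} :
    M.SatT w (alpha P S c) ↔ M.SatT w (TForm.bigTangle c.last.1 (tauChainF P S (delta P S) c)) :=
  Iff.rfl

theorem satT_delta_iff {P : Finset ℕ} {S : Finset (MuForm 0)} {n : ℕ} {c : CSeq n} {w : W} :
    M.SatT w (delta P S n c) ↔ M.SatT w (alpha P S c) ∧
      (∀ v, M.rel w v → (∃ c' ∈ chains P S n, PairLT P c'.last c.last ∧ M.SatT v (alpha P S c')) →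
        M.SatT v (alpha P S c)) ∧
      ∀ c' ∈ chains P S n, M.SatT w (alpha P S c') → PairLE P c'.last c.last := by
  rw [delta_eq, satT_and, satT_and, and_assoc, betaF, gammaF, satT_box, satT_neg, satT_bigOr]
  refine and_congr Iff.rfl (and_congr ?_ ?_)
  · refine forall_congr' fun v => forall_congr' fun _ => ?_
    rw [satT_imp, satT_bigOr]
    simp only [Finset.mem_filter, and_assoc]
    exact Iff.rfl
  · push Not
    simp only [Finset.mem_filter, and_imp]
    exact forall_congr' fun c' => forall_congr' fun _ => not_imp_not

theorem satT_angle_iff {n : ℕ} {P : Finset ℕ} {S : Finset (MuForm 0)} {ψ : MuForm 0} {w : W} :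
    M.SatT w (angle P S n ψ) ↔
      ∃ c ∈ supp P S n ψ, ∃ v, M.rrel w v ∧ M.SatT v (delta P S n c) := by
  rw [angle, angleF, satT_bigOr]
  simp only [satT_rdia]

theorem satT_aF_iff {n : ℕ} {P : Finset ℕ} {S : Finset (MuForm 0)} {Θ : Finset (ℕ × MuForm 0)}
    (hΘ : Θ ⊆ Finset.range n ×ˢ S) {w : W}
    (h : ∀ m < n, ∀ ψ ∈ S, (M.SatT w (angle P S m ψ) ↔ M.DepthDia S m ψ w)) :
    M.SatT w (aF P S (delta P S) n Θ) ↔ M.theta S n w = Θ := by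
  rw [aF, satT_bigAnd]
  constructor
  · intro h'
    ext ⟨m, ψ⟩
    rw [mem_theta]
    constructor
    · rintro ⟨hm, hψ, hd⟩
      by_contra hq
      have := h' (m, ψ) (Finset.mem_product.2 ⟨Finset.mem_range.2 hm, hψ⟩)
      rw [if_neg hq] at this
      exact this ((h m hm ψ hψ).2 hd)
    · intro hq
      have hq' := Finset.mem_product.1 (hΘ hq)
      have hm := Finset.mem_range.1 hq'.1
      have := h' (m, ψ) (hΘ hq)
      rw [if_pos hq] at this
      exact ⟨hm, hq'.2, (h m hm ψ hq'.2).1 this⟩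
  · rintro rfl ⟨m, ψ⟩ hq
    obtain ⟨hm, hψ⟩ := Finset.mem_product.1 hq
    rw [Finset.mem_range] at hm
    split_ifs with h'
    · exact (h m hm ψ hψ).2 (mem_theta.1 h').2.2
    · exact fun h'' => h' (mem_theta.2 ⟨hm, hψ, (h m hm ψ hψ).1 h''⟩)

theorem satT_tauChainF_succ {P : Finset ℕ} {S : Finset (MuForm 0)} {n : ℕ} {c : CSeq (n + 1)}
    {t : Finset ℕ} {w : W} : M.SatT w (tauChainF P S (delta P S) c t) ↔
      M.SatT w (tauF P t) ∧ M.SatT w (aF P S (delta P S) (n + 1) c.last.2) ∧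
      ∃ v, M.rel w v ∧ (Ir P S c → M.SatT v (tauF P t)) ∧ M.SatT v (delta P S n c.init) := by
  rw [tauChainF]
  split_ifs with h
  · rw [satT_and, satT_and, and_assoc, satT_dia]
    simp only [satT_and, h, true_imp_iff]
  · rw [satT_and, satT_and, and_assoc, satT_dia]
    simp only [h, false_imp_iff, true_and]

end KModel

/-! ### Meaning of the structural formulas -/

namespace KModel

variable {W : Type*} {M : KModel W} {φ : MuForm 0}

/-- `δ(C)`, for a witnessing chain `C` of depth `n`, only holds below final worlds of depth `n` with
the pair `⟨C_n, Θ_n⟩`. -/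
def DeltaSound (φ : MuForm 0) (M : KModel W) (n : ℕ) : Prop :=
  ∀ c ∈ chains φ.atoms φ.sigma n, ∀ v, M.SatT v (delta φ.atoms φ.sigma n c) →
    ∃ u, M.rrel v u ∧ M.Final φ.sigma u ∧ M.HasDepth φ.sigma u n ∧ M.pair φ n u = c.last

/-- Final worlds of depth `n` satisfy `δ(C)` for their witnessing chains `C`. -/
def DeltaComplete (φ : MuForm 0) (M : KModel W) (n : ℕ) : Prop :=
  ∀ (c : CSeq n) (w : W), M.Final φ.sigma w → Realizes φ M c w →
    M.SatT w (delta φ.atoms φ.sigma n c)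

theorem last_snd_subset_of_realizes {n : ℕ} {c : CSeq n} {w : W} (h : Realizes φ M c w) :
    c.last.2 ⊆ Finset.range n ×ˢ φ.sigma := by
  rw [h.last_eq]
  exact Finset.mem_powerset.1 theta_mem_powerset

/-- The formulas `⟨n⟩ ψ` of tangle logic express the operators `⟨n⟩‾`. -/
theorem satT_angle_iff_depthDia [Finite W] (hM : M.WeaklyTransitive) {n : ℕ}
    (hs : DeltaSound φ M n) (hc : DeltaComplete φ M n) {ψ : MuForm 0}
    (hψ : ψ ∈ φ.sigma ∨ ψ = .top) (v : W) :
    M.SatT v (angle φ.atoms φ.sigma n ψ) ↔ M.DepthDia φ.sigma n ψ v := by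
  rw [satT_angle_iff]
  constructor
  · rintro ⟨c, hcs, x, hvx, hx⟩
    obtain ⟨u, hxu, huf, hu, hp⟩ := hs c (mem_chains_of_mem_supp hcs) x hx
    obtain ⟨k, N, a, hN, -, -, ha, haψ⟩ := mem_supp_iff_exists.1 hcs
    have hp' := hp.trans ha.last_eq
    -- the world of the cluster of `u` that corresponds to the root of the witnessing model
    have hrep : M.clusterRep φ.atoms u = N.clusterRep φ.atoms a := (Prod.ext_iff.1 hp').1
    obtain ⟨y, hy, hyt⟩ := mem_clusterRep.1 (hrep ▸
      mem_clusterRep.2 ⟨a, N.mem_cluster_self a, rfl⟩)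
    refine ⟨y, hM.final_of_mem_cluster huf hy, hM.rrel_trans hvx (hM.rrel_trans hxu hy.1),
      (hM.hasDepth_iff_of_mem_cluster hy).2 hu, ?_⟩
    rcases hψ with hψ | rfl
    · exact (sat_iff_of_pair_eq hM hN hu ha.hasDepth hp' hy (N.mem_cluster_self a) hyt ψ hψ).2 haψ
    · trivial
  · rintro ⟨u, huf, hvu, hu, huψ⟩
    obtain ⟨c, h⟩ := hM.exists_realizes hu huf
    exact ⟨c, h.mem_supp hM huf hψ huψ, u, hvu, hc c u huf h⟩

section Step

variable {n : ℕ}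

theorem satT_aF_iff_theta_eq [Finite W] (hM : M.WeaklyTransitive)
    (hs : ∀ m < n, DeltaSound φ M m) (hc : ∀ m < n, DeltaComplete φ M m)
    {Θ : Finset (ℕ × MuForm 0)} (hΘ : Θ ⊆ Finset.range n ×ˢ φ.sigma) (w : W) :
    M.SatT w (aF φ.atoms φ.sigma (delta φ.atoms φ.sigma) n Θ) ↔ M.theta φ.sigma n w = Θ :=
  satT_aF_iff hΘ fun m hm _ hψ => satT_angle_iff_depthDia hM (hs m hm) (hc m hm) (.inl hψ) w

/-- A world realizing a chain `C` satisfies `α(C)`, even if it is not final. -/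
theorem Realizes.satT_alpha [Finite W] (hM : M.WeaklyTransitive)
    (hs : ∀ m < n, DeltaSound φ M m) (hc : ∀ m < n, DeltaComplete φ M m) {c : CSeq n} {w : W}
    (h : Realizes φ M c w) : M.SatT w (alpha φ.atoms φ.sigma c) := by
  rw [satT_alpha_iff, h.last_eq]
  refine hM.satT_bigTangle_clusterRep fun x hx => ?_
  have hA : M.SatT x (aF φ.atoms φ.sigma (delta φ.atoms φ.sigma) n c.last.2) := by
    rw [satT_aF_iff_theta_eq hM hs hc (last_snd_subset_of_realizes h),
      hM.theta_eq_of_mem_cluster hx, h.last_eq, pair]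
  have hτ : M.SatT x (tauF φ.atoms (M.typeAt φ.atoms x)) :=
    (satT_tauF (M.typeAt_subset _ _)).2 rfl
  cases n with
  | zero =>
    rw [tauChainF, satT_and]
    exact ⟨hτ, hA⟩
  | succ n =>
    obtain ⟨h1, h2, v, hv, hwv, h3, -⟩ := h
    rw [satT_tauChainF_succ]
    refine ⟨hτ, hA, ?_⟩
    by_cases hIr : Ir φ.atoms φ.sigma c
    · -- the cluster of `w` is contained in that of `v`, so the type of `x` occurs there
      obtain ⟨⟨Θ', -, hle⟩, -⟩ := hIr
      have hmem : c.last.1 ∈ clusterReps φ.atoms := by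
        rw [h2]
        exact M.clusterRep_mem_clusterReps _ _
      rw [pairLE_iff (c := (c.init.last.1, Θ')) hmem h3.fst_last_mem, h2, h3.last_eq] at hle
      obtain ⟨y, hy, hyt⟩ := mem_clusterRep.1 (Multiset.mem_of_le hle.1
        (mem_clusterRep.2 ⟨x, hx, rfl⟩))
      refine ⟨y, (hM.below_of_rrel_of_below hx.2 (hM.below_of_below_of_rrel hwv hy.1)).1,
        fun _ => (satT_tauF (M.typeAt_subset _ _)).2 hyt, ?_⟩
      exact hc n (Nat.lt_succ_self n) c.init y (hM.final_of_mem_cluster hv hy)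
        (h3.of_mem_cluster hM hy)
    · exact ⟨v, (hM.below_of_rrel_of_below hx.2 hwv).1, fun h => (hIr h).elim,
        hc n (Nat.lt_succ_self n) c.init v hv h3⟩

/-- The role of the condition `Ir`. Let the cluster of a final world `u` of depth `n` contain a copy
of the lowest cluster of a semi-witnessing chain of depth `n + 1`, such that `u` agrees with the
chain as regards the remaining data. The chain condition yields a type that occurs in both clusters
only once; then `Ir` holds, and so the points of the copy cannot all see a point of the cluster of
their own type. -/
theorem not_embedded_of_mem_semiChains [Finite W] (hM : M.WeaklyTransitive) {c : CSeq (n + 1)}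
    (hcs : c ∈ semiChains φ.atoms φ.sigma (n + 1)) {u : W} (hu : M.HasDepth φ.sigma u n)
    (huf : M.Final φ.sigma u) (hp : M.pair φ n u = c.init.last)
    (hθ : M.theta φ.sigma (n + 1) u = c.last.2) (hle : c.last.1 ≤ M.clusterRep φ.atoms u)
    (hIr : Ir φ.atoms φ.sigma c → ∀ t ∈ c.last.1, 2 ≤ (M.clusterRep φ.atoms u).count t) :
    False := by
  obtain ⟨k, N, a, hN, ha, ha2, v, hvf, -, hv, hcond⟩ := exists_of_mem_semiChains hcs
  have hpv := hp.trans hv.last_eq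
  have hrep : M.clusterRep φ.atoms u = c.init.last.1 := (Prod.ext_iff.1 hp).1
  have hθv := theta_succ_eq_of_pair_eq hM hN hu hv.hasDepth huf hvf hpv
  have hex : ∃ t ∈ c.last.1, c.init.last.1.count t < 2 := by
    by_contra h
    push Not at h
    exact hcond h (hθ.symm.trans hθv)
  obtain ⟨t, ht, htc⟩ := hex
  have hmem : c.last.1 ∈ clusterReps φ.atoms := by
    rw [ha2]
    exact N.clusterRep_mem_clusterReps _ _
  refine absurd (hIr ⟨⟨M.theta φ.sigma (n + 1) u, ?_, ?_⟩, ?_⟩ t ht) (by rw [hrep]; omega)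
  · obtain ⟨k', N', a', hN', hroot, hsemi, -, -, -, hdep, -, hpair, -⟩ := hM.exists_fin_model φ u
    have h1 := Prod.ext_iff.1 ((hpair n).trans hp)
    exact ⟨k', N', a', hN', hroot, hsemi, (hdep n).2 hu, hN'.represents_iff.2 h1.1.symm, h1.2.symm,
      (Prod.ext_iff.1 (hpair (n + 1))).2.symm⟩
  · exact (pairLE_iff (c := (c.init.last.1, M.theta φ.sigma (n + 1) u)) hmem
      hv.fst_last_mem).2 ⟨hrep ▸ hle, hθ.symm⟩
  · obtain ⟨b, rfl⟩ := exists_fst_eq ht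
    refine ⟨b, fun b' hne hbb' => ?_⟩
    have := exists_ne_fst_eq_iff.1 ⟨b, b', hne, rfl, hbb'.symm⟩
    have := Multiset.count_le_of_le b.1 hle
    rw [hrep] at this
    omega

/-- For a semi-witnessing chain `C` of depth `n`, the formula `α(C)` finds a cluster of depth at
least `n` containing a copy of `C_n`. -/
theorem exists_of_satT_alpha [Finite W] (hM : M.WeaklyTransitive)
    (hs : ∀ m < n, DeltaSound φ M m) (hc : ∀ m < n, DeltaComplete φ M m) {c : CSeq n}
    (hcs : c ∈ semiChains φ.atoms φ.sigma n) {v : W} (h : M.SatT v (alpha φ.atoms φ.sigma c)) :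
    ∃ z, M.rrel v z ∧ c.last.1 ≤ M.clusterRep φ.atoms z ∧ M.theta φ.sigma n z = c.last.2 ∧
      M.DepthGE φ.sigma n z := by
  obtain ⟨z, hvz, h1, h2⟩ := hM.exists_of_satT_bigTangle (satT_alpha_iff.1 h)
  obtain ⟨k, N, a, hN, ha⟩ := exists_of_mem_semiChains hcs
  obtain ⟨hne, hsub, hcount⟩ := mem_clusterReps.1 ha.fst_last_mem
  have hτ : ∀ t ∈ c.last.1, ∀ x, M.SatT x (tauChainF φ.atoms φ.sigma
      (delta φ.atoms φ.sigma) c t) → M.typeAt φ.atoms x = t ∧ M.theta φ.sigma n x = c.last.2 := by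
    intro t ht x hx
    rw [← satT_aF_iff_theta_eq hM hs hc (last_snd_subset_of_realizes ha),
      ← satT_tauF (hsub t ht)]
    cases n with
    | zero =>
      rw [tauChainF] at hx
      exact hx
    | succ n =>
      rw [satT_tauChainF_succ] at hx
      exact ⟨hx.1, hx.2.1⟩
  have hle : c.last.1 ≤ M.clusterRep φ.atoms z := by
    refine (le_iff_of_count_le_two hcount).2 ⟨fun t ht => ?_, fun t ht => ?_⟩
    · obtain ⟨x, hx, hxt⟩ := h1 t ht
      exact mem_clusterRep.2 ⟨x, hx, (hτ t ht x hxt).1⟩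
    · obtain ⟨x, hx, y, hy, hr, hxt, hyt⟩ := h2 t ht
      have ht' : t ∈ c.last.1 := Multiset.count_pos.1 (by omega)
      exact two_le_count_clusterRep.2 ⟨x, hx, y, hy, hr, (hτ t ht' x hxt).1, (hτ t ht' y hyt).1⟩
  obtain ⟨t₀, ht₀⟩ := Multiset.exists_mem_of_ne_zero hne
  obtain ⟨x₀, hx₀, hxt₀⟩ := h1 t₀ ht₀
  have hθ : M.theta φ.sigma n z = c.last.2 := by
    rw [← (hτ t₀ ht₀ x₀ hxt₀).2, hM.theta_eq_of_mem_cluster hx₀]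
  refine ⟨z, hvz, hle, hθ, ?_⟩
  cases n with
  | zero => trivial
  | succ n =>
    have hinit := init_mem_chains hcs
    have hsn := hs n (Nat.lt_succ_self n) c.init hinit
    obtain ⟨-, -, y, hr, -, hy⟩ := satT_tauChainF_succ.1 hxt₀
    obtain ⟨u, hyu, huf, hu, hp⟩ := hsn y hy
    rcases mem_cluster_or_below (hM.rrel_trans (hM.rrel_trans hx₀.1 (.inr hr)) hyu) with huz | hzu
    · exfalso
      rw [← hM.clusterRep_eq_of_mem_cluster huz] at hle
      rw [← hM.theta_eq_of_mem_cluster huz] at hθ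
      refine not_embedded_of_mem_semiChains hM hcs hu huf hp hθ hle fun hIr t ht => ?_
      obtain ⟨x, hx, hxt⟩ := h1 t ht
      obtain ⟨-, -, y, hr, hyt, hy⟩ := satT_tauChainF_succ.1 hxt
      obtain ⟨u', hyu', huf', hu', -⟩ := hsn y hy
      have hxu : x ∈ M.cluster u := hM.mem_cluster_trans hx (mem_cluster_symm huz)
      have huy := hM.rrel_trans hxu.1 (.inr hr)
      have huu' := hM.mem_cluster_of_hasDepth hu (hM.rrel_trans huy hyu') huf' hu'
      refine two_le_count_clusterRep.2 ⟨x, hxu, y, ⟨huy, hM.rrel_trans hyu' huu'.2⟩, hr,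
        (hτ t ht x hxt).1, ?_⟩
      exact (satT_tauF (hsub t ht)).1 (hyt hIr)
    · exact ⟨u, huf, hzu, hu.1⟩

/-- Above a world of depth `n`, the formulas `α(C)` for witnessing chains `C` of depth `n` only hold
in the cluster of that world. -/
theorem mem_cluster_of_satT_alpha [Finite W] (hM : M.WeaklyTransitive)
    (hs : ∀ m < n, DeltaSound φ M m) (hc : ∀ m < n, DeltaComplete φ M m) {c : CSeq n}
    (hcs : c ∈ chains φ.atoms φ.sigma n) {w v : W} (hw : M.HasDepth φ.sigma w n)
    (hwv : M.rrel w v) (h : M.SatT v (alpha φ.atoms φ.sigma c)) :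
    v ∈ M.cluster w ∧ c.last.1 ≤ M.clusterRep φ.atoms w ∧ c.last.2 = M.theta φ.sigma n w := by
  obtain ⟨z, hvz, hle, hθ, hz⟩ := exists_of_satT_alpha hM hs hc (mem_semiChains_of_mem_chains hcs) h
  obtain ⟨k, N, a, hN, hf, ha⟩ := exists_of_mem_chains hcs
  have hwz := hM.rrel_trans hwv hvz
  have hzn : M.HasDepth φ.sigma z n := ⟨hz, fun h => hw.2 (hM.depthGE_of_rrel hwz h)⟩
  have hzf : M.Final φ.sigma z := by
    refine final_of_clusterRep_le hM hN hzn ha.hasDepth hf ?_ ?_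
    · rwa [ha.last_eq] at hle
    · rwa [ha.last_eq] at hθ
  have hzw := hM.mem_cluster_of_hasDepth hw hwz hzf hzn
  rw [← hM.clusterRep_eq_of_mem_cluster hzw, ← hM.theta_eq_of_mem_cluster hzw]
  exact ⟨⟨hwv, hM.rrel_trans hvz hzw.2⟩, hle, hθ.symm⟩

/-- `β(C)` and `γ(C)` hold at a final world of depth `n` with chain `C`, because formulas `α(C')`
true at or above that world are true in its own cluster. -/
theorem deltaComplete_of_lt [Finite W] (hM : M.WeaklyTransitive)
    (hs : ∀ m < n, DeltaSound φ M m) (hc : ∀ m < n, DeltaComplete φ M m) :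
    DeltaComplete φ M n := by
  intro c w hf h
  rw [satT_delta_iff]
  refine ⟨h.satT_alpha hM hs hc, ?_, ?_⟩
  · rintro v hr ⟨c', hc', -, hv⟩
    have hvw := (mem_cluster_of_satT_alpha hM hs hc hc' h.hasDepth (.inr hr) hv).1
    exact (h.of_mem_cluster hM hvw).satT_alpha hM hs hc
  · intro c' hc' hw
    obtain ⟨-, h1, h2⟩ := mem_cluster_of_satT_alpha hM hs hc hc' h.hasDepth (.inl rfl) hw
    obtain ⟨k, N, a, hN, -, ha⟩ := exists_of_mem_chains hc'
    rw [pairLE_iff ha.fst_last_mem h.fst_last_mem, h.last_eq]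
    exact ⟨h1, h2⟩

/-- The cluster found by `α(C)` either has depth `n`, and is then final, or lies below a final
cluster of depth `n`. In both cases `γ(C)` bounds the final cluster from above; in the second case
`β(C)` bounds it from below. -/
theorem deltaSound_of_lt [Finite W] (hM : M.WeaklyTransitive)
    (hs : ∀ m < n, DeltaSound φ M m) (hc : ∀ m < n, DeltaComplete φ M m) :
    DeltaSound φ M n := by
  intro c hcs v hv
  obtain ⟨hα, hβ, hγ⟩ := satT_delta_iff.1 hv
  obtain ⟨k, N, a, hN, hf, ha⟩ := exists_of_mem_chains hcs
  obtain ⟨z, hvz, hle, hθ, hz⟩ :=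
    exists_of_satT_alpha hM hs hc (mem_semiChains_of_mem_chains hcs) hα
  -- by `γ`, the final worlds of depth `n` seen from `v` have pairs `⊴` that of `c`
  have hbound : ∀ u, M.rrel v u → M.Final φ.sigma u → M.HasDepth φ.sigma u n →
      ∃ c' ∈ chains φ.atoms φ.sigma n, c'.last = M.pair φ n u ∧
        M.SatT u (alpha φ.atoms φ.sigma c') ∧ PairLE φ.atoms c'.last c.last ∧
        M.clusterRep φ.atoms u ≤ c.last.1 := by
    intro u hvu huf hu
    obtain ⟨c', h'⟩ := hM.exists_realizes hu huf
    have hc' := h'.mem_chains hM huf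
    have hαu := h'.satT_alpha hM hs hc
    have hPLE := hγ c' hc' (hM.satT_bigTangle_of_rrel hvu hαu)
    refine ⟨c', hc', h'.last_eq, hαu, hPLE, ?_⟩
    rw [pairLE_iff h'.fst_last_mem ha.fst_last_mem, h'.last_eq] at hPLE
    exact hPLE.1
  by_cases hzn : M.DepthGE φ.sigma (n + 1) z
  · obtain ⟨u, hzu, huf, hu⟩ := hM.exists_final_of_lt_depth hzn (Nat.lt_succ_self n)
    have hvu := hM.below_of_rrel_of_below hvz hzu
    obtain ⟨c', hc', hlast, hαu, hPLE, hle'⟩ := hbound u hvu.rrel huf hu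
    refine ⟨u, hvu.rrel, huf, hu, ?_⟩
    rcases hPLE with hlt | heq
    · have hαu' := hβ u hvu.1 ⟨c', hc', hlt, hαu⟩
      obtain ⟨-, h1, h2⟩ := mem_cluster_of_satT_alpha hM hs hc hcs hu (.inl rfl) hαu'
      exact Prod.ext (le_antisymm hle' h1) h2.symm
    · exact hlast.symm.trans heq
  · have hzn : M.HasDepth φ.sigma z n := ⟨hz, hzn⟩
    have hzf : M.Final φ.sigma z := by
      refine final_of_clusterRep_le hM hN hzn ha.hasDepth hf ?_ ?_
      · rwa [ha.last_eq] at hle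
      · rwa [ha.last_eq] at hθ
    obtain ⟨-, -, -, -, -, hle'⟩ := hbound z hvz hzf hzn
    exact ⟨z, hvz, hzf, hzn, Prod.ext (le_antisymm hle' hle) hθ⟩

end Step

theorem WeaklyTransitive.deltaSound_and_deltaComplete [Finite W] (hM : M.WeaklyTransitive)
    (φ : MuForm 0) (n : ℕ) : DeltaSound φ M n ∧ DeltaComplete φ M n := by
  induction n using Nat.strong_induction_on with
  | _ n ih =>
    have hs : ∀ m < n, DeltaSound φ M m := fun m hm => (ih m hm).1
    have hc : ∀ m < n, DeltaComplete φ M m := fun m hm => (ih m hm).2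
    exact ⟨deltaSound_of_lt hM hs hc, deltaComplete_of_lt hM hs hc⟩

theorem WeaklyTransitive.deltaSound [Finite W] (hM : M.WeaklyTransitive) (φ : MuForm 0) (n : ℕ) :
    DeltaSound φ M n :=
  (hM.deltaSound_and_deltaComplete φ n).1

theorem WeaklyTransitive.deltaComplete [Finite W] (hM : M.WeaklyTransitive) (φ : MuForm 0)
    (n : ℕ) : DeltaComplete φ M n :=
  (hM.deltaSound_and_deltaComplete φ n).2

end KModel

/-! ### The characteristic formula -/

namespace KModel

variable {W : Type*} {M : KModel W} {φ : MuForm 0} {n : ℕ}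

theorem satT_split_iff {P : Finset ℕ} {S : Finset (MuForm 0)} {w : W} :
    M.SatT w (split P S n) ↔
      (∃ c ∈ chains P S n, ∃ c' ∈ chains P S n, c.last ≠ c'.last ∧
        (∃ v, M.rrel w v ∧ M.SatT v (delta P S n c)) ∧
        ∃ v, M.rrel w v ∧ M.SatT v (delta P S n c')) ∨
      ∃ c ∈ semiChains P S (n + 1), c ∉ chains P S (n + 1) ∧ M.SatT w (alpha P S c) := by
  rw [split, satT_or, satT_bigOr, satT_bigOr]
  refine or_congr ⟨?_, ?_⟩ ⟨?_, ?_⟩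
  · rintro ⟨⟨c, c'⟩, hq, h⟩
    rw [Finset.mem_filter, Finset.mem_product] at hq
    rw [satT_and, satT_rdia, satT_rdia] at h
    exact ⟨c, hq.1.1, c', hq.1.2, hq.2, h⟩
  · rintro ⟨c, hc, c', hc', hne, h⟩
    refine ⟨(c, c'), Finset.mem_filter.2 ⟨Finset.mem_product.2 ⟨hc, hc'⟩, hne⟩, ?_⟩
    rw [satT_and, satT_rdia, satT_rdia]
    exact h
  · rintro ⟨c, hc, h⟩
    exact ⟨c, (Finset.mem_sdiff.1 hc).1, (Finset.mem_sdiff.1 hc).2, h⟩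
  · rintro ⟨c, hc, hc', h⟩
    exact ⟨c, Finset.mem_sdiff.2 ⟨hc, hc'⟩, h⟩

/-- Above a world of depth `n`, all final worlds of depth `n` lie in its cluster, and no world has
greater depth. -/
theorem WeaklyTransitive.not_satT_split_of_hasDepth [Finite W] (hM : M.WeaklyTransitive) {w : W}
    (hw : M.HasDepth φ.sigma w n) :
    ¬ M.SatT w (split φ.atoms φ.sigma n) := by
  rw [satT_split_iff]
  rintro (⟨c, hc, c', hc', hne, ⟨v, hwv, hv⟩, v', hwv', hv'⟩ | ⟨c, hc, -, h⟩)
  · have key : ∀ c ∈ chains φ.atoms φ.sigma n, ∀ v, M.rrel w v →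
        M.SatT v (delta φ.atoms φ.sigma n c) → c.last = M.pair φ n w := by
      intro c hc v hwv hv
      obtain ⟨u, hvu, huf, hu, hp⟩ := hM.deltaSound φ n c hc v hv
      have huw := hM.mem_cluster_of_hasDepth hw (hM.rrel_trans hwv hvu) huf hu
      rw [← hp, hM.pair_eq_of_mem_cluster huw]
    exact hne ((key c hc v hwv hv).trans (key c' hc' v' hwv' hv').symm)
  · obtain ⟨z, hwz, -, -, hz⟩ := exists_of_satT_alpha hM (fun m _ => hM.deltaSound φ m)
      (fun m _ => hM.deltaComplete φ m) hc h
    exact hw.2 (hM.depthGE_of_rrel hwz hz)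

/-- If `split(n)` fails at a world that is not final, then the cluster of this world is absorbed by
the final clusters of depth `n` above it: otherwise the chain of such a cluster could be extended
to a semi-witnessing chain that is not a witnessing chain. -/
theorem WeaklyTransitive.absorbed_of_not_satT_split [Finite W] (hM : M.WeaklyTransitive) {w u : W}
    (hw : M.HasDepth φ.sigma w (n + 1)) (hwf : ¬ M.Final φ.sigma w)
    (hs : ¬ M.SatT w (split φ.atoms φ.sigma n)) (hwu : M.Below w u)
    (hu : M.HasDepth φ.sigma u n) (huf : M.Final φ.sigma u) :
    (∀ t ∈ M.clusterRep φ.atoms w, 2 ≤ (M.clusterRep φ.atoms u).count t) ∧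
      M.theta φ.sigma (n + 1) w = M.theta φ.sigma (n + 1) u := by
  obtain ⟨c, hc⟩ := hM.exists_realizes hu huf
  by_contra hcond
  have hreal : Realizes φ M (c.extend (M.pair φ (n + 1) w)) w := by
    refine ⟨hw, CSeq.last_extend _ _, u, huf, hwu, by rwa [CSeq.init_extend], ?_⟩
    rw [CSeq.last_extend, CSeq.init_extend, hc.last_eq]
    exact fun h1 h2 => hcond ⟨h1, h2⟩
  exact hs (satT_split_iff.2 (.inr ⟨_, hreal.mem_semiChains hM,
    fun h => hwf (hreal.final_of_mem_chains hM h),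
    hreal.satT_alpha hM (fun m _ => hM.deltaSound φ m) (fun m _ => hM.deltaComplete φ m)⟩))

theorem Realizes.mem_evalTriples [Finite W] (hM : M.WeaklyTransitive) {c : CSeq n} {w : W}
    (h : Realizes φ M c w) (hf : M.Final φ.sigma w) (hw : M.Sat w φ) :
    (M.typeAt φ.atoms w, some c, M.theta φ.sigma n w) ∈ evalTriples φ.atoms φ.sigma φ n := by
  obtain ⟨k, N, a, hN, hroot, hsemi, hfin, hfa, hsat, hdep, htype, hpair, hreal⟩ :=
    hM.exists_fin_model φ w
  have h' := hreal n c h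
  refine Finset.mem_filter.2 ⟨?_, k, N, a, hN, hroot, hsemi, (hsat φ φ.self_mem_sigma).2 hw,
    htype.symm, .inr ⟨hfa.2 hf, h'.hasDepth, (Prod.ext_iff.1 (hpair n)).2.symm, c, rfl,
      hN, hroot, hfin hf, h'.realizesAt hN⟩⟩
  refine Finset.mem_product.2 ⟨Finset.mem_powerset.2 (M.typeAt_subset _ _),
    Finset.mem_product.2 ⟨?_, ?_⟩⟩
  · exact Finset.some_mem_insertNone.2 (mem_allSeqs_of_realizesAt (h.realizesAt hM))
  · refine Finset.mem_powerset.2 fun q hq => ?_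
    obtain ⟨h1, h2⟩ := Finset.mem_product.1 (Finset.mem_powerset.1 theta_mem_powerset hq)
    have h1 := Finset.mem_range.1 h1
    exact Finset.mem_product.2 ⟨Finset.mem_range.2 (by omega), h2⟩

theorem WeaklyTransitive.mem_evalTriples_none [Finite W] (hM : M.WeaklyTransitive) {w : W}
    (hd : M.HasDepth φ.sigma w (n + 1)) (hf : ¬ M.Final φ.sigma w) (hw : M.Sat w φ) :
    (M.typeAt φ.atoms w, none, M.theta φ.sigma (n + 1) w) ∈ evalTriples φ.atoms φ.sigma φ n := by
  obtain ⟨k, N, a, hN, hroot, hsemi, hfin, hfa, hsat, hdep, htype, hpair, hreal⟩ :=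
    hM.exists_fin_model φ w
  refine Finset.mem_filter.2 ⟨?_, k, N, a, hN, hroot, hsemi, (hsat φ φ.self_mem_sigma).2 hw,
    htype.symm, .inl ⟨fun h => hf (hfa.1 h), (hdep _).2 hd, (Prod.ext_iff.1 (hpair _)).2.symm,
      rfl⟩⟩
  exact Finset.mem_product.2 ⟨Finset.mem_powerset.2 (M.typeAt_subset _ _),
    Finset.mem_product.2 ⟨Finset.none_mem_insertNone, theta_mem_powerset⟩⟩

theorem exists_of_mem_evalTriples_some {t : Finset ℕ} {c : CSeq n} {Θ : Finset (ℕ × MuForm 0)}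
    (h : (t, some c, Θ) ∈ evalTriples φ.atoms φ.sigma φ n) :
    ∃ (k : ℕ) (N : KModel (Fin k)) (a : Fin k), N.WeaklyTransitive ∧ N.Final φ.sigma a ∧
      Realizes φ N c a ∧ N.Sat a φ ∧ t = N.typeAt φ.atoms a := by
  obtain ⟨-, k, N, a, hN, -, -, hφ, ht, ⟨-, -, -, hc⟩ | ⟨hf, -, -, c', hc, -, -, hfin, hreal⟩⟩ :=
    Finset.mem_filter.1 h
  · exact absurd hc (Option.some_ne_none c)
  · obtain rfl := Option.some_injective _ hc
    exact ⟨k, N, a, hN, hf, realizes_of_realizesAt hN hreal fun x _ => hfin x, hφ, ht⟩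

theorem exists_of_mem_evalTriples_none {t : Finset ℕ} {Θ : Finset (ℕ × MuForm 0)}
    (h : (t, none, Θ) ∈ evalTriples φ.atoms φ.sigma φ n) :
    ∃ (k : ℕ) (N : KModel (Fin k)) (a : Fin k), N.WeaklyTransitive ∧ ¬ N.Final φ.sigma a ∧
      N.HasDepth φ.sigma a (n + 1) ∧ N.Sat a φ ∧ t = N.typeAt φ.atoms a ∧
      Θ = N.theta φ.sigma (n + 1) a := by
  obtain ⟨-, k, N, a, hN, -, -, hφ, ht, ⟨hf, hd, hΘ, -⟩ | ⟨-, -, -, c', hc, -⟩⟩ :=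
    Finset.mem_filter.1 h
  · exact ⟨k, N, a, hN, hf, hd, hφ, ht, hΘ⟩
  · exact absurd hc.symm (Option.some_ne_none c')

/-- The conjunct `⟨n⟩ ⊤ ∧ ¬ ⟨n + 1⟩ ⊤` of the characteristic formula fixes the depth. -/
theorem WeaklyTransitive.hasDepth_of_depthDia [Finite W] (hM : M.WeaklyTransitive) {w : W}
    (h : M.DepthDia φ.sigma n .top w) (h' : ¬ M.DepthDia φ.sigma (n + 1) .top w) :
    (M.Final φ.sigma w → M.HasDepth φ.sigma w n) ∧
      (¬ M.Final φ.sigma w → M.HasDepth φ.sigma w (n + 1)) := by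
  obtain ⟨x, hxf, hwx, hx, -⟩ := h
  obtain ⟨m, hm⟩ := hM.exists_hasDepth φ.sigma w
  have hle := hM.depth_le_of_rrel hm hwx hx
  have hub : m ≤ n + 1 := by
    by_contra hlt
    obtain ⟨v, hwv, hvf, hv⟩ := hM.exists_final_of_lt_depth hm.1 (m := n + 1) (by omega)
    exact h' ⟨v, hvf, hwv.rrel, hv, trivial⟩
  constructor
  · intro hf
    have hne : m ≠ n + 1 := by
      rintro rfl
      exact h' ⟨w, hf, .inl rfl, hm, trivial⟩
    obtain rfl : m = n := by omega
    exact hm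
  · intro hf
    have hb : M.Below w x := (mem_cluster_or_below hwx).resolve_left fun hc =>
      hf ((hM.final_iff_of_mem_cluster hc).1 hxf)
    have := hM.depth_lt_of_below hm hb hxf hx
    obtain rfl : m = n + 1 := by omega
    exact hm

theorem WeaklyTransitive.satT_angle_top_iff [Finite W] (hM : M.WeaklyTransitive) {w : W} :
    M.SatT w (.and (angle φ.atoms φ.sigma n .top) (.neg (angle φ.atoms φ.sigma (n + 1) .top))) ↔
      M.DepthDia φ.sigma n .top w ∧ ¬ M.DepthDia φ.sigma (n + 1) .top w := by
  rw [satT_and, satT_neg,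
    satT_angle_iff_depthDia hM (hM.deltaSound φ _) (hM.deltaComplete φ _) (.inr rfl),
    satT_angle_iff_depthDia hM (hM.deltaSound φ _) (hM.deltaComplete φ _) (.inr rfl)]

theorem WeaklyTransitive.satT_chi0_some_iff [Finite W] (hM : M.WeaklyTransitive) {w : W}
    {t : Finset ℕ} (ht : t ⊆ φ.atoms) {c : CSeq n} {Θ : Finset (ℕ × MuForm 0)} :
    M.SatT w (chi0 φ.atoms φ.sigma n (t, some c, Θ)) ↔
      (M.DepthDia φ.sigma n .top w ∧ ¬ M.DepthDia φ.sigma (n + 1) .top w) ∧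
        ¬ M.SatT w (split φ.atoms φ.sigma n) ∧ M.typeAt φ.atoms w = t ∧
        ∃ v, M.rrel w v ∧ M.SatT v (delta φ.atoms φ.sigma n c) := by
  rw [chi0, satT_and, hM.satT_angle_top_iff, satT_and, satT_and, satT_neg, satT_tauF ht, satT_rdia]

theorem WeaklyTransitive.satT_chi0_none_iff [Finite W] (hM : M.WeaklyTransitive) {w : W}
    {t : Finset ℕ} (ht : t ⊆ φ.atoms) {Θ : Finset (ℕ × MuForm 0)}
    (hΘ : Θ ⊆ Finset.range (n + 1) ×ˢ φ.sigma) :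
    M.SatT w (chi0 φ.atoms φ.sigma n (t, none, Θ)) ↔
      (M.DepthDia φ.sigma n .top w ∧ ¬ M.DepthDia φ.sigma (n + 1) .top w) ∧
        M.SatT w (split φ.atoms φ.sigma n) ∧ M.typeAt φ.atoms w = t ∧
        M.theta φ.sigma (n + 1) w = Θ := by
  rw [chi0, satT_and, hM.satT_angle_top_iff, satT_and, satT_and, satT_tauF ht,
    satT_aF_iff_theta_eq hM (fun m _ => hM.deltaSound φ m) (fun m _ => hM.deltaComplete φ m) hΘ]

theorem satT_chi_iff {w : W} : M.SatT w (chi φ) ↔ ∃ n < φ.sigma.card,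
    ∃ q ∈ evalTriples φ.atoms φ.sigma φ n, M.SatT w (chi0 φ.atoms φ.sigma n q) := by
  simp only [chi, satT_bigOr, Finset.mem_range]

theorem WeaklyTransitive.satT_chi_of_sat [Finite W] (hM : M.WeaklyTransitive) {w : W}
    (hφ : M.Sat w φ) : M.SatT w (chi φ) := by
  rw [satT_chi_iff]
  by_cases hf : M.Final φ.sigma w
  · obtain ⟨n, hn⟩ := hM.exists_hasDepth φ.sigma w
    obtain ⟨c, hc⟩ := hM.exists_realizes hn hf
    refine ⟨n, hM.lt_card_of_final hf hn.1, _, hc.mem_evalTriples hM hf hφ, ?_⟩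
    rw [hM.satT_chi0_some_iff (M.typeAt_subset _ _)]
    refine ⟨⟨⟨w, hf, .inl rfl, hn, trivial⟩, ?_⟩, hM.not_satT_split_of_hasDepth hn, rfl, w,
      .inl rfl, hM.deltaComplete φ n c w hf hc⟩
    rintro ⟨x, -, hwx, hx, -⟩
    have := hM.depth_le_of_rrel hn hwx hx
    omega
  · obtain ⟨m, hm⟩ := hM.exists_hasDepth φ.sigma w
    have hpos : 0 < m := by
      obtain ⟨x, hwx, hxf⟩ := hM.exists_final φ w
      have hb : M.Below w x := (mem_cluster_or_below hwx).resolve_left fun hc =>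
        hf ((hM.final_iff_of_mem_cluster hc).1 hxf)
      exact hM.le_of_depthGE (k := 1) ⟨x, hxf, hb, trivial⟩ hm
    obtain ⟨n, rfl⟩ : ∃ n, m = n + 1 := ⟨m - 1, by omega⟩
    obtain ⟨u, hwu, huf, hu⟩ := hM.exists_final_of_lt_depth hm.1 (Nat.lt_succ_self n)
    have hdia : M.DepthDia φ.sigma n .top w ∧ ¬ M.DepthDia φ.sigma (n + 1) .top w := by
      refine ⟨⟨u, huf, hwu.rrel, hu, trivial⟩, ?_⟩
      rintro ⟨x, hxf, hwx, hx, -⟩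
      exact hf ((hM.final_iff_of_mem_cluster (hM.mem_cluster_of_hasDepth hm hwx hxf hx)).1 hxf)
    refine ⟨n, hM.lt_card_of_final huf hu.1, ?_⟩
    by_cases hs : M.SatT w (split φ.atoms φ.sigma n)
    · refine ⟨_, hM.mem_evalTriples_none hm hf hφ, ?_⟩
      rw [hM.satT_chi0_none_iff (M.typeAt_subset _ _)
        (Finset.mem_powerset.1 theta_mem_powerset)]
      exact ⟨hdia, hs, rfl, rfl⟩
    · -- `w` satisfies the same formulas as a point of the final cluster that absorbs it
      obtain ⟨hrep, hθ⟩ := hM.absorbed_of_not_satT_split hm hf hs hwu hu huf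
      obtain ⟨y, hy, hyw⟩ := mem_clusterRep.1 (Multiset.count_pos.1 (Nat.zero_lt_two.trans_le
        (hrep _ (mem_clusterRep.2 ⟨w, M.mem_cluster_self w, rfl⟩))))
      have hyφ := (hM.sat_iff_of_absorbed hm hu hwu hθ hrep (M.mem_cluster_self w) hy hyw.symm
        φ φ.self_mem_sigma).1 hφ
      have hyf := hM.final_of_mem_cluster huf hy
      obtain ⟨c, hc⟩ := hM.exists_realizes ((hM.hasDepth_iff_of_mem_cluster hy).2 hu) hyf
      refine ⟨_, hc.mem_evalTriples hM hyf hyφ, ?_⟩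
      rw [hM.satT_chi0_some_iff (M.typeAt_subset _ _)]
      exact ⟨hdia, hs, hyw.symm, y, hM.rrel_trans hwu.rrel hy.1, hM.deltaComplete φ n c y hyf hc⟩

theorem WeaklyTransitive.sat_of_satT_chi [Finite W] (hM : M.WeaklyTransitive) {w : W}
    (h : M.SatT w (chi φ)) : M.Sat w φ := by
  obtain ⟨n, -, ⟨t, _ | c, Θ⟩, hq, h⟩ := satT_chi_iff.1 h
  · obtain ⟨k, N, a, hN, haf, ha, haφ, rfl, rfl⟩ := exists_of_mem_evalTriples_none hq
    rw [hM.satT_chi0_none_iff (N.typeAt_subset _ _)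
      (Finset.mem_powerset.1 theta_mem_powerset)] at h
    obtain ⟨⟨hd, hd'⟩, hs, ht, hθ⟩ := h
    obtain ⟨h1, h2⟩ := hM.hasDepth_of_depthDia hd hd'
    have hf : ¬ M.Final φ.sigma w := fun hf => hM.not_satT_split_of_hasDepth (h1 hf) hs
    exact (sat_iff_of_not_final hM hN (h2 hf) ha hf haf ht hθ φ φ.self_mem_sigma).2 haφ
  · obtain ⟨k, N, a, hN, haf, ha, haφ, rfl⟩ := exists_of_mem_evalTriples_some hq
    rw [hM.satT_chi0_some_iff (N.typeAt_subset _ _)] at h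
    obtain ⟨⟨hd, hd'⟩, hs, ht, v, hwv, hv⟩ := h
    obtain ⟨h1, h2⟩ := hM.hasDepth_of_depthDia hd hd'
    obtain ⟨u, hvu, huf, hu, hp⟩ := hM.deltaSound φ n c (ha.mem_chains hN haf) v hv
    have hwu := hM.rrel_trans hwv hvu
    have hp' := hp.trans ha.last_eq
    by_cases hf : M.Final φ.sigma w
    · have hwc := mem_cluster_symm (hM.mem_cluster_of_hasDepth (h1 hf) hwu huf hu)
      exact (sat_iff_of_pair_eq hM hN hu ha.hasDepth hp' hwc (N.mem_cluster_self a) ht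
        φ φ.self_mem_sigma).2 haφ
    · have hb : M.Below w u := (mem_cluster_or_below hwu).resolve_left fun hc =>
        hf ((hM.final_iff_of_mem_cluster hc).1 huf)
      obtain ⟨hrep, hθ⟩ := hM.absorbed_of_not_satT_split (h2 hf) hf hs hb hu huf
      obtain ⟨y, hy, hyw⟩ := mem_clusterRep.1 (Multiset.count_pos.1 (Nat.zero_lt_two.trans_le
        (hrep _ (mem_clusterRep.2 ⟨w, M.mem_cluster_self w, rfl⟩))))
      have hyφ := (sat_iff_of_pair_eq hM hN hu ha.hasDepth hp' hy (N.mem_cluster_self a)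
        (hyw.trans ht) φ φ.self_mem_sigma).2 haφ
      exact (hM.sat_iff_of_absorbed (h2 hf) hu hb hθ hrep (M.mem_cluster_self w) hy hyw.symm
        φ φ.self_mem_sigma).2 hyφ

end KModel

end TangleLogic

end

theorem mainTheorem2 {W : Type*} [Finite W] (M : TangleLogic.KModel W)
    (hM : M.WeaklyTransitive) (w : W) (hw : M.IsRoot w) (φ : TangleLogic.MuForm 0) :
    M.Sat w φ ↔ M.SatT w (TangleLogic.chi φ) :=
  ⟨hM.satT_chi_of_sat, hM.sat_of_satT_chi⟩
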